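/- A simple two-dimensional lattice path is a nonempty finite sequence of steps from $\{\uparrow,\rightarrow,\downarrow,\leftarrow\}$. For a path $\ell$ of length at least $2$, its reduction $\Phi_L(\ell)$ is obtained as follows. If $\ell$ starts with a vertical step, rotate the entire path clockwise by $90^\circ$. If the resulting path ends with a horizontal step, rotate this last step clockwise by $90^\circ$. The path is now a concatenation of segments, each consisting of a maximal nonempty run of horizontal steps followed by a maximal nonempty run of vertical steps. Replace each segment by a single step determined by its first horizontal and its first vertical step: $(\rightarrow,\uparrow)\mapsto\nearrow$, $(\rightarrow,\downarrow)\mapsto\searrow$, $(\leftarrow,\downarrow)\mapsto\swarrow$, $(\leftarrow,\uparrow)\mapsto\nwarrow$; finally rotate the path by $45^\circ$ clockwise (so $\nearrow$ becomes $\rightarrow$, $\searrow$ becomes $\downarrow$, $\swarrow$ becomes $\leftarrow$, $\nwarrow$ becomes $\uparrow$). The reduction degree of $\ell$ is the unique $r\ge 0$ such that $\Phi_L^{r}(\ell)$ is a single step. Let $D_n$ be the reduction degree of a uniformly random path among the $4^n$ paths of length $n$. Let $\gamma$ be the Euler–Mascheroni constant, $\zeta$ the Riemann zeta function, $\psi=\Gamma'/\Gamma$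 the digamma function, $\log$ the natural logarithm, and for nonzero integers $k$ put $\chi_k = \frac{2\pi i k}{\log 2}$, \[ c_k = \frac{2}{\sqrt{\pi}\,\log^2 2}\,\Gamma\Big(\frac{3+\chi_k}{2}\Big)\zeta(1+\chi_k), \] \[ d_k = \frac{4}{\sqrt{\pi}\,\log^2 2}\,\Gamma\Big(\frac{3+\chi_k}{2}\Big)\big(\psi(2+\chi_k)\zeta(1+\chi_k)+\zeta'(1+\chi_k)\big) - 3c_k\log 2. \] **Theorem.** For every $x\in\mathbb{R}$ the series \[ \delta_1(x) = \log 2\sum_{k\ne 0} c_k e^{2k\pi i x}, \qquad \delta_2(x) = \sum_{k\neq 0}\Big(d_k - c_k\,\psi\Big(1+\frac{\chi_k}{2}\Big)\Big)e^{2k\pi i x} \] converge absolutely to real numbers, and they define $1$-periodic functions with mean zero, that is, $\int_0^1\delta_j(x)\,dx=0$. As $n\to\infty$, the expected value satisfies \[ \mathbb{E} D_n = \log_4 n + \frac{\gamma+2-3\log 2}{2\log 2} + \delta_1(\log_4 n) + O(n^{-1}), \] and the variance satisfies \[ \mathbb{V} D_n = \frac{\pi^2 - 24\log^2\pi - 48\zeta''(0)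 - 24}{24\log^2 2} - \frac{2\log\pi}{\log 2} - \frac{11}{12} + \delta_2(\log_4 n) - \frac{\gamma+2-3\log 2}{\log 2}\,\delta_1(\log_4 n) - \delta_1^2(\log_4 n) + O\Big(\frac{\log n}{n}\Big), \] where $\zeta''(0)$ is real. -/

import Mathlib

/-- The four unit steps of a simple two-dimensional lattice path. -/
inductive Step where
  | up
  | right
  | down
  | left
  deriving DecidableEq

namespace Step

instance : Fintype Step := ⟨{up, right, down, left}, fun s => by cases s <;> simp⟩

instance : MeasurableSpace Step := ⊤

instance : DiscreteMeasurableSpace Step := ⟨fun _ => trivial⟩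

/-- Whether a step is horizontal (as opposed to vertical). -/
def isHorizontal : Step → Bool
  | right => true
  | left => true
  | up => false
  | down => false

/-- Clockwise rotation of a step by a right angle. -/
def rotate : Step → Step
  | up => right
  | right => down
  | down => left
  | left => up

/-- The step replacing a horizontal-vertical segment whose first horizontal step is `h` and
whose first vertical step is `v`: the diagonal step in direction `h + v`, rotated clockwise
by 45 degrees (north-east becomes right, south-east becomes down, south-west becomes left,
north-west becomes up). The value is irrelevant unless `h` is horizontal and `v` is vertical. -/
def merge : Step → Step → Step
  | right, up => right
  | right, down => down
  | left, down => left
  | left, up => up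
  | h, _ => h

end Step

namespace LatticePath

/-- If the path starts vertically, rotate the entire path clockwise. -/
def rotateAll : List Step → List Step
  | [] => []
  | a :: l => if a.isHorizontal then a :: l else (a :: l).map Step.rotate

/-- If the path ends horizontally, rotate its very last step clockwise. -/
def rotateLast : List Step → List Step
  | [] => []
  | [a] => if a.isHorizontal then [a.rotate] else [a]
  | a :: b :: l => a :: rotateLast (b :: l)

/-- Collapse each horizontal-vertical segment of a path that starts horizontally and ends
vertically into a single step. A segment is a maximal nonempty run of horizontal steps
(first step `a`) followed by a maximal nonempty run of vertical steps (first step `b`). -/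
def collapse : List Step → List Step
  | [] => []
  | a :: l =>
    match h : l.dropWhile (fun s => s.isHorizontal) with
    | [] => []
    | b :: l' => Step.merge a b :: collapse (l'.dropWhile (fun s => !s.isHorizontal))
  termination_by l => l.length
  decreasing_by
    have h1 := (List.dropWhile_sublist (l := l) (fun s => s.isHorizontal)).length_le
    have h2 := (List.dropWhile_sublist (l := l') (fun s => !s.isHorizontal)).length_le
    rw [h] at h1
    simp only [List.length_cons] at h1 ⊢
    omega

/-- The reduction `Φ_L`, a partial function: it is defined exactly on the paths of length at
least two. -/
def reduce (l : List Step) : Option (List Step) :=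
  if 2 ≤ l.length then some (collapse (rotateLast (rotateAll l))) else none

/-- The `n`-fold iterate of the partial function `reduce`. -/
def iterReduce : ℕ → List Step → Option (List Step)
  | 0, l => some l
  | n + 1, l => (reduce l).bind (iterReduce n)

/-- The `n`-fold reduction of `l` is defined and is a single step. -/
def ReducesToStepIn (l : List Step) (n : ℕ) : Prop :=
  ∃ s : Step, iterReduce n l = some [s]

/-- The reduction degree of a path: the number `n` such that the `n`-fold reduction of the
path is a single step. For a nonempty path there is exactly one such `n`, see
`rdeg_eq_iff`. -/
noncomputable def rdeg (l : List Step) : ℕ :=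
  sInf {n | ReducesToStepIn l n}

theorem length_rotateAll (l : List Step) : (rotateAll l).length = l.length := by
  cases l with
  | nil => rfl
  | cons a l => rw [rotateAll]; split_ifs <;> simp

theorem length_rotateLast (l : List Step) : (rotateLast l).length = l.length := by
  fun_induction rotateLast l <;> simp_all

theorem two_mul_length_collapse_le (l : List Step) :
    2 * (collapse l).length ≤ l.length := by
  fun_induction collapse l with
  | case1 => simp
  | case2 => simp
  | case3 a l b l' h ih =>
    have h1 := (List.dropWhile_sublist (l := l) (fun s => s.isHorizontal)).length_le
    have h2 := (List.dropWhile_sublist (l := l') (fun s => !s.isHorizontal)).length_le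
    rw [h] at h1
    simp only [List.length_cons] at h1 ⊢
    omega

theorem exists_vertical_mem_rotateLast (l : List Step) (hl : l ≠ []) :
    ∃ s ∈ rotateLast l, s.isHorizontal = false := by
  fun_induction rotateLast l with
  | case1 => simp at hl
  | case2 a h => exact ⟨a.rotate, by simp, by cases a <;> simp_all [Step.isHorizontal, Step.rotate]⟩
  | case3 a h => exact ⟨a, by simp, by simpa using h⟩
  | case4 a b l ih =>
    obtain ⟨s, hs, h⟩ := ih (by simp)
    exact ⟨s, List.mem_cons_of_mem _ hs, h⟩

theorem collapse_ne_nil (a : Step) (l : List Step) (h : ∃ s ∈ l, s.isHorizontal = false) :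
    collapse (a :: l) ≠ [] := by
  rw [collapse]
  split
  · rename_i h0
    rw [List.dropWhile_eq_nil_iff] at h0
    obtain ⟨s, hs, h⟩ := h
    have := h0 s hs
    simp_all
  · simp

theorem reduce_spec (l : List Step) (hl : 2 ≤ l.length) :
    ∃ l', reduce l = some l' ∧ l' ≠ [] ∧ l'.length < l.length := by
  refine ⟨_, if_pos hl, ?_, ?_⟩
  · have hlen := length_rotateAll l
    match hr : rotateAll l with
    | [] => rw [hr] at hlen; simp at hlen; omega
    | [a] => rw [hr] at hlen; simp at hlen; omega
    | a :: b :: t =>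
      rw [rotateLast]
      exact collapse_ne_nil _ _ (exists_vertical_mem_rotateLast _ (by simp))
  · have := two_mul_length_collapse_le (rotateLast (rotateAll l))
    rw [length_rotateLast, length_rotateAll] at this
    omega

theorem existsUnique_reducesToStepIn (l : List Step) (hl : l ≠ []) :
    ∃! n, ReducesToStepIn l n := by
  induction hk : l.length using Nat.strong_induction_on generalizing l with
  | _ k ih =>
    by_cases h2 : 2 ≤ l.length
    · obtain ⟨l', hr, hne, hlt⟩ := reduce_spec l h2
      obtain ⟨n, hn, hu⟩ := ih _ (hk ▸ hlt) l' hne rfl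
      refine ⟨n + 1, ?_, ?_⟩
      · simpa [ReducesToStepIn, iterReduce, hr] using hn
      · rintro (_ | m) hm
        · obtain ⟨s, hs⟩ := hm
          simp only [iterReduce, Option.some.injEq] at hs
          simp [hs] at h2
        · congr 1
          exact hu m (by simpa [ReducesToStepIn, iterReduce, hr] using hm)
    · match l, hl, h2 with
      | [a], _, _ =>
        refine ⟨0, ⟨a, rfl⟩, ?_⟩
        rintro (_ | m) hm
        · rfl
        · obtain ⟨s, hs⟩ := hm
          simp [iterReduce, reduce] at hs
      | a :: b :: t, _, h => simp at h

theorem rdeg_eq_iff (l : List Step) (hl : l ≠ []) (n : ℕ) :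
    rdeg l = n ↔ ∃ s : Step, iterReduce n l = some [s] := by
  obtain ⟨m, hm, hu⟩ := existsUnique_reducesToStepIn l hl
  have hr : ReducesToStepIn l (rdeg l) :=
    Nat.sInf_mem (s := {n | ReducesToStepIn l n}) ⟨m, hm⟩
  constructor
  · rintro rfl
    exact hr
  · intro h
    rw [hu _ hr, hu n h]

/-- The uniform distribution on the `4 ^ n` lattice paths of length `n`. -/
noncomputable def uniformPath (n : ℕ) : MeasureTheory.Measure (Fin n → Step) :=
  ProbabilityTheory.uniformOn Set.univ

/-- The random variable `D_n`: the reduction degree of a path of length `n`. -/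
noncomputable def D (n : ℕ) (p : Fin n → Step) : ℝ := (rdeg (List.ofFn p) : ℝ)

/-- The expected value of `D_n` under the uniform distribution. -/
noncomputable def expectedD (n : ℕ) : ℝ := ∫ p, D n p ∂(uniformPath n)

/-- The variance of `D_n` under the uniform distribution. -/
noncomputable def varianceD (n : ℕ) : ℝ := ProbabilityTheory.variance (D n) (uniformPath n)

/-- `χ_k = 2 π i k / log 2`. -/
noncomputable def chi (k : ℤ) : ℂ := 2 * Real.pi * Complex.I * k / Real.log 2

/-- The constants `c_k` (for `k ≠ 0`). -/
noncomputable def coeffC (k : ℤ) : ℂ :=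
  2 / (Real.sqrt Real.pi * Real.log 2 ^ 2) * Complex.Gamma ((3 + chi k) / 2)
    * riemannZeta (1 + chi k)

/-- The constants `d_k` (for `k ≠ 0`). -/
noncomputable def coeffD (k : ℤ) : ℂ :=
  4 / (Real.sqrt Real.pi * Real.log 2 ^ 2) * Complex.Gamma ((3 + chi k) / 2)
    * (Complex.digamma (2 + chi k) * riemannZeta (1 + chi k) + deriv riemannZeta (1 + chi k))
    - 3 * coeffC k * Real.log 2

/-- `f` is the real-valued function given by the (unconditionally convergent) Fourier series
with coefficients `a k`, where `k` ranges over the nonzero integers. -/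
def HasFourierSeries (a : ℤ → ℂ) (f : ℝ → ℝ) : Prop :=
  ∀ x : ℝ, HasSum
    (fun k : {k : ℤ // k ≠ 0} => a k * Complex.exp (2 * (k : ℤ) * Real.pi * Complex.I * x))
    (f x : ℂ)

/-- `f` is `1`-periodic with mean zero. -/
def IsPeriodicMeanZero (f : ℝ → ℝ) : Prop :=
  Function.Periodic f 1 ∧ IntervalIntegrable f MeasureTheory.volume 0 1 ∧
    ∫ x in (0 : ℝ)..1, f x = 0

end LatticePath

/-! Rotations and merging act bijectively on directions, so conditionally on its length the
reduction of a uniform path is again uniform. Hence the tail P(D_n ≥ r) obeys a linear recursion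
with binomial weights on odd indices (`degreeTail_succ`). Half-angle formulas diagonalise it: one
step sends the kernel at θ to the sum of the kernels at θ/2 and θ/2 + π, and the kernel at 0 is 1,
so r steps produce a sum over the angles of the 2^r-th roots of unity (`degreeTail_eq_sum_kernel`).
Expanding the kernel in frequencies and filtering by roots of unity gives a second formula, a sum of
m² C(2n, n + m) over positive multiples m of 2^r (`degreeTail_eq_sum_choose`).

Put t = 4^r / n. Both formulas converge to F(t) = (4/√π) t^(3/2) ∑ λ² exp(-λ² t) (`limitTail`), and
Jacobi's theta identity relates their limits. The kernel sum gives the error O(t/n), used for t ≤ 1;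
the binomial sum gives O(1/(tn)) for t ≥ 1. Together they are summable over r with total O(1/n).

The first two moments are ∑ P(D ≥ r) and ∑ (2r - 1) P(D ≥ r). Replacing the tail by F, with x =
log_4 n and q(u) = F(4^(-u)), leaves regularised sums S₁, S₂ over all integer translates q(x - r).
Index shifts show that S₁ - x and S₂ - 2x S₁ + x² are 1-periodic. Unfolding turns their Fourier
coefficients into values and derivatives, at χ_k / 2, of the Mellin transform N of F with its jump
removed.

Termwise integration and analytic continuation give N(s) = (4/√π) Γ(s + 3/2) ζ(2s + 1) - 1/s
(`mellin_reducedTail_eq`). For k ≠ 0 this yields c_k and d_k, the digamma term through the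
duplication formula. For k = 0 the zeta functional equation removes the singularity and brings in
ζ''(0); second-order Taylor data at 0 give the two means. Finally S₂ - S₁² equals the second
periodic function minus (S₁ - x)², which is the variance formula. -/

namespace LatticePath

/-! ### Combinatorics of one reduction and the recursion for the tails -/

/-- The sum of `F` over all lattice paths of length `n`. -/
def pathSum : ℕ → (List Step → ℝ) → ℝ
  | 0, F => F []
  | n + 1, F => ∑ s : Step, pathSum n (fun l => F (s :: l))

theorem sum_step (f : Step → ℝ) :
    ∑ s, f s = f .up + f .right + f .down + f .left := by
  have : (Finset.univ : Finset Step) = {.up, .right, .down, .left} := rfl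
  rw [this]
  simp [add_assoc]

theorem sum_ofFn (n : ℕ) (F : List Step → ℝ) :
    ∑ p : Fin n → Step, F (List.ofFn p) = pathSum n F := by
  induction n generalizing F with
  | zero => simp [pathSum]
  | succ n ih =>
    rw [pathSum, ← (Fin.consEquiv (fun _ => Step)).sum_comp, Fintype.sum_prod_type]
    refine Finset.sum_congr rfl fun s _ => ?_
    rw [← ih]
    refine Finset.sum_congr rfl fun p _ => ?_
    simp [Fin.consEquiv, List.ofFn_succ]

theorem pathSum_congr {n : ℕ} {F G : List Step → ℝ}
    (h : ∀ l : List Step, l.length = n → F l = G l) : pathSum n F = pathSum n G := by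
  induction n generalizing F G with
  | zero => exact h [] rfl
  | succ n ih =>
    exact Finset.sum_congr rfl fun s _ => ih fun l hl => h _ (by simp [hl])

theorem pathSum_const (n : ℕ) (c : ℝ) : pathSum n (fun _ => c) = 4 ^ n * c := by
  induction n with
  | zero => simp [pathSum]
  | succ n ih =>
    simp only [pathSum, ih, sum_step]
    ring

theorem pathSum_map_rotate (n : ℕ) (F : List Step → ℝ) :
    pathSum n (fun l => F (l.map Step.rotate)) = pathSum n F := by
  induction n generalizing F with
  | zero => rfl
  | succ n ih =>
    simp only [pathSum, sum_step, List.map_cons, Step.rotate]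
    rw [ih (fun l => F (.up :: l)), ih (fun l => F (.right :: l)), ih (fun l => F (.down :: l)),
      ih (fun l => F (.left :: l))]
    ring

theorem rotateLast_cons {l : List Step} (a : Step) (hl : l ≠ []) :
    rotateLast (a :: l) = a :: rotateLast l := by
  cases l with
  | nil => exact absurd rfl hl
  | cons b l => rw [rotateLast]

theorem collapse_cons_horizontal (a h : Step) (l : List Step) (hh : h.isHorizontal = true) :
    collapse (a :: h :: l) = collapse (a :: l) := by
  have h1 : ∀ m m' : List Step, m.dropWhile (fun s => s.isHorizontal) =
      m'.dropWhile (fun s => s.isHorizontal) → collapse (a :: m) = collapse (a :: m') := by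
    intro m m' hm
    rw [collapse, collapse]
    split <;> split <;> simp_all
  exact h1 _ _ (by simp [hh])

theorem collapse_cons_vertical (a b : Step) (l : List Step) (hb : b.isHorizontal = false) :
    collapse (a :: b :: l) =
      Step.merge a b :: collapse (l.dropWhile (fun s => !s.isHorizontal)) := by
  rw [collapse]
  split
  · rename_i h
    simp [hb] at h
  · rename_i b' l' h
    simp only [List.dropWhile_cons, hb] at h
    simp only [Bool.false_eq_true, if_false, List.cons.injEq] at h
    rw [h.1, h.2]

/-- Sum over the continuations of a horizontal run with first step `a`. -/
def horizontalSum (n : ℕ) (a : Step) (F : List Step → ℝ) : ℝ :=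
  pathSum n (fun l => F (collapse (a :: rotateLast l)))

/-- Sum over the continuations of a vertical run. -/
def verticalSum (n : ℕ) (F : List Step → ℝ) : ℝ :=
  pathSum n (fun l => F (collapse ((rotateLast l).dropWhile (fun s => !s.isHorizontal))))

theorem horizontalSum_succ (n : ℕ) (a : Step) (F : List Step → ℝ) :
    horizontalSum (n + 2) a F = 2 * horizontalSum (n + 1) a F
      + verticalSum (n + 1) (fun l => F (Step.merge a .up :: l))
      + verticalSum (n + 1) (fun l => F (Step.merge a .down :: l)) := by
  have hH : ∀ s : Step, s.isHorizontal = true →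
      pathSum (n + 1) (fun l => F (collapse (a :: rotateLast (s :: l))))
        = horizontalSum (n + 1) a F := fun s hs => pathSum_congr fun l hl => by
    rw [rotateLast_cons _ (by rintro rfl; simp at hl), collapse_cons_horizontal _ _ _ hs]
  have hV : ∀ s : Step, s.isHorizontal = false →
      pathSum (n + 1) (fun l => F (collapse (a :: rotateLast (s :: l))))
        = verticalSum (n + 1) (fun l => F (Step.merge a s :: l)) :=
    fun s hs => pathSum_congr fun l hl => by
    rw [rotateLast_cons _ (by rintro rfl; simp at hl), collapse_cons_vertical _ _ _ hs]
  rw [horizontalSum, pathSum, sum_step, hH .right rfl, hH .left rfl, hV .up rfl, hV .down rfl]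
  ring

theorem verticalSum_succ (n : ℕ) (F : List Step → ℝ) :
    verticalSum (n + 2) F = 2 * verticalSum (n + 1) F
      + horizontalSum (n + 1) .right F + horizontalSum (n + 1) .left F := by
  have hH : ∀ s : Step, s.isHorizontal = true →
      pathSum (n + 1) (fun l => F (collapse ((rotateLast (s :: l)).dropWhile
        (fun s => !s.isHorizontal))))
        = horizontalSum (n + 1) s F := fun s hs => pathSum_congr fun l hl => by
    rw [rotateLast_cons _ (by rintro rfl; simp at hl), List.dropWhile_cons]
    simp [hs]
  have hV : ∀ s : Step, s.isHorizontal = false →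
      pathSum (n + 1) (fun l => F (collapse ((rotateLast (s :: l)).dropWhile
        (fun s => !s.isHorizontal))))
        = verticalSum (n + 1) F :=
    fun s hs => pathSum_congr fun l hl => by
    rw [rotateLast_cons _ (by rintro rfl; simp at hl), List.dropWhile_cons]
    simp [hs]
  rw [verticalSum, pathSum, sum_step, hH .right rfl, hH .left rfl, hV .up rfl, hV .down rfl]
  ring

/-- Merging is a bijection from pairs (horizontal, vertical) onto the four steps. This makes the
reduced path uniform once its length is fixed. -/
theorem pathSum_succ_eq_merge (k : ℕ) (F : List Step → ℝ) :
    pathSum (k + 1) F = pathSum k (fun l => F (Step.merge .right .up :: l))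
      + pathSum k (fun l => F (Step.merge .right .down :: l))
      + (pathSum k (fun l => F (Step.merge .left .up :: l))
      + pathSum k (fun l => F (Step.merge .left .down :: l))) := by
  simp only [pathSum, sum_step, Step.merge]
  ring

/-- Count the changes between horizontal and vertical among the n + 1 transitions. Since the path
ends vertically, their number is odd from a horizontal run and even from a vertical one, and the
binomial coefficient places them. Only the first step of each new run is recorded, so the others
contribute a factor 2 each. The leading 2 arises because rotating the last step is two-to-one onto
the vertical steps. The two parities are linked by Pascal's rule and must be proved together; `R` is
any large enough cutoff, as the excess binomials vanish. -/
theorem horizontalSum_verticalSum_eq (n R : ℕ) (hR : n + 1 ≤ R) :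
    (∀ a F, horizontalSum (n + 1) a F = ∑ k ∈ Finset.range R,
      2 * ((2 : ℝ) ^ (n + 1) / 2 ^ (2 * k + 1) * (n + 1).choose (2 * k + 1)) *
        (pathSum k (fun l => F (Step.merge a .up :: l))
          + pathSum k (fun l => F (Step.merge a .down :: l)))) ∧
    (∀ F, verticalSum (n + 1) F = ∑ k ∈ Finset.range (R + 1),
      2 * ((2 : ℝ) ^ (n + 1) / 2 ^ (2 * k) * (n + 1).choose (2 * k)) * pathSum k F) := by
  induction n with
  | zero =>
    obtain ⟨R, rfl⟩ : ∃ m, R = m + 1 := ⟨R - 1, by omega⟩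
    constructor
    · intro a F
      rw [Finset.sum_range_succ', Finset.sum_eq_zero]
      · have h1 : ∀ b : Step, b.isHorizontal = false →
            collapse [a, b] = [Step.merge a b] := fun b hb => by
          rw [collapse_cons_vertical _ _ _ hb, List.dropWhile_nil, collapse]
        simp [horizontalSum, pathSum, sum_step, rotateLast, Step.isHorizontal, Step.rotate,
          h1 .up rfl, h1 .down rfl]
        ring
      · intro k _
        rw [Nat.choose_eq_zero_of_lt (by omega)]
        simp
    · intro F
      rw [Finset.sum_range_succ', Finset.sum_eq_zero]
      · simp [verticalSum, pathSum, sum_step, rotateLast, Step.isHorizontal, Step.rotate, collapse]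
        ring
      · intro k _
        rw [Nat.choose_eq_zero_of_lt (by omega)]
        simp
  | succ n ih =>
    obtain ⟨ihH, ihV⟩ := ih (by omega)
    constructor
    · intro a F
      rw [horizontalSum_succ, ihH, ihV, ihV, Finset.sum_range_succ, Finset.sum_range_succ _ R,
        Nat.choose_eq_zero_of_lt (show n + 1 < 2 * R by omega)]
      simp only [Nat.cast_zero, mul_zero, zero_mul, add_zero]
      rw [Finset.mul_sum, ← Finset.sum_add_distrib, ← Finset.sum_add_distrib]
      refine Finset.sum_congr rfl fun k _ => ?_
      rw [Nat.choose_succ_succ (n + 1) (2 * k)]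
      push_cast
      field_simp
      ring
    · intro F
      have hcomm : ∀ a b c d : ℝ, a + b + c + d = a + c + d + b := by intros; ring
      rw [verticalSum_succ, ihV, ihH, ihH, Finset.sum_range_succ', Finset.sum_range_succ' _ R,
        mul_add, Finset.mul_sum, hcomm,
        ← Finset.sum_add_distrib, ← Finset.sum_add_distrib]
      congr 1
      · refine Finset.sum_congr rfl fun k _ => ?_
        rw [show 2 * (k + 1) = 2 * k + 1 + 1 by ring, Nat.choose_succ_succ (n + 1) (2 * k + 1),
          pathSum_succ_eq_merge k F]
        push_cast
        field_simp
        ring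
      · simp
        ring

/-- The factor 4 combines the two-to-one normalisations of the first direction and of the last step.
-/
theorem pathSum_reduction (n R : ℕ) (hR : n + 1 ≤ R) (F : List Step → ℝ) :
    pathSum (n + 2) (fun l => F (collapse (rotateLast (rotateAll l)))) =
      ∑ k ∈ Finset.range R,
        4 * ((2 : ℝ) ^ (n + 1) / 2 ^ (2 * k + 1) * (n + 1).choose (2 * k + 1)) *
          pathSum (k + 1) F := by
  have hH : ∀ s : Step, s.isHorizontal = true →
      pathSum (n + 1) (fun l => F (collapse (rotateLast (rotateAll (s :: l)))))
        = horizontalSum (n + 1) s F := fun s hs => pathSum_congr fun l hl => by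
    rw [rotateAll, if_pos hs, rotateLast_cons _ (by rintro rfl; simp at hl)]
  have hV : ∀ s : Step, s.isHorizontal = false →
      pathSum (n + 1) (fun l => F (collapse (rotateLast (rotateAll (s :: l)))))
        = horizontalSum (n + 1) s.rotate F := fun s hs => by
    refine (pathSum_congr fun l hl => ?_).trans
      (pathSum_map_rotate _ (fun l => F (collapse (s.rotate :: rotateLast l))))
    rw [rotateAll, if_neg (by simp [hs]), List.map_cons,
      rotateLast_cons _ (by rintro h; simp [List.map_eq_nil_iff] at h; simp [h] at hl)]
  rw [pathSum, sum_step, hH .right rfl, hH .left rfl, hV .up rfl, hV .down rfl]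
  simp only [Step.rotate]
  rw [(horizontalSum_verticalSum_eq n R hR).1, (horizontalSum_verticalSum_eq n R hR).1,
    ← Finset.sum_add_distrib, ← Finset.sum_add_distrib, ← Finset.sum_add_distrib]
  refine Finset.sum_congr rfl fun k _ => ?_
  rw [pathSum_succ_eq_merge k F]
  ring

theorem rdeg_of_two_le {l : List Step} (hl : 2 ≤ l.length) :
    rdeg l = rdeg (collapse (rotateLast (rotateAll l))) + 1 := by
  obtain ⟨l', hr, hne, -⟩ := reduce_spec l hl
  have h : collapse (rotateLast (rotateAll l)) = l' := by
    rw [reduce, if_pos hl] at hr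
    exact Option.some.inj hr
  rw [h, rdeg_eq_iff l (by rintro rfl; simp at hl)]
  obtain ⟨s, hs⟩ := (rdeg_eq_iff l' hne _).1 rfl
  exact ⟨s, by rw [iterReduce, hr]; exact hs⟩

theorem rdeg_singleton (s : Step) : rdeg [s] = 0 :=
  (rdeg_eq_iff [s] (by simp) 0).2 ⟨s, rfl⟩

/-- The probability that a random path of length `n` has reduction degree at least `r`. -/
noncomputable def degreeTail (r n : ℕ) : ℝ :=
  pathSum n (fun l => if r ≤ rdeg l then 1 else 0) / 4 ^ n

theorem degreeTail_zero (n : ℕ) : degreeTail 0 n = 1 := by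
  simp [degreeTail, pathSum_const]

theorem degreeTail_succ (r n R : ℕ) (hR : n ≤ R) :
    degreeTail (r + 1) (n + 1) = ∑ k ∈ Finset.range R,
      2 / 2 ^ n * (n.choose (2 * k + 1) : ℝ) * degreeTail r (k + 1) := by
  cases n with
  -- A path of length 1 has degree 0, and the binomials of 0 at odd indices vanish, so both sides
  -- are 0.
  | zero => simp [degreeTail, pathSum, rdeg_singleton]
  | succ n =>
    have h : pathSum (n + 2) (fun l => if r + 1 ≤ rdeg l then (1 : ℝ) else 0) =
        pathSum (n + 2) (fun l => (fun m => if r ≤ rdeg m then (1 : ℝ) else 0)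
          (collapse (rotateLast (rotateAll l)))) :=
      pathSum_congr fun l hl => by
        simp only [rdeg_of_two_le (l := l) (by omega), Nat.add_le_add_iff_right]
    rw [degreeTail, h,
      pathSum_reduction n R hR (fun m => if r ≤ rdeg m then (1 : ℝ) else 0), Finset.sum_div]
    refine Finset.sum_congr rfl fun k _ => ?_
    rw [degreeTail, show (4 : ℝ) ^ (n + 1 + 1) = 4 * (2 ^ (n + 1) * 2 ^ (n + 1)) by
      rw [pow_succ, ← mul_pow]; norm_num; ring,
      show (4 : ℝ) ^ (k + 1) = 2 * 2 ^ (2 * k + 1) by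
      rw [pow_succ, pow_succ, pow_mul]; norm_num; ring]
    field_simp

end LatticePath


/-! ### Exact tail formulas: kernel sum and binomial sum -/

namespace LatticePath

theorem sum_choose_odd_even (n R : ℕ) (hR : n ≤ R) (x : ℝ) :
    ∑ k ∈ Finset.range R, (n.choose (2 * k + 1) : ℝ) * x ^ (2 * k + 1)
      = ((1 + x) ^ n - (1 - x) ^ n) / 2 ∧
    ∑ k ∈ Finset.range (R + 1), (n.choose (2 * k) : ℝ) * x ^ (2 * k)
      = ((1 + x) ^ n + (1 - x) ^ n) / 2 := by
  induction n with
  | zero =>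
    constructor
    · simp
    · rw [Finset.sum_range_succ', Finset.sum_eq_zero]
      · simp
      · intro k _
        rw [Nat.choose_eq_zero_of_lt (by omega)]
        simp
  | succ n ih =>
    obtain ⟨ho, he⟩ := ih (by omega)
    constructor
    · have he' := he
      rw [Finset.sum_range_succ, Nat.choose_eq_zero_of_lt (show n < 2 * R by omega)] at he'
      simp only [Nat.cast_zero, zero_mul, add_zero] at he'
      have : ((1 + x) ^ (n + 1) - (1 - x) ^ (n + 1)) / 2 =
          x * (((1 + x) ^ n + (1 - x) ^ n) / 2) + ((1 + x) ^ n - (1 - x) ^ n) / 2 := by ring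
      rw [this, ← he', ← ho, Finset.mul_sum, ← Finset.sum_add_distrib]
      refine Finset.sum_congr rfl fun k _ => ?_
      rw [Nat.choose_succ_succ n (2 * k)]
      push_cast
      ring
    · have : ((1 + x) ^ (n + 1) + (1 - x) ^ (n + 1)) / 2 =
          x * (((1 + x) ^ n - (1 - x) ^ n) / 2) + ((1 + x) ^ n + (1 - x) ^ n) / 2 := by ring
      rw [this, ← he, ← ho, Finset.sum_range_succ', Finset.sum_range_succ' _ R, Finset.mul_sum,
        ← add_assoc, ← Finset.sum_add_distrib]
      congr 1
      · refine Finset.sum_congr rfl fun k _ => ?_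
        rw [show 2 * (k + 1) = 2 * k + 1 + 1 by ring, Nat.choose_succ_succ n (2 * k + 1)]
        push_cast
        ring
      · simp

/-- Absorption, (2k + 1) C(n + 1, 2k + 1) = (n + 1) C(n, 2k), reduces this to the even sum. The
factor 1 - x² avoids the exponent n - 1 and so covers n = 0. -/
theorem sum_mul_choose_odd (n R : ℕ) (hR : n ≤ R) (x : ℝ) :
    (1 - x ^ 2) * ∑ k ∈ Finset.range R, (n.choose (2 * k + 1) : ℝ) * ((2 * k + 1) * x ^ (2 * k))
      = n / 2 * ((1 - x) * (1 + x) ^ n + (1 + x) * (1 - x) ^ n) := by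
  cases n with
  | zero => simp
  | succ n =>
    have h : ∀ k : ℕ, ((n + 1).choose (2 * k + 1) : ℝ) * ((2 * k + 1) * x ^ (2 * k)) =
        (n + 1) * ((n.choose (2 * k) : ℝ) * x ^ (2 * k)) := fun k => by
      have := Nat.add_one_mul_choose_eq n (2 * k)
      have h2 : ((n : ℝ) + 1) * n.choose (2 * k) = (n + 1).choose (2 * k + 1) * (2 * k + 1) := by
        exact_mod_cast this
      linear_combination (-x ^ (2 * k)) * h2
    have he := (sum_choose_odd_even n (R - 1) (by omega) x).2
    rw [Nat.sub_add_cancel (by omega)] at he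
    simp_rw [h]
    rw [← Finset.mul_sum, he]
    push_cast
    ring

/-- The Fourier kernel of the reduction degree of paths of length `n + 1`. -/
noncomputable def kernel (n : ℕ) (θ : ℝ) : ℝ :=
  Real.cos (θ / 2) ^ (2 * n) * (1 - 2 * (n + 1) * Real.sin (θ / 2) ^ 2)

/-- With c = cos(θ/2), the odd binomial sums produce (1 + c)^n and (1 - c)^n, which are 2^n
cos^(2n)(θ/4) and 2^n sin^(2n)(θ/4). The sine is the cosine at the angle shifted by π, so a
reduction step sums the kernel over both preimages of θ under angle doubling. -/
theorem sum_choose_mul_kernel (n R : ℕ) (hR : n ≤ R) (θ : ℝ) :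
    ∑ k ∈ Finset.range R, 2 / 2 ^ n * (n.choose (2 * k + 1) : ℝ) * kernel k θ
      = kernel n (θ / 2) + kernel n (θ / 2 + Real.pi) := by
  set c := Real.cos (θ / 2) with hc
  have hs : Real.sin (θ / 2) ^ 2 = 1 - c ^ 2 := by rw [hc, Real.sin_sq]
  have ho := (sum_choose_odd_even n R hR c).1
  have hm := sum_mul_choose_odd n R hR c
  have hsum : ∑ k ∈ Finset.range R, 2 / 2 ^ n * (n.choose (2 * k + 1) : ℝ) * kernel k θ =
      2 / 2 ^ n * (c * ∑ k ∈ Finset.range R, (n.choose (2 * k + 1) : ℝ) * c ^ (2 * k + 1)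
        - (1 - c ^ 2) * ∑ k ∈ Finset.range R,
          (n.choose (2 * k + 1) : ℝ) * ((2 * k + 1) * c ^ (2 * k))) := by
    rw [Finset.mul_sum, Finset.mul_sum, ← Finset.sum_sub_distrib, Finset.mul_sum]
    refine Finset.sum_congr rfl fun k _ => ?_
    rw [kernel, hs, ← hc]
    ring
  have hquarter : θ / 2 = 2 * (θ / 2 / 2) := by ring
  have hC : c = 2 * Real.cos (θ / 2 / 2) ^ 2 - 1 := by
    rw [hc]
    conv_lhs => rw [hquarter]
    exact Real.cos_two_mul _
  have hS : Real.sin (θ / 2 / 2) ^ 2 = 1 - Real.cos (θ / 2 / 2) ^ 2 := Real.sin_sq _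
  have h1 : (1 + c) ^ n = 2 ^ n * Real.cos (θ / 2 / 2) ^ (2 * n) := by
    rw [hC, pow_mul, ← mul_pow]
    ring
  have h2 : (1 - c) ^ n = 2 ^ n * Real.sin (θ / 2 / 2) ^ (2 * n) := by
    rw [hC, pow_mul, hS, ← mul_pow]
    ring
  have hshift : (θ / 2 + Real.pi) / 2 = θ / 2 / 2 + Real.pi / 2 := by ring
  rw [hsum, ho, hm, h1, h2, kernel, kernel, hshift, Real.cos_add_pi_div_two,
    Real.sin_add_pi_div_two, (even_two_mul n).neg_pow, hC, hS]
  field_simp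
  ring

theorem degreeTail_eq_sum_kernel (r n : ℕ) :
    degreeTail r (n + 1) = ∑ j ∈ Finset.range (2 ^ r), kernel n (2 * Real.pi * j / 2 ^ r) := by
  induction r generalizing n with
  | zero => simp [degreeTail_zero, kernel]
  | succ r ih =>
    rw [degreeTail_succ r n n le_rfl]
    simp_rw [ih, Finset.mul_sum]
    -- The indices j and 2^r + j of the finer division are the two halves θ/2 and θ/2 + π of the
    -- angle with index j.
    rw [Finset.sum_comm, pow_succ 2 r, mul_two, Finset.sum_range_add, ← Finset.sum_add_distrib]
    refine Finset.sum_congr rfl fun j _ => ?_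
    rw [sum_choose_mul_kernel n n le_rfl]
    congr 2
    · field_simp
      ring
    · push_cast
      field_simp
      ring

theorem sum_range_exp_eq (N : ℕ) (hN : N ≠ 0) (m : ℤ) :
    ∑ j ∈ Finset.range N, Complex.exp (Complex.I * (2 * Real.pi * j / N : ℝ) * m)
      = if (N : ℤ) ∣ m then (N : ℂ) else 0 := by
  have hN' : (N : ℂ) ≠ 0 := by exact_mod_cast hN
  have hI : Complex.I ≠ 0 := Complex.I_ne_zero
  have hpi : (Real.pi : ℂ) ≠ 0 := by exact_mod_cast Real.pi_ne_zero
  set z := Complex.exp (Complex.I * (2 * Real.pi / N) * m) with hz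
  have hterm : ∀ j : ℕ, Complex.exp (Complex.I * (2 * Real.pi * j / N : ℝ) * m) = z ^ j := by
    intro j
    rw [hz, ← Complex.exp_nat_mul]
    congr 1
    push_cast
    ring
  have hzN : z ^ N = 1 := by
    rw [hz, ← Complex.exp_nat_mul, Complex.exp_eq_one_iff]
    exact ⟨m, by field_simp⟩
  simp_rw [hterm]
  split_ifs with h
  · obtain ⟨d, rfl⟩ := h
    have : z = 1 := by
      rw [hz, Complex.exp_eq_one_iff]
      exact ⟨d, by push_cast; field_simp⟩
    simp [this]
  · have hz1 : z ≠ 1 := by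
      rw [hz, Ne, Complex.exp_eq_one_iff]
      rintro ⟨d, hd⟩
      apply h
      refine ⟨d, ?_⟩
      have : (m : ℂ) = N * d := by
        have h3 : (Complex.I * (2 * Real.pi)) * m = (Complex.I * (2 * Real.pi)) * (N * d) := by
          field_simp at hd
          linear_combination Complex.I * 2 * Real.pi * hd
        exact mul_left_cancel₀ (mul_ne_zero hI (mul_ne_zero two_ne_zero hpi)) h3
      exact_mod_cast this
    have := mul_geom_sum z N
    rw [hzN, sub_self] at this
    exact (mul_eq_zero.1 this).resolve_left (sub_ne_zero.2 hz1)

theorem cos_pow_eq_sum (n : ℕ) (θ : ℝ) :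
    ∑ i ∈ Finset.range (2 * n + 1), ((2 * n).choose i : ℂ)
        * Complex.exp (Complex.I * θ * ((i : ℤ) - n : ℤ))
      = 4 ^ n * (Real.cos (θ / 2) : ℂ) ^ (2 * n) := by
  have h4 : (4 : ℂ) ^ n = 2 ^ (2 * n) := by rw [pow_mul]; norm_num
  rw [h4, ← mul_pow, Complex.ofReal_cos, Complex.two_cos, add_pow]
  refine Finset.sum_congr rfl fun i hi => ?_
  rw [mul_comm, ← Complex.exp_nat_mul, ← Complex.exp_nat_mul, ← Complex.exp_add]
  have hi' : i ≤ 2 * n := by simp at hi; omega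
  congr 2
  push_cast [hi']
  ring

/-- With N = 2n + 2 one has (n + 1)² - (i - n - 1)² = i (N - i), and i (N - i) C(N, i) = N (N - 1)
C(N - 2, i - 1). -/
theorem sq_mul_choose (n i : ℕ) (hi : i ≤ 2 * (n + 1)) :
    (((i : ℝ) - (n + 1)) ^ 2) * (2 * (n + 1)).choose i =
      (n + 1) ^ 2 * (2 * (n + 1)).choose i - (2 * n + 2) * (2 * n + 1) *
        (if i = 0 then 0 else ((2 * n).choose (i - 1) : ℝ)) := by
  rcases i with _ | i
  · simp
    ring
  · simp only [Nat.add_eq_zero_iff, one_ne_zero, and_false, if_false, Nat.add_sub_cancel]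
    have h1 := Nat.add_one_mul_choose_eq (2 * n + 1) i
    have h2 := Nat.choose_mul_succ_eq (2 * n) i
    have hi2 : i ≤ 2 * n + 1 := by omega
    have h1' : ((2 * n : ℝ) + 1 + 1) * (2 * n + 1).choose i
        = (2 * n + 1 + 1).choose (i + 1) * (i + 1) := by exact_mod_cast h1
    have h2' : ((2 * n).choose i : ℝ) * (2 * n + 1)
        = (2 * n + 1).choose i * (2 * n + 1 - i) := by
      have : (((2 * n).choose i * (2 * n + 1) : ℕ) : ℝ)
          = ((2 * n + 1).choose i * (2 * n + 1 - i) : ℕ) := by exact_mod_cast h2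
      push_cast [Nat.cast_sub hi2] at this
      exact this
    rw [show 2 * (n + 1) = 2 * n + 1 + 1 by ring]
    push_cast
    linear_combination (2 * n + 1 - i : ℝ) * h1' + (2 * n + 2 : ℝ) * h2'

/-- The kernel is -2/(n + 1) times the second derivative in θ of cos(θ/2)^(2n+2), which explains the
square of the frequency in its coefficients. -/
theorem kernel_eq_sum (n : ℕ) (θ : ℝ) :
    ∑ i ∈ Finset.range (2 * (n + 1) + 1), ((((i : ℝ) - (n + 1)) ^ 2
        * (2 * (n + 1)).choose i : ℝ) : ℂ)
        * Complex.exp (Complex.I * θ * ((i : ℤ) - (n + 1 : ℕ) : ℤ))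
      = 4 ^ (n + 1) * ((n + 1) / 2) * (kernel n θ : ℂ) := by
  have h1 := cos_pow_eq_sum (n + 1) θ
  have h2 := cos_pow_eq_sum n θ
  have h3 : ∑ i ∈ Finset.range (2 * (n + 1) + 1),
      (if i = 0 then (0 : ℂ) else ((2 * n).choose (i - 1) : ℂ))
        * Complex.exp (Complex.I * θ * ((i : ℤ) - (n + 1 : ℕ) : ℤ))
      = 4 ^ n * (Real.cos (θ / 2) : ℂ) ^ (2 * n) := by
    rw [← h2, Finset.sum_range_succ', show 2 * (n + 1) = 2 * n + 1 + 1 by ring,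
      Finset.sum_range_succ]
    simp only [Nat.add_eq_zero_iff, one_ne_zero, and_false, if_false, Nat.add_sub_cancel,
      if_true, zero_mul, add_zero, Nat.choose_succ_self, Nat.cast_zero]
    refine Finset.sum_congr rfl fun i _ => ?_
    congr 3
    push_cast
    ring
  have h4 : ∀ i ∈ Finset.range (2 * (n + 1) + 1), ((((i : ℝ) - (n + 1)) ^ 2
        * (2 * (n + 1)).choose i : ℝ) : ℂ)
        * Complex.exp (Complex.I * θ * ((i : ℤ) - (n + 1 : ℕ) : ℤ)) =
      (n + 1) ^ 2 * (((2 * (n + 1)).choose i : ℂ)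
        * Complex.exp (Complex.I * θ * ((i : ℤ) - (n + 1 : ℕ) : ℤ))) -
      (2 * n + 2) * (2 * n + 1) * ((if i = 0 then (0 : ℂ) else ((2 * n).choose (i - 1) : ℂ))
        * Complex.exp (Complex.I * θ * ((i : ℤ) - (n + 1 : ℕ) : ℤ))) := by
    intro i hi
    rw [sq_mul_choose n i (by simp at hi; omega)]
    split_ifs <;> push_cast <;> ring
  rw [Finset.sum_congr rfl h4, Finset.sum_sub_distrib, ← Finset.mul_sum, ← Finset.mul_sum, h1, h3,
    kernel]
  push_cast
  have hs := Complex.sin_sq ((θ : ℂ) / 2)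
  rw [hs]
  ring

theorem sum_range_two_mul_eq (n : ℕ) (f : ℤ → ℝ) (hf : ∀ m, f (-m) = f m) (h0 : f 0 = 0) :
    ∑ i ∈ Finset.range (2 * n + 1), f ((i : ℤ) - n) =
      2 * ∑ i ∈ Finset.range n, f ((i : ℤ) + 1) := by
  rw [two_mul, add_assoc, Finset.sum_range_add, Finset.sum_range_succ', two_mul]
  congr 1
  · rw [← Finset.sum_range_reflect]
    refine Finset.sum_congr rfl fun i hi => ?_
    rw [← hf]
    congr 1
    simp at hi
    omega
  · simp [h0]

/-- Summing the kernel over 2^r equally spaced angles keeps only frequencies divisible by 2^r. The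
frequency 0 has weight 0, and the symmetry m ↔ -m leaves twice the positive ones. -/
theorem degreeTail_eq_sum_choose (r n : ℕ) :
    degreeTail r (n + 1) = ∑' l : ℕ, 4 * 2 ^ r / (n + 1) * ((l + 1) * 2 ^ r) ^ 2 *
      ((2 * (n + 1)).choose (n + 1 + (l + 1) * 2 ^ r) / 4 ^ (n + 1) : ℝ) := by
  set N := 2 ^ r with hNdef
  have hN : N ≠ 0 := by positivity
  have hNR : ((2 : ℝ) ^ r) = N := by rw [hNdef]; push_cast; rfl
  rw [degreeTail_eq_sum_kernel]
  let f : ℤ → ℝ := fun m => if (N : ℤ) ∣ m then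
    (m : ℝ) ^ 2 * (2 * (n + 1)).choose (n + 1 + m.natAbs) else 0
  have hf : ∀ m, f (-m) = f m := fun m => by simp [f]
  have hf0 : f 0 = 0 := by simp [f]
  have hcast : ∀ i ∈ Finset.range (2 * (n + 1) + 1),
      ((2 * (n + 1)).choose i : ℝ)
        = (2 * (n + 1)).choose (n + 1 + ((i : ℤ) - (n + 1 : ℕ)).natAbs) := by
    intro i hi
    simp at hi
    rcases le_total (n + 1) i with h | h
    · congr 2; omega
    · rw [← Nat.choose_symm (show i ≤ 2 * (n + 1) by omega)]
      congr 2; omega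
  have key : (4 : ℂ) ^ (n + 1) * ((n + 1) / 2)
      * ((∑ j ∈ Finset.range N, kernel n (2 * Real.pi * j / 2 ^ r) : ℝ) : ℂ)
      = ((N * ∑ i ∈ Finset.range (2 * (n + 1) + 1), f ((i : ℤ) - (n + 1 : ℕ)) : ℝ) : ℂ) := by
    simp only [Complex.ofReal_sum, Complex.ofReal_mul, Complex.ofReal_natCast]
    rw [Finset.mul_sum]
    simp_rw [← kernel_eq_sum]
    rw [Finset.sum_comm, Finset.mul_sum]
    refine Finset.sum_congr rfl fun i hi => ?_
    rw [← Finset.mul_sum]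
    have := sum_range_exp_eq N hN ((i : ℤ) - (n + 1 : ℕ))
    rw [hNR, this, hcast i hi]
    simp only [f]
    split_ifs with h
    · push_cast
      ring
    · simp
  have key' : (4 : ℝ) ^ (n + 1) * ((n + 1) / 2)
      * (∑ j ∈ Finset.range N, kernel n (2 * Real.pi * j / 2 ^ r))
      = N * (2 * ∑ i ∈ Finset.range (n + 1), f ((i : ℤ) + 1)) := by
    rw [← sum_range_two_mul_eq (n + 1) f hf hf0]
    apply Complex.ofReal_injective
    rw [← key]
    push_cast
    ring
  have htsum : ∑ i ∈ Finset.range (n + 1), f ((i : ℤ) + 1)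
      = ∑' l : ℕ, (((l : ℝ) + 1) * 2 ^ r) ^ 2 *
        ((2 * (n + 1)).choose (n + 1 + (l + 1) * N) : ℝ) := by
    have h1 : ∑ i ∈ Finset.range (n + 1), f ((i : ℤ) + 1) = ∑' m : ℕ, f m := by
      have : HasSum (fun m : ℕ => f m) (∑ m ∈ Finset.range (n + 2), f m) := by
        refine hasSum_sum_of_ne_finset_zero fun m hm => ?_
        simp only [Finset.mem_range, not_lt] at hm
        simp only [f]
        split_ifs
        · rw [Nat.choose_eq_zero_of_lt (by simp; omega)]
          simp
        · rfl
      rw [this.tsum_eq, Finset.sum_range_succ' _ (n + 1)]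
      simp [hf0]
    have hinj : Function.Injective (fun l : ℕ => (l + 1) * N) := fun a b h => by
      have := Nat.eq_of_mul_eq_mul_right (Nat.pos_of_ne_zero hN) h
      omega
    rw [h1, ← hinj.tsum_eq (f := fun m : ℕ => f m)]
    · refine tsum_congr fun l => ?_
      simp only [f]
      rw [if_pos (by push_cast; exact Dvd.intro_left _ rfl), hNR]
      congr 1
      · push_cast; ring
    · intro m hm
      simp only [Function.mem_support, f] at hm
      have hd : (N : ℤ) ∣ m := by by_contra h; simp [h] at hm
      have hd' : N ∣ m := by exact_mod_cast hd
      obtain ⟨d, rfl⟩ := hd'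
      rcases d with _ | d
      · simp at hm
      · exact ⟨d, by ring⟩
  rw [htsum] at key'
  have h4 : (4 : ℝ) ^ (n + 1) ≠ 0 := by positivity
  have hn : (n : ℝ) + 1 ≠ 0 := by positivity
  have : ∀ l : ℕ, 4 * 2 ^ r / ((n : ℝ) + 1) * ((l + 1) * 2 ^ r) ^ 2 *
      ((2 * (n + 1)).choose (n + 1 + (l + 1) * N) / 4 ^ (n + 1) : ℝ) =
      4 * 2 ^ r / ((n : ℝ) + 1) / 4 ^ (n + 1) * (((l + 1) * 2 ^ r) ^ 2 *
      ((2 * (n + 1)).choose (n + 1 + (l + 1) * N) : ℝ)) := fun l => by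
    field_simp
  rw [tsum_congr this, tsum_mul_left]
  generalize ∑' l : ℕ, (((l : ℝ) + 1) * 2 ^ r) ^ 2 *
    ((2 * (n + 1)).choose (n + 1 + (l + 1) * N) : ℝ) = X at *
  rw [hNR] at *
  field_simp
  linear_combination 2 * key'

end LatticePath


/-! ### Theta series and the limiting tail function -/

namespace LatticePath

open Filter Topology

/-- The partial theta series `∑ λ ^ (2 m) e ^ (-λ² t)` over positive integers `λ`. -/
noncomputable def thetaSum (m : ℕ) (t : ℝ) : ℝ :=
  ∑' i : ℕ, ((i : ℝ) + 1) ^ (2 * m) * Real.exp (-((i : ℝ) + 1) ^ 2 * t)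

theorem summable_thetaSum (m : ℕ) {t : ℝ} (ht : 0 < t) :
    Summable fun i : ℕ => ((i : ℝ) + 1) ^ (2 * m) * Real.exp (-((i : ℝ) + 1) ^ 2 * t) := by
  have h := (summable_nat_add_iff 1).2 (Real.summable_pow_mul_exp_neg_nat_mul (2 * m) ht)
  refine Summable.of_nonneg_of_le (fun i => by positivity) (fun i => ?_) h
  push_cast
  refine mul_le_mul_of_nonneg_left (Real.exp_le_exp.2 ?_) (by positivity)
  have : (0 : ℝ) ≤ i := Nat.cast_nonneg i
  nlinarith [mul_nonneg ht.le (mul_nonneg this (add_nonneg this zero_le_one))]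

theorem thetaSum_nonneg (m : ℕ) (t : ℝ) : 0 ≤ thetaSum m t :=
  tsum_nonneg fun i => by positivity

theorem hasDerivAt_thetaSum (m : ℕ) {t : ℝ} (ht : 0 < t) :
    HasDerivAt (thetaSum m) (-thetaSum (m + 1) t) t := by
  have h := hasDerivAt_tsum_of_isPreconnected (t := Set.Ioi (t / 2)) (y₀ := t) (y := t)
    (g := fun (i : ℕ) (y : ℝ) => ((i : ℝ) + 1) ^ (2 * m) * Real.exp (-((i : ℝ) + 1) ^ 2 * y))
    (g' := fun (i : ℕ) (y : ℝ) =>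
      -(((i : ℝ) + 1) ^ (2 * (m + 1)) * Real.exp (-((i : ℝ) + 1) ^ 2 * y)))
    (summable_thetaSum (m + 1) (half_pos ht)) isOpen_Ioi isPreconnected_Ioi ?_ ?_
    (by simpa using half_lt_self ht) (summable_thetaSum m ht) (by simpa using half_lt_self ht)
  · rw [thetaSum, ← tsum_neg]
    exact h
  · intro i y _
    have h1 : HasDerivAt (fun y : ℝ => -((i : ℝ) + 1) ^ 2 * y) (-((i : ℝ) + 1) ^ 2) y := by
      simpa using (hasDerivAt_id y).const_mul (-((i : ℝ) + 1) ^ 2)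
    refine (h1.exp.const_mul (((i : ℝ) + 1) ^ (2 * m))).congr_deriv ?_
    ring
  · intro i y hy
    rw [norm_neg, Real.norm_of_nonneg (by positivity)]
    have : t / 2 ≤ y := le_of_lt hy
    refine mul_le_mul_of_nonneg_left (Real.exp_le_exp.2 ?_) (by positivity)
    nlinarith [sq_nonneg ((i : ℝ) + 1)]

theorem thetaSum_le (m : ℕ) {t : ℝ} (ht : 1 ≤ t) :
    thetaSum m t ≤ thetaSum m 1 * Real.exp 1 * Real.exp (-t) := by
  rw [thetaSum, thetaSum, mul_assoc, ← Real.exp_add, ← tsum_mul_right]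
  refine Summable.tsum_le_tsum (fun i => ?_) (summable_thetaSum m (by linarith))
    ((summable_thetaSum m one_pos).mul_right _)
  rw [mul_assoc, ← Real.exp_add]
  gcongr
  have : (1 : ℝ) ≤ ((i : ℝ) + 1) ^ 2 := by
    have : (0 : ℝ) ≤ i := Nat.cast_nonneg i
    nlinarith
  nlinarith

theorem tsum_int_exp_eq {t : ℝ} (ht : 0 < t) :
    ∑' n : ℤ, Real.exp (-t * (n : ℝ) ^ 2) = 1 + 2 * thetaSum 0 t := by
  have hs : Summable fun i : ℕ => Real.exp (-t * ((i : ℝ) + 1) ^ 2) := by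
    refine (summable_thetaSum 0 ht).congr fun i => ?_
    simp [mul_comm]
  have h0 : Summable fun i : ℕ => Real.exp (-t * (i : ℝ) ^ 2) :=
    (summable_nat_add_iff 1).1 (by simpa using hs)
  rw [tsum_of_nat_of_neg_add_one (f := fun n : ℤ => Real.exp (-t * (n : ℝ) ^ 2))
    (by simpa using h0)]
  · have h1 : ∑' i : ℕ, Real.exp (-t * ((i : ℤ) : ℝ) ^ 2)
        = 1 + ∑' i : ℕ, Real.exp (-t * ((i : ℝ) + 1) ^ 2) := by
      simp only [Int.cast_natCast]
      rw [h0.tsum_eq_zero_add]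
      simp
    have h2 : ∀ i : ℕ, Real.exp (-t * ((-((i : ℤ) + 1) : ℤ) : ℝ) ^ 2)
        = Real.exp (-t * ((i : ℝ) + 1) ^ 2) := fun i => by
      congr 1; push_cast; ring
    have h3 : thetaSum 0 t = ∑' i : ℕ, Real.exp (-t * ((i : ℝ) + 1) ^ 2) := by
      rw [thetaSum]
      exact tsum_congr fun i => by simp [mul_comm]
    rw [h1, tsum_congr h2, h3]
    ring
  · refine hs.congr fun i => ?_
    congr 1; push_cast; ring

/-- Jacobi's identity for the full theta series over the integers, which is 1 + 2 `thetaSum 0`. -/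
theorem thetaSum_functional_equation {t : ℝ} (ht : 0 < t) :
    1 + 2 * thetaSum 0 t =
      Real.sqrt Real.pi * t ^ (-(1 / 2) : ℝ) * (1 + 2 * thetaSum 0 (Real.pi ^ 2 / t)) := by
  have hpi := Real.pi_pos
  have h := Real.tsum_exp_neg_mul_int_sq (a := t / Real.pi) (by positivity)
  rw [← tsum_int_exp_eq ht, ← tsum_int_exp_eq (by positivity)]
  have e1 : ∀ n : ℤ, Real.exp (-Real.pi * (t / Real.pi) * (n : ℝ) ^ 2)
      = Real.exp (-t * (n : ℝ) ^ 2) := fun n => by congr 1; field_simp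
  have e2 : ∀ n : ℤ, Real.exp (-Real.pi / (t / Real.pi) * (n : ℝ) ^ 2)
      = Real.exp (-(Real.pi ^ 2 / t) * (n : ℝ) ^ 2) := fun n => by congr 1; field_simp
  rw [tsum_congr e1, tsum_congr e2] at h
  rw [h]
  congr 1
  rw [Real.div_rpow ht.le hpi.le, Real.rpow_neg ht.le, Real.sqrt_eq_rpow]
  field_simp

/-- The limiting tail function of the reduction degree. -/
noncomputable def limitTail (t : ℝ) : ℝ :=
  4 / Real.sqrt Real.pi * t ^ (3 / 2 : ℝ) * thetaSum 1 t

/-- The derivative of `limitTail`. -/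
noncomputable def limitTailDeriv (t : ℝ) : ℝ :=
  4 / Real.sqrt Real.pi * ((3 / 2) * t ^ (1 / 2 : ℝ) * thetaSum 1 t
    - t ^ (3 / 2 : ℝ) * thetaSum 2 t)

theorem hasDerivAt_limitTail {t : ℝ} (ht : 0 < t) :
    HasDerivAt limitTail (limitTailDeriv t) t := by
  have h1 := Real.hasDerivAt_rpow_const (x := t) (p := 3 / 2) (Or.inl ht.ne')
  have h2 := ((h1.const_mul (4 / Real.sqrt Real.pi)).mul (hasDerivAt_thetaSum 1 ht))
  refine h2.congr_deriv ?_
  rw [limitTailDeriv]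
  norm_num
  ring

theorem hasDerivAt_pi_sq_div {t : ℝ} (ht : 0 < t) :
    HasDerivAt (fun t : ℝ => Real.pi ^ 2 / t) (-(Real.pi ^ 2 / t) / t) t := by
  have := (hasDerivAt_inv ht.ne').const_mul (Real.pi ^ 2)
  refine this.congr_deriv ?_
  field_simp

/-- Obtained by differentiating the theta functional equation. In this form the limit 1 as t → 0 is
visible, because π²/t → ∞. -/
theorem limitTail_eq {t : ℝ} (ht : 0 < t) :
    limitTail t = 1 + 2 * thetaSum 0 (Real.pi ^ 2 / t)
      - 4 * (Real.pi ^ 2 / t) * thetaSum 1 (Real.pi ^ 2 / t) := by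
  have hpi := Real.pi_pos
  have hw : 0 < Real.pi ^ 2 / t := by positivity
  have h1 : HasDerivAt (fun t => 1 + 2 * thetaSum 0 t) (2 * -thetaSum 1 t) t :=
    ((hasDerivAt_thetaSum 0 ht).const_mul 2).const_add 1
  have h2 := ((Real.hasDerivAt_rpow_const (x := t) (p := -(1 / 2)) (Or.inl ht.ne')).const_mul
    (Real.sqrt Real.pi)).mul
      ((((hasDerivAt_thetaSum 0 hw).comp t (hasDerivAt_pi_sq_div ht)).const_mul 2).const_add 1)
  have h3 := h1.unique (h2.congr_of_eventuallyEq
    ((eventually_gt_nhds ht).mono fun s hs => thetaSum_functional_equation hs))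
  have hsq : 0 < Real.sqrt Real.pi := Real.sqrt_pos.2 hpi
  have r1 : t ^ (-(1 / 2) - 1 : ℝ) = (t ^ (3 / 2 : ℝ))⁻¹ := by
    rw [← Real.rpow_neg ht.le]; norm_num
  have r2 : t ^ (-(1 / 2) : ℝ) = t * (t ^ (3 / 2 : ℝ))⁻¹ := by
    rw [← Real.rpow_neg ht.le, ← Real.rpow_one_add' ht.le] <;> norm_num
  rw [r1, r2] at h3
  have hp : 0 < t ^ (3 / 2 : ℝ) := by positivity
  rw [limitTail]
  have h4 : thetaSum 1 t = Real.sqrt Real.pi / 4 * (t ^ (3 / 2 : ℝ))⁻¹ *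
      (1 + 2 * thetaSum 0 (Real.pi ^ 2 / t)
      - 4 * (Real.pi ^ 2 / t) * thetaSum 1 (Real.pi ^ 2 / t)) := by
    field_simp at h3 ⊢
    simp only [Function.comp, zero_add] at h3
    linarith
  rw [h4]
  field_simp

theorem mul_limitTailDeriv_eq {t : ℝ} (ht : 0 < t) :
    t * limitTailDeriv t = 6 * (Real.pi ^ 2 / t) * thetaSum 1 (Real.pi ^ 2 / t)
      - 4 * (Real.pi ^ 2 / t) ^ 2 * thetaSum 2 (Real.pi ^ 2 / t) := by
  have hw : 0 < Real.pi ^ 2 / t := by positivity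
  have hd := hasDerivAt_pi_sq_div ht
  have h1 := ((((hasDerivAt_thetaSum 0 hw).comp t hd).const_mul 2).const_add 1).sub
    ((hd.const_mul 4).mul ((hasDerivAt_thetaSum 1 hw).comp t hd))
  have h2 := (hasDerivAt_limitTail ht).unique (h1.congr_of_eventuallyEq
    ((eventually_gt_nhds ht).mono fun s hs => by
      simpa using limitTail_eq hs))
  rw [h2]
  simp only [Function.comp, zero_add]
  field_simp
  ring

theorem pow_mul_exp_neg_le (k : ℕ) {x : ℝ} (hx : 0 ≤ x) :
    x ^ k * Real.exp (-x) ≤ k.factorial := by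
  have := Real.pow_div_factorial_le_exp x hx k
  rw [Real.exp_neg, ← div_eq_mul_inv, div_le_iff₀ (Real.exp_pos x)]
  rw [div_le_iff₀ (by positivity)] at this
  linarith

theorem pow_mul_thetaSum_le (k m : ℕ) {t : ℝ} (ht : 1 ≤ t) :
    t ^ k * thetaSum m t ≤ thetaSum m 1 * Real.exp 1 * (k + 1).factorial * t⁻¹ := by
  have h0 : 0 < t := by linarith
  have h1 := pow_mul_exp_neg_le (k + 1) h0.le
  calc t ^ k * thetaSum m t
      ≤ t ^ k * (thetaSum m 1 * Real.exp 1 * Real.exp (-t)) := by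
        gcongr; exact thetaSum_le m ht
    _ = thetaSum m 1 * Real.exp 1 * (t ^ (k + 1) * Real.exp (-t)) * t⁻¹ := by
        field_simp
        ring
    _ ≤ _ := by
        gcongr
        have := thetaSum_nonneg m 1
        positivity

/-- For t ≥ 1 the defining series decays exponentially, and for t ≤ 1 the transformed series in π²/t
does. First-order decay suffices: it becomes exponential on the scale log t. The combination t F'(t)
is the derivative on that scale. -/
theorem limitTail_bounds : ∃ C : ℝ, 0 < C ∧
    (∀ t, 1 ≤ t → |limitTail t| ≤ C * t⁻¹ ∧ |t * limitTailDeriv t| ≤ C * t⁻¹) ∧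
    (∀ t, 0 < t → t ≤ 1 → |limitTail t - 1| ≤ C * t ∧ |t * limitTailDeriv t| ≤ C * t) := by
  have hpi := Real.pi_gt_three
  set c : ℕ → ℕ → ℝ := fun k m => thetaSum m 1 * Real.exp 1 * (k + 1).factorial with hc
  have hc0 : ∀ k m, 0 ≤ c k m := fun k m => by
    have := thetaSum_nonneg m 1
    positivity
  have hb : ∀ k m t, 1 ≤ t → t ^ k * thetaSum m t ≤ c k m * t⁻¹ := fun k m t ht =>
    pow_mul_thetaSum_le k m ht
  have hs : 0 < Real.sqrt Real.pi := Real.sqrt_pos.2 (by linarith)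
  set a := 4 / Real.sqrt Real.pi with ha
  have ha0 : 0 < a := by positivity
  -- One constant for all four estimates: the sum of the individual constants, plus 1 to make it
  -- positive.
  refine ⟨a * (c 2 1 + 3 / 2 * c 2 1 + c 3 2) +
    (2 * c 0 0 + 4 * c 1 1 + 6 * c 1 1 + 4 * c 2 2) + 1, ?_, ?_, ?_⟩
  · have := hc0 2 1; have := hc0 3 2; have := hc0 0 0; have := hc0 1 1; have := hc0 2 2
    positivity
  · intro t ht
    have ht0 : 0 < t := by linarith
    have hti : 0 < t⁻¹ := by positivity
    have p1 : t ^ (3 / 2 : ℝ) ≤ t ^ 2 := by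
      rw [← Real.rpow_natCast]
      exact Real.rpow_le_rpow_of_exponent_le ht (by norm_num)
    have p2 : t * t ^ (1 / 2 : ℝ) ≤ t ^ 2 := by
      rw [sq]
      gcongr
      simpa using Real.rpow_le_rpow_of_exponent_le ht (show (1 / 2 : ℝ) ≤ 1 by norm_num)
    have b1 := hb 2 1 t ht
    have b2 := hb 3 2 t ht
    have n1 := thetaSum_nonneg 1 t
    have n2 := thetaSum_nonneg 2 t
    have q1 : t ^ (3 / 2 : ℝ) * thetaSum 1 t ≤ c 2 1 * t⁻¹ :=
      (mul_le_mul_of_nonneg_right p1 n1).trans b1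
    have q2 : t * t ^ (1 / 2 : ℝ) * thetaSum 1 t ≤ c 2 1 * t⁻¹ :=
      (mul_le_mul_of_nonneg_right p2 n1).trans b1
    have q3 : t * t ^ (3 / 2 : ℝ) * thetaSum 2 t ≤ c 3 2 * t⁻¹ := by
      refine le_trans ?_ b2
      gcongr
      calc t * t ^ (3 / 2 : ℝ) ≤ t * t ^ 2 := by gcongr
        _ = t ^ 3 := by ring
    have hrest : 0 ≤ (2 * c 0 0 + 4 * c 1 1 + 6 * c 1 1 + 4 * c 2 2) + 1 := by
      have := hc0 0 0; have := hc0 1 1; have := hc0 2 2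
      positivity
    have hr2 := mul_nonneg hrest hti.le
    have r1 : 0 ≤ t ^ (3 / 2 : ℝ) * thetaSum 1 t := by positivity
    have r2 : 0 ≤ t * t ^ (1 / 2 : ℝ) * thetaSum 1 t := by positivity
    have r3 : 0 ≤ t * t ^ (3 / 2 : ℝ) * thetaSum 2 t := by positivity
    have s1 := mul_le_mul_of_nonneg_left q1 ha0.le
    have s2 := mul_le_mul_of_nonneg_left q2 ha0.le
    have s3 := mul_le_mul_of_nonneg_left q3 ha0.le
    have u1 := mul_nonneg ha0.le r1
    have u2 := mul_nonneg ha0.le r2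
    have u3 := mul_nonneg ha0.le r3
    have v1 := mul_nonneg ha0.le (mul_nonneg (hc0 2 1) hti.le)
    have v2 := mul_nonneg ha0.le (mul_nonneg (hc0 3 2) hti.le)
    constructor
    · rw [limitTail, ← ha, abs_le]
      constructor <;> linarith
    · rw [limitTailDeriv, ← ha, abs_le]
      constructor <;> linarith
  · intro t ht0 ht
    have hw : 1 ≤ Real.pi ^ 2 / t := by
      rw [le_div_iff₀ ht0]; nlinarith
    have hwi : (Real.pi ^ 2 / t)⁻¹ ≤ t := by
      rw [inv_div, div_le_iff₀ (by positivity)]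
      nlinarith [mul_nonneg ht0.le (show 0 ≤ Real.pi ^ 2 - 1 by nlinarith)]
    have hb' : ∀ k m, (Real.pi ^ 2 / t) ^ k * thetaSum m (Real.pi ^ 2 / t) ≤ c k m * t :=
      fun k m => (hb k m _ hw).trans (by gcongr; exact hc0 k m)
    have hn : ∀ k m, 0 ≤ (Real.pi ^ 2 / t) ^ k * thetaSum m (Real.pi ^ 2 / t) := fun k m => by
      have := thetaSum_nonneg m (Real.pi ^ 2 / t)
      positivity
    have hrest : 0 ≤ a * (c 2 1 + 3 / 2 * c 2 1 + c 3 2) := by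
      have := hc0 2 1; have := hc0 3 2
      positivity
    have hr2 := mul_nonneg hrest ht0.le
    have v1 := mul_nonneg (hc0 0 0) ht0.le
    have v2 := mul_nonneg (hc0 1 1) ht0.le
    have v3 := mul_nonneg (hc0 2 2) ht0.le
    have b1 := hb' 0 0; have b2 := hb' 1 1; have b3 := hb' 2 2
    have n1 := hn 0 0; have n2 := hn 1 1; have n3 := hn 2 2
    simp only [pow_zero, one_mul, pow_one] at b1 b2 n1 n2
    constructor
    · rw [limitTail_eq ht0, abs_le]
      constructor <;> linarith
    · rw [mul_limitTailDeriv_eq ht0, abs_le]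
      constructor <;> linarith

theorem continuousOn_limitTailDeriv : ContinuousOn limitTailDeriv (Set.Ioi 0) := by
  have h : ∀ m, ContinuousOn (thetaSum m) (Set.Ioi 0) := fun m t ht =>
    (hasDerivAt_thetaSum m ht).continuousAt.continuousWithinAt
  have hr : ∀ p : ℝ, ContinuousOn (fun t : ℝ => t ^ p) (Set.Ioi 0) := fun p t ht =>
    (Real.continuousAt_rpow_const t p (Or.inl (ne_of_gt ht))).continuousWithinAt
  exact continuousOn_const.mul (((continuousOn_const.mul (hr _)).mul (h 1)).sub ((hr _).mul (h 2)))

end LatticePath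


/-! ### Small t: Gaussian approximation of the kernel sum -/

namespace LatticePath

open Filter Topology

theorem mul_cos_le_sin {x : ℝ} (h0 : 0 ≤ x) (h1 : x ≤ Real.pi / 2) :
    x * Real.cos x ≤ Real.sin x := by
  rcases h1.lt_or_eq with h | h
  · have hc : 0 < Real.cos x := Real.cos_pos_of_mem_Ioo ⟨by linarith [Real.pi_pos], h⟩
    have := Real.le_tan h0 h
    rwa [Real.tan_eq_sin_div_cos, le_div_iff₀ hc] at this
  · rw [h, Real.cos_pi_div_two, Real.sin_pi_div_two]
    norm_num

/-- The derivative has the sign of x cos x - sin x, which is nonpositive here, so the product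
decreases from its value 1 at 0. -/
theorem cos_mul_exp_le_one {x : ℝ} (h0 : 0 ≤ x) (h1 : x ≤ Real.pi / 2) :
    Real.cos x * Real.exp (x ^ 2 / 2) ≤ 1 := by
  have hd : ∀ y : ℝ, HasDerivAt (fun y => Real.cos y * Real.exp (y ^ 2 / 2))
      (Real.exp (y ^ 2 / 2) * (y * Real.cos y - Real.sin y)) y := fun y => by
    have h2 : HasDerivAt (fun y : ℝ => y ^ 2 / 2) y y := by
      refine ((hasDerivAt_pow 2 y).div_const 2).congr_deriv ?_
      norm_num
    refine ((Real.hasDerivAt_cos y).mul h2.exp).congr_deriv ?_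
    ring
  have hanti : AntitoneOn (fun y => Real.cos y * Real.exp (y ^ 2 / 2))
      (Set.Icc 0 (Real.pi / 2)) := by
    refine antitoneOn_of_deriv_nonpos (convex_Icc _ _)
      (fun y _ => (hd y).continuousAt.continuousWithinAt)
      (fun y _ => (hd y).differentiableAt.differentiableWithinAt) fun y hy => ?_
    rw [interior_Icc] at hy
    rw [(hd y).deriv]
    have := mul_cos_le_sin hy.1.le hy.2.le
    exact mul_nonpos_of_nonneg_of_nonpos (Real.exp_pos _).le (by linarith)
  have := hanti ⟨le_rfl, by positivity⟩ ⟨h0, h1⟩ h0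
  simpa using this

theorem one_sub_le_cos_mul_exp {x : ℝ} (h0 : 0 ≤ x) (h1 : x ≤ Real.pi / 2) :
    1 - x ^ 4 / 4 ≤ Real.cos x * Real.exp (x ^ 2 / 2) := by
  have hc : 0 ≤ Real.cos x := Real.cos_nonneg_of_mem_Icc ⟨by linarith [Real.pi_pos], h1⟩
  have h2 := Real.one_sub_sq_div_two_le_cos (x := x)
  have h3 := Real.add_one_le_exp (x ^ 2 / 2)
  rcases le_total 0 (1 - x ^ 2 / 2) with h | h
  · calc 1 - x ^ 4 / 4 = (1 - x ^ 2 / 2) * (x ^ 2 / 2 + 1) := by ring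
      _ ≤ _ := by gcongr
  · have : 0 ≤ Real.cos x * Real.exp (x ^ 2 / 2) := by positivity
    nlinarith [sq_nonneg (x ^ 2)]

/-- Write cos x = c exp(-x²/2) with 1 - x⁴/4 ≤ c ≤ 1; Bernoulli's inequality then bounds c^(2n) from
below. -/
theorem abs_cos_pow_sub_exp_le (n : ℕ) {x : ℝ} (h0 : 0 ≤ x) (h1 : x ≤ Real.pi / 2) :
    |Real.cos x ^ (2 * n) - Real.exp (-(n * x ^ 2))| ≤ n * x ^ 4 / 2 * Real.exp (-(n * x ^ 2)) := by
  have hc : 0 ≤ Real.cos x := Real.cos_nonneg_of_mem_Icc ⟨by linarith [Real.pi_pos], h1⟩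
  set c := Real.cos x * Real.exp (x ^ 2 / 2) with hcdef
  have hc0 : 0 ≤ c := by positivity
  have hc1 : c ≤ 1 := cos_mul_exp_le_one h0 h1
  have hc2 := one_sub_le_cos_mul_exp h0 h1
  have hpow : Real.cos x ^ (2 * n) = c ^ (2 * n) * Real.exp (-(n * x ^ 2)) := by
    rw [hcdef, mul_pow, ← Real.exp_nat_mul, mul_assoc, ← Real.exp_add]
    have : ((2 * n : ℕ) : ℝ) * (x ^ 2 / 2) + -(n * x ^ 2) = 0 := by push_cast; ring
    rw [this, Real.exp_zero, mul_one]
  have hb := one_add_mul_le_pow (a := c - 1) (by linarith) (2 * n)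
  rw [add_sub_cancel] at hb
  push_cast at hb
  have hle : c ^ (2 * n) ≤ 1 := pow_le_one₀ hc0 hc1
  have hlow : 1 - n * x ^ 4 / 2 ≤ c ^ (2 * n) := by
    have : (n : ℝ) * (1 - x ^ 4 / 4) ≤ n * c := by gcongr
    nlinarith
  have hE := Real.exp_pos (-(n * x ^ 2))
  rw [hpow, abs_le]
  constructor <;> nlinarith

theorem sq_sub_sin_sq_le {x : ℝ} (h0 : 0 ≤ x) (h1 : x ≤ Real.pi / 2) :
    0 ≤ x ^ 2 - Real.sin x ^ 2 ∧ x ^ 2 - Real.sin x ^ 2 ≤ x ^ 4 := by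
  have hc : 0 ≤ Real.cos x := Real.cos_nonneg_of_mem_Icc ⟨by linarith [Real.pi_pos], h1⟩
  have hs : 0 ≤ Real.sin x := Real.sin_nonneg_of_nonneg_of_le_pi h0 (by linarith [Real.pi_pos])
  have h2 := mul_cos_le_sin h0 h1
  have h3 := Real.sin_le h0
  have h4 : Real.sin x ^ 2 ≤ x ^ 2 := by gcongr
  have h5 : (x * Real.cos x) ^ 2 ≤ Real.sin x ^ 2 := by gcongr
  have h6 := Real.sin_sq_add_cos_sq x
  refine ⟨by linarith, ?_⟩
  have h7 : x ^ 2 - x ^ 2 * Real.cos x ^ 2 = x ^ 2 * Real.sin x ^ 2 := by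
    linear_combination (-x ^ 2) * h6
  nlinarith [mul_le_mul_of_nonneg_left h4 (sq_nonneg x)]

theorem exp_neg_mul_poly_le {z : ℝ} (hz : 0 < z) :
    -- 53 = 2! + (9/2) · 3! + 4!, from bounding each z^k exp(-z) by k!.
    (z + (9 / 2) * z ^ 2 + z ^ 3) * Real.exp (-z) ≤ 53 / z := by
  have h2 := pow_mul_exp_neg_le 2 hz.le
  have h3 := pow_mul_exp_neg_le 3 hz.le
  have h4 := pow_mul_exp_neg_le 4 hz.le
  norm_num [Nat.factorial] at h2 h3 h4
  rw [le_div_iff₀ hz]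
  nlinarith

theorem exp_neg_succ_mul_sq (n : ℕ) (x : ℝ) :
    Real.exp (-(n * x ^ 2)) = Real.exp (x ^ 2) * Real.exp (-((n + 1) * x ^ 2)) := by
  rw [← Real.exp_add]
  congr 1
  ring

/-- Three replacements are made: cos^(2n) x by exp(-n x²), sin² x by x², and n by n + 1 in the
exponent. With z = (n + 1) x², each costs a polynomial in z times exp(-z), divided by n + 1. The
constant 4000 exceeds 60 · 53, where exp(x²) ≤ 60 since x² ≤ 4. -/
theorem abs_kernel_sub_le (n : ℕ) {x : ℝ} (h0 : 0 < x) (h1 : x ≤ Real.pi / 2) :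
    |kernel n (2 * x) - Real.exp (-((n + 1) * x ^ 2)) * (1 - 2 * ((n + 1) * x ^ 2))|
      ≤ 4000 / ((n + 1) * ((n + 1) * x ^ 2)) := by
  set ν : ℝ := n + 1 with hν
  have hν0 : 0 < ν := by positivity
  set z := ν * x ^ 2 with hz
  have hz0 : 0 < z := by positivity
  set E := Real.exp (-(n * x ^ 2)) with hE
  have hE0 : 0 < E := Real.exp_pos _
  have hEz : E = Real.exp (x ^ 2) * Real.exp (-z) := exp_neg_succ_mul_sq n x
  have hpi := Real.pi_lt_d2
  have hx2 : x ^ 2 ≤ 4 := by nlinarith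
  have hexp : Real.exp (x ^ 2) ≤ 60 := by
    calc Real.exp (x ^ 2) ≤ Real.exp (4 : ℕ) := Real.exp_le_exp.2 (by simpa using hx2)
      _ = Real.exp 1 ^ 4 := by rw [← Real.exp_nat_mul]; norm_num
      _ ≤ 2.7182818286 ^ 4 := by gcongr; exact Real.exp_one_lt_d9.le
      _ ≤ 60 := by norm_num
  have hcos := abs_cos_pow_sub_exp_le n h0.le h1
  obtain ⟨hs0, hs1⟩ := sq_sub_sin_sq_le h0.le h1
  have hEd : |E - Real.exp (-z)| ≤ x ^ 2 * E := by
    have h2 : Real.exp (-z) = Real.exp (-x ^ 2) * E := by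
      rw [hEz, ← mul_assoc, ← Real.exp_add]; simp
    have h3 := Real.one_sub_le_exp_neg (x ^ 2)
    have h4 : Real.exp (-x ^ 2) ≤ 1 := Real.exp_le_one_iff.2 (by nlinarith)
    rw [h2, abs_le]
    constructor <;> nlinarith
  have hkernel : kernel n (2 * x) = Real.cos x ^ (2 * n) * (1 - 2 * ν * Real.sin x ^ 2) := by
    rw [kernel, mul_div_cancel_left₀ _ (two_ne_zero' ℝ)]
  have hdecomp : kernel n (2 * x) - Real.exp (-z) * (1 - 2 * z) =
      (Real.cos x ^ (2 * n) - E) * (1 - 2 * ν * Real.sin x ^ 2)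
      + E * (2 * ν * (x ^ 2 - Real.sin x ^ 2)) + (E - Real.exp (-z)) * (1 - 2 * z) := by
    rw [hkernel, hz]
    ring
  have hf1 : |1 - 2 * ν * Real.sin x ^ 2| ≤ 1 + 2 * z := by
    have : 0 ≤ Real.sin x ^ 2 := sq_nonneg _
    have h5 : 2 * ν * Real.sin x ^ 2 ≤ 2 * z := by rw [hz]; nlinarith
    have h6 : 0 ≤ 2 * ν * Real.sin x ^ 2 := by positivity
    rw [abs_le]; constructor <;> linarith
  have hf2 : |1 - 2 * z| ≤ 1 + 2 * z := by rw [abs_le]; constructor <;> linarith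
  have hn : (n : ℝ) ≤ ν := by rw [hν]; linarith
  have hbound : |kernel n (2 * x) - Real.exp (-z) * (1 - 2 * z)| ≤
      ν * x ^ 4 / 2 * E * (1 + 2 * z) + E * (2 * ν * x ^ 4) + x ^ 2 * E * (1 + 2 * z) := by
    rw [hdecomp]
    refine (abs_add_three _ _ _).trans ?_
    rw [abs_mul, abs_mul (E - _), abs_of_nonneg (show 0 ≤ E * (2 * ν * (x ^ 2 - Real.sin x ^ 2)) by
      positivity)]
    gcongr
    exact hcos.trans (by gcongr)
  refine hbound.trans ?_
  have hx4 : ν * x ^ 4 = z ^ 2 / ν := by rw [hz]; field_simp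
  have hx2' : x ^ 2 = z / ν := by rw [hz]; field_simp
  have hpoly := exp_neg_mul_poly_le hz0
  have heq : ν * x ^ 4 / 2 * E * (1 + 2 * z) + E * (2 * ν * x ^ 4) + x ^ 2 * E * (1 + 2 * z)
      = E / ν * (z + (9 / 2) * z ^ 2 + z ^ 3) := by
    rw [mul_assoc 2 ν, hx4, hx2']
    field_simp
    ring
  rw [heq, hEz]
  calc Real.exp (x ^ 2) * Real.exp (-z) / ν * (z + (9 / 2) * z ^ 2 + z ^ 3)
      ≤ 60 * Real.exp (-z) / ν * (z + (9 / 2) * z ^ 2 + z ^ 3) := by gcongr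
    _ = 60 / ν * ((z + (9 / 2) * z ^ 2 + z ^ 3) * Real.exp (-z)) := by ring
    _ ≤ 60 / ν * (53 / z) := by gcongr
    _ ≤ 4000 / (ν * z) := by
        rw [div_mul_div_comm]
        gcongr
        norm_num

/-- Past π/2 the finite kernel sum has no terms left. The Gaussian alone satisfies the same bound,
since z ≥ n + 1 there supplies the factor 1/(n + 1). -/
theorem abs_gaussian_le (n : ℕ) {x : ℝ} (h1 : Real.pi / 2 ≤ x) :
    |Real.exp (-((n + 1) * x ^ 2)) * (1 - 2 * ((n + 1) * x ^ 2))|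
      ≤ 4000 / ((n + 1) * ((n + 1) * x ^ 2)) := by
  set ν : ℝ := n + 1 with hν
  have hν0 : 0 < ν := by positivity
  set z := ν * x ^ 2 with hz
  have hx1 : 1 ≤ x := by linarith [Real.pi_gt_three]
  have hzν : ν ≤ z := le_mul_of_one_le_right hν0.le (one_le_pow₀ hx1)
  have hz0 : 0 < z := by linarith
  have hpoly := exp_neg_mul_poly_le hz0
  have hE := Real.exp_pos (-z)
  have hf2 : |1 - 2 * z| ≤ 1 + 2 * z := by rw [abs_le]; constructor <;> linarith
  rw [abs_mul, abs_of_pos hE]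
  calc Real.exp (-z) * |1 - 2 * z| ≤ Real.exp (-z) * (1 + 2 * z) := by gcongr
    _ = 1 * (1 + 2 * z) * Real.exp (-z) := by ring
    _ ≤ z / ν * (1 + 2 * z) * Real.exp (-z) := by
        gcongr
        rwa [le_div_iff₀ hν0, one_mul]
    _ ≤ 1 / ν * ((z + (9 / 2) * z ^ 2 + z ^ 3) * Real.exp (-z)) := by
        have : z / ν * (1 + 2 * z) * Real.exp (-z)
          = 1 / ν * ((z + 2 * z ^ 2) * Real.exp (-z)) := by ring
        rw [this]
        refine mul_le_mul_of_nonneg_left (mul_le_mul_of_nonneg_right ?_ hE.le) (by positivity)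
        nlinarith [sq_nonneg z, pow_pos hz0 3]
    _ ≤ 1 / ν * (53 / z) := by gcongr
    _ ≤ 4000 / (ν * z) := by
        rw [div_mul_div_comm]
        gcongr
        norm_num

/-- Fold j onto 2M - j. The indices 0 and M are their own partners, hence the unequal ranges M - 1
and M. -/
theorem sum_range_even_periodic (M : ℕ) (f : ℤ → ℝ) (hf : ∀ m, f (-m) = f m)
    (hp : ∀ m, f (m + 2 * M) = f m) (hM : 1 ≤ M) :
    ∑ j ∈ Finset.range (2 * M), f j
      = f 0 + ∑ i ∈ Finset.range (M - 1), f ((i : ℤ) + 1) + ∑ i ∈ Finset.range M, f ((i : ℤ) + 1) := by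
  rw [two_mul, Finset.sum_range_add]
  congr 1
  · obtain ⟨m, rfl⟩ : ∃ m, M = m + 1 := ⟨M - 1, by omega⟩
    rw [Finset.sum_range_succ', Nat.add_sub_cancel, add_comm]
    simp
  · rw [← Finset.sum_range_reflect]
    refine Finset.sum_congr rfl fun i hi => ?_
    simp only [Finset.mem_range] at hi
    rw [← hf, ← hp]
    congr 1
    omega

theorem kernel_neg (n : ℕ) (θ : ℝ) : kernel n (-θ) = kernel n θ := by
  simp [kernel, neg_div]

theorem kernel_add_two_pi (n : ℕ) (θ : ℝ) : kernel n (θ + 2 * Real.pi) = kernel n θ := by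
  rw [kernel, kernel, add_div, mul_div_cancel_left₀ _ (two_ne_zero' ℝ), Real.cos_add_pi,
    Real.sin_add_pi, (even_two_mul n).neg_pow, neg_sq]

theorem limitTail_eq_tsum {t : ℝ} (ht : 0 < t) :
    HasSum (fun i : ℕ => Real.exp (-(Real.pi ^ 2 * (i + 1) ^ 2 / t))
      * (1 - 2 * (Real.pi ^ 2 * (i + 1) ^ 2 / t))) ((limitTail t - 1) / 2) := by
  have hw : 0 < Real.pi ^ 2 / t := by positivity
  have h := (summable_thetaSum 0 hw).hasSum.sub
    (((summable_thetaSum 1 hw).hasSum).mul_left (2 * (Real.pi ^ 2 / t)))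
  convert! h using 1
  · ext i
    have : -((i : ℝ) + 1) ^ 2 * (Real.pi ^ 2 / t) = -(Real.pi ^ 2 * (i + 1) ^ 2 / t) := by ring
    rw [this]
    ring
  · rw [limitTail_eq ht, thetaSum, thetaSum]
    ring

theorem summable_one_div_succ_sq : Summable fun i : ℕ => 1 / ((i : ℝ) + 1) ^ 2 := by
  have := (summable_nat_add_iff 1).2 (Real.summable_one_div_nat_pow.2 one_lt_two)
  simpa using this

/-- The Basel constant, used in error bounds. -/
noncomputable def baselSum : ℝ := ∑' i : ℕ, 1 / ((i : ℝ) + 1) ^ 2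

/-- The index r + 1 makes the number 2M of angles even, so the sum folds into two halves, each
approximating half of F(t) - 1. The bound is effective for t ≤ 1. -/
theorem abs_degreeTail_sub_limitTail_le_mul (r n : ℕ) :
    |degreeTail (r + 1) (n + 1) - limitTail (4 ^ (r + 1) / (n + 1))|
      ≤ 8000 * baselSum / (n + 1) * (4 ^ (r + 1) / (n + 1)) := by
  have hpi := Real.pi_gt_three
  set t : ℝ := 4 ^ (r + 1) / (n + 1) with ht
  have hν : (0 : ℝ) < n + 1 := by positivity
  have ht0 : 0 < t := by positivity
  set M := 2 ^ r with hM
  have hM1 : 1 ≤ M := Nat.one_le_two_pow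
  have hMR : (0 : ℝ) < M := by exact_mod_cast hM1
  have hMt : (M : ℝ) ^ 2 * 4 = t * (n + 1) := by
    rw [ht, hM]
    push_cast
    rw [← pow_mul, mul_comm r 2, pow_mul, div_mul_cancel₀ _ hν.ne', pow_succ 4 r]
    norm_num
  clear_value t
  set h : ℕ → ℝ := fun i => Real.exp (-(Real.pi ^ 2 * ((i : ℝ) + 1) ^ 2 / t))
      * (1 - 2 * (Real.pi ^ 2 * ((i : ℝ) + 1) ^ 2 / t)) with hh
  have hsum := limitTail_eq_tsum ht0
  set f : ℤ → ℝ := fun m => kernel n (Real.pi * m / M) with hf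
  have htail : degreeTail (r + 1) (n + 1) = 1 + ∑ i ∈ Finset.range (M - 1), f ((i : ℤ) + 1)
      + ∑ i ∈ Finset.range M, f ((i : ℤ) + 1) := by
    have hf0 : f 0 = 1 := by simp [hf, kernel]
    rw [degreeTail_eq_sum_kernel, ← hf0, ← sum_range_even_periodic M f ?_ ?_ hM1, pow_succ,
      mul_comm (2 ^ r) 2]
    · refine Finset.sum_congr rfl fun j _ => ?_
      rw [hf, hM]
      simp only
      congr 1
      push_cast
      field_simp
      ring
    · intro m
      simp only [hf]
      rw [← kernel_neg]
      congr 1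
      push_cast
      ring
    · intro m
      simp only [hf]
      rw [← kernel_add_two_pi n (Real.pi * m / M)]
      congr 1
      push_cast
      field_simp
  have hz : ∀ i : ℕ, ((n : ℝ) + 1) * (Real.pi * ((i : ℝ) + 1) / (2 * M)) ^ 2
      = Real.pi ^ 2 * ((i : ℝ) + 1) ^ 2 / t := fun i => by
    field_simp
    linear_combination -hMt
  have hfx : ∀ i : ℕ, f ((i : ℤ) + 1) = kernel n (2 * (Real.pi * ((i : ℝ) + 1) / (2 * M))) :=
    fun i => by
    simp only [hf]
    congr 1
    push_cast
    field_simp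
  -- Indices below `L` compare the kernel with the Gaussian; those beyond see only the Gaussian
  -- tail. At the boundary index i + 1 = M the argument is exactly π/2, where both estimates apply,
  -- so both lengths are admissible.
  have hpart : ∀ L : ℕ, (L = M - 1 ∨ L = M) →
      |∑ i ∈ Finset.range L, f ((i : ℤ) + 1) - (limitTail t - 1) / 2|
        ≤ 4000 * baselSum / (n + 1) * t := by
    intro L hL
    have h1 : HasSum (fun i : ℕ => (if i < L then f ((i : ℤ) + 1) else 0) - h i)
        (∑ i ∈ Finset.range L, f ((i : ℤ) + 1) - (limitTail t - 1) / 2) := by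
      refine HasSum.sub ?_ hsum
      have : ∑ i ∈ Finset.range L, f ((i : ℤ) + 1)
          = ∑ i ∈ Finset.range L, (if i < L then f ((i : ℤ) + 1) else 0) :=
        Finset.sum_congr rfl fun i hi => by rw [if_pos (Finset.mem_range.1 hi)]
      rw [this]
      exact hasSum_sum_of_ne_finset_zero fun i hi => by
        rw [if_neg (by simpa using hi)]
    have h2 : ∀ i : ℕ, ‖(if i < L then f ((i : ℤ) + 1) else 0) - h i‖
        ≤ 4000 / (n + 1) * t * (1 / ((i : ℝ) + 1) ^ 2) := by
      intro i
      have hx0 : 0 < Real.pi * ((i : ℝ) + 1) / (2 * M) := by positivity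
      have hle : 4000 / (((n : ℝ) + 1) * (((n : ℝ) + 1) * (Real.pi * ((i : ℝ) + 1) / (2 * M)) ^ 2))
          ≤ 4000 / (n + 1) * t * (1 / ((i : ℝ) + 1) ^ 2) := by
        rw [hz]
        have : 4000 / (((n : ℝ) + 1) * (Real.pi ^ 2 * ((i : ℝ) + 1) ^ 2 / t))
            = 4000 / (n + 1) * t * (1 / ((i : ℝ) + 1) ^ 2) * (1 / Real.pi ^ 2) := by
          field_simp
        rw [this]
        refine mul_le_of_le_one_right (by positivity) ?_
        rw [div_le_one (by positivity)]
        nlinarith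
      refine le_trans ?_ hle
      rw [Real.norm_eq_abs]
      split_ifs with hi
      · rw [hfx, hh]
        simp only
        rw [← hz]
        refine abs_kernel_sub_le n hx0 ?_
        rw [div_le_div_iff₀ (by positivity) two_pos]
        have : (i : ℝ) + 1 ≤ M := by exact_mod_cast (by omega : i + 1 ≤ M)
        nlinarith
      · rw [zero_sub, abs_neg, hh]
        simp only
        rw [← hz]
        refine abs_gaussian_le n ?_
        rw [div_le_div_iff₀ two_pos (by positivity)]
        have : (M : ℝ) ≤ (i : ℝ) + 1 := by exact_mod_cast (by omega : M ≤ i + 1)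
        nlinarith
    have h3 := summable_one_div_succ_sq.hasSum.mul_left (4000 / ((n : ℝ) + 1) * t)
    rw [← h1.tsum_eq, ← Real.norm_eq_abs]
    refine (tsum_of_norm_bounded h3 h2).trans (le_of_eq ?_)
    rw [baselSum]
    ring
  have e1 := hpart (M - 1) (Or.inl rfl)
  have e2 := hpart M (Or.inr rfl)
  rw [htail]
  rw [abs_le] at *
  have : 8000 * baselSum / ((n : ℝ) + 1) * t = 2 * (4000 * baselSum / (n + 1) * t) := by ring
  rw [this]
  constructor <;> linarith [e1.1, e1.2, e2.1, e2.2]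

end LatticePath


/-! ### Large t: Gaussian approximation of the binomial sum -/

namespace LatticePath

open Filter Topology

theorem exp_mul_one_sub_div_bounds {x : ℝ} (h0 : 0 ≤ x) (h1 : x ≤ 1) :
    0 ≤ Real.exp (2 * x) * ((1 - x) / (1 + x)) ∧ Real.exp (2 * x) * ((1 - x) / (1 + x)) ≤ 1 ∧
      1 - 2 * x ^ 3 ≤ Real.exp (2 * x) * ((1 - x) / (1 + x)) := by
  have hx : 0 < 1 + x := by linarith
  refine ⟨mul_nonneg (Real.exp_pos _).le (div_nonneg (by linarith) hx.le), ?_, ?_⟩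
  · rcases h1.lt_or_eq with h | h
    · have := Real.sum_range_le_log_div h0 h 1
      simp only [Finset.range_one, Finset.sum_singleton] at this
      norm_num at this
      have h3 : Real.exp (2 * x) ≤ (1 + x) / (1 - x) := by
        rw [← Real.le_log_iff_exp_le (div_pos hx (by linarith))]
        linarith
      calc Real.exp (2 * x) * ((1 - x) / (1 + x))
          ≤ (1 + x) / (1 - x) * ((1 - x) / (1 + x)) := by
            gcongr
        _ = 1 := by
            have : 1 - x ≠ 0 := by linarith
            field_simp
    · rw [h]
      simp
  · have h2 := Real.quadratic_le_exp_of_nonneg (show 0 ≤ 2 * x by linarith)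
    rw [← mul_div_assoc, le_div_iff₀ hx]
    have h3 := mul_le_mul_of_nonneg_right h2 (show 0 ≤ 1 - x by linarith)
    nlinarith [pow_nonneg h0 3, pow_nonneg h0 4]

/-- The ratio of consecutive binomials is (1 - x)/(1 + x) with x = (m + 1/2)/(n + 1/2), close to
exp(-2x). The exponents 2x add up exactly to m²/(n + 1/2), which is why n is shifted by 1/2, and the
losses 2x³ accumulate to at most the quartic error term. -/
theorem choose_central_ratio_bounds (n m : ℕ) (hn : 1 ≤ n) :
    let ρ := ((2 * n).choose (n + m) : ℝ) / (2 * n).choose n * Real.exp (m ^ 2 / (n + 1 / 2))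
    0 ≤ ρ ∧ ρ ≤ 1 ∧ 1 - 2 * m ^ 4 / (n + 1 / 2) ^ 3 ≤ ρ := by
  have ha : (0 : ℝ) < n + 1 / 2 := by positivity
  have hn1 : (1 : ℝ) ≤ n := by exact_mod_cast hn
  have hC : 0 < ((2 * n).choose n : ℝ) := by
    exact_mod_cast Nat.choose_pos (by omega)
  induction m with
  | zero => simp [hC.ne']
  | succ m ih =>
    obtain ⟨ih0, ih1, ih2⟩ := ih
    -- For m > n the binomial is 0, and the lower bound is harmless because its error term is at
    -- least 1.
    rcases Nat.lt_or_ge n m with hm | hm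
    · intro ρ
      have : ρ = 0 := by
        simp only [ρ]
        rw [Nat.choose_eq_zero_of_lt (by omega)]
        simp
      rw [this]
      refine ⟨le_rfl, zero_le_one, ?_⟩
      have hm' : (n : ℝ) + 1 / 2 ≤ ((m + 1 : ℕ) : ℝ) := by
        have : (n : ℝ) + 1 ≤ m := by exact_mod_cast hm
        push_cast
        linarith
      have h4 : ((n : ℝ) + 1 / 2) ^ 4 ≤ ((m + 1 : ℕ) : ℝ) ^ 4 := by gcongr
      rw [sub_nonpos, le_div_iff₀ (by positivity)]
      nlinarith [pow_pos ha 3]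
    · set x : ℝ := (m + 1 / 2) / (n + 1 / 2) with hx
      have hx0 : 0 ≤ x := by positivity
      have hx1 : x ≤ 1 := by
        rw [hx, div_le_one ha]
        have : (m : ℝ) ≤ n := by exact_mod_cast hm
        linarith
      obtain ⟨hk0, hk1, hk2⟩ := exp_mul_one_sub_div_bounds hx0 hx1
      set k := Real.exp (2 * x) * ((1 - x) / (1 + x)) with hk
      have hstep : ((2 * n).choose (n + (m + 1)) : ℝ) / (2 * n).choose n
          * Real.exp (((m + 1 : ℕ) : ℝ) ^ 2 / (n + 1 / 2)) =
          ((2 * n).choose (n + m) : ℝ) / (2 * n).choose n * Real.exp (m ^ 2 / (n + 1 / 2)) * k := by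
        have hch := Nat.choose_succ_right_eq (2 * n) (n + m)
        have hch' : ((2 * n).choose (n + m + 1) : ℝ) * (n + m + 1)
            = (2 * n).choose (n + m) * (n - m) := by
          have h5 : 2 * n - (n + m) = n - m := by omega
          rw [h5] at hch
          have : (((2 * n).choose (n + m + 1) * (n + m + 1) : ℕ) : ℝ)
            = ((2 * n).choose (n + m) * (n - m) : ℕ) := by exact_mod_cast hch
          push_cast [Nat.cast_sub hm] at this
          exact this
        have hfrac : (1 - x) / (1 + x) = ((n : ℝ) - m) / (n + m + 1) := by
          rw [hx]
          rw [div_eq_div_iff (by positivity) (by positivity)]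
          field_simp
          ring
        have hexp : Real.exp (((m + 1 : ℕ) : ℝ) ^ 2 / (n + 1 / 2))
            = Real.exp (m ^ 2 / (n + 1 / 2)) * Real.exp (2 * x) := by
          rw [← Real.exp_add, hx]
          congr 1
          push_cast
          field_simp
          ring
        have hch2 : ((2 * n).choose (n + (m + 1)) : ℝ)
            = (2 * n).choose (n + m) * (((n : ℝ) - m) / (n + m + 1)) := by
          rw [← add_assoc]
          field_simp
          linear_combination hch'
        rw [hk, hfrac, hexp, hch2]
        ring
      intro ρ
      have hρ : ρ = ((2 * n).choose (n + m) : ℝ) / (2 * n).choose n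
        * Real.exp (m ^ 2 / (n + 1 / 2)) * k := hstep
      rw [hρ]
      set ρ' := ((2 * n).choose (n + m) : ℝ) / (2 * n).choose n * Real.exp (m ^ 2 / (n + 1 / 2))
      refine ⟨mul_nonneg ih0 hk0, mul_le_one₀ ih1 hk0 hk1, ?_⟩
      have h6 : ρ' - 2 * x ^ 3 ≤ ρ' * k := by nlinarith
      have h7 : 1 - 2 * (((m + 1 : ℕ) : ℝ)) ^ 4 / (n + 1 / 2) ^ 3
          ≤ 1 - 2 * (m : ℝ) ^ 4 / (n + 1 / 2) ^ 3 - 2 * x ^ 3 := by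
        have h8 : 2 * x ^ 3 = 2 * ((m : ℝ) + 1 / 2) ^ 3 / (n + 1 / 2) ^ 3 := by
          rw [hx, div_pow]; ring
        have h9 : 2 * (m : ℝ) ^ 4 / (n + 1 / 2) ^ 3 + 2 * ((m : ℝ) + 1 / 2) ^ 3 / (n + 1 / 2) ^ 3
            ≤ 2 * (((m + 1 : ℕ) : ℝ)) ^ 4 / (n + 1 / 2) ^ 3 := by
          rw [← add_div]
          gcongr
          have : (0 : ℝ) ≤ m := Nat.cast_nonneg m
          push_cast
          nlinarith [pow_nonneg this 2, pow_nonneg this 3]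
        rw [h8]
        linarith
      linarith

/-- The square of the normalised central binomial times 2n + 1 is the reciprocal of the Wallis
product, so known bounds on that product control β². Since 0 ≤ β ≤ 1, also β ≥ β². -/
theorem central_choose_bounds (n : ℕ) (hn : 1 ≤ n) :
    let β := ((2 * n).choose n : ℝ) / 4 ^ n * Real.sqrt (Real.pi * n)
    0 ≤ β ∧ β ≤ 1 ∧ 1 - 1 / n ≤ β := by
  intro β
  have hpi := Real.pi_pos
  have hn1 : (1 : ℝ) ≤ n := by exact_mod_cast hn
  have h0 : 0 ≤ β := by positivity
  have hW : Real.Wallis.W n * ((((2 * n).choose n : ℝ) / 4 ^ n) ^ 2 * (2 * n + 1)) = 1 := by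
    rw [Real.Wallis.W_eq_factorial_ratio]
    have hf : ((2 * n).factorial : ℝ) = (2 * n).choose n * (n.factorial) ^ 2 := by
      have := Nat.choose_mul_factorial_mul_factorial (show n ≤ 2 * n by omega)
      rw [show 2 * n - n = n by omega] at this
      rw [← this]
      push_cast
      ring
    have hC : 0 < ((2 * n).choose n : ℝ) := by
      exact_mod_cast Nat.choose_pos (by omega)
    have h24 : (2 : ℝ) ^ (4 * n) = (4 ^ n) ^ 2 := by
      rw [← pow_mul, mul_comm n 2, pow_mul, pow_mul]; norm_num
    rw [hf, h24]
    field_simp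
  set b := ((2 * n).choose n : ℝ) / 4 ^ n with hb
  have hβ2 : β ^ 2 = b ^ 2 * (Real.pi * n) := by
    simp only [β]
    rw [mul_pow, Real.sq_sqrt (by positivity)]
  have hWpos := Real.Wallis.W_pos n
  have hW1 := Real.Wallis.W_le n
  have hW2 := Real.Wallis.le_W n
  have hb2 : b ^ 2 = 1 / (Real.Wallis.W n * (2 * n + 1)) := by
    field_simp
    linarith
  have hle : β ^ 2 ≤ 1 := by
    rw [hβ2, hb2, one_div_mul_eq_div, div_le_one (by positivity)]
    have h3 : Real.pi * n ≤ (2 * n + 1) / (2 * n + 2) * (Real.pi / 2) * (2 * n + 1) := by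
      rw [div_mul_eq_mul_div, div_mul_eq_mul_div, le_div_iff₀ (by positivity)]
      nlinarith
    exact h3.trans (by gcongr)
  have hge : 1 - 1 / n ≤ β ^ 2 := by
    rw [hβ2, hb2, one_div_mul_eq_div]
    have h3 : Real.pi * n / (Real.pi / 2 * (2 * n + 1)) ≤ Real.pi * n / (Real.Wallis.W n * (2 * n + 1)) := by
      gcongr
    refine le_trans ?_ h3
    have : Real.pi * n / (Real.pi / 2 * (2 * n + 1)) = 1 - 1 / (2 * n + 1) := by
      field_simp
      ring
    rw [this]
    gcongr
    linarith
  have h1 : β ≤ 1 := by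
    by_contra h
    push Not at h
    nlinarith
  exact ⟨h0, h1, hge.trans (by nlinarith)⟩

theorem exp_neg_mul_poly_le_cube {v : ℝ} (hv : 0 < v) :
    -- 258 = 3! + 4!/2 + 2 · 5!.
    (1 + v / 2 + 2 * v ^ 2) * Real.exp (-v) ≤ 258 / v ^ 3 := by
  have h3 := pow_mul_exp_neg_le 3 hv.le
  have h4 := pow_mul_exp_neg_le 4 hv.le
  have h5 := pow_mul_exp_neg_le 5 hv.le
  norm_num [Nat.factorial] at h3 h4 h5
  rw [le_div_iff₀ (by positivity)]
  nlinarith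

/-- Combines the central asymptotics with the ratio estimate and replaces n + 1/2 by n in the
exponent. As v' ≥ (2/3) v, the constant must be at least 258 · (3/2)³, which is below 1000. The cube
is needed to absorb the growing prefactor in the tail formula. -/
theorem abs_choose_sub_gaussian_le (n m : ℕ) (hn : 1 ≤ n) (hm : 1 ≤ m) :
    |((2 * n).choose (n + m) : ℝ) / 4 ^ n * Real.sqrt (Real.pi * n) - Real.exp (-(m ^ 2 / n))|
      ≤ 1000 / (n * (m ^ 2 / n) ^ 3) := by
  have hn1 : (1 : ℝ) ≤ n := by exact_mod_cast hn
  have hm1 : (1 : ℝ) ≤ m := by exact_mod_cast hm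
  have hC : 0 < ((2 * n).choose n : ℝ) := by
    exact_mod_cast Nat.choose_pos (by omega)
  set a : ℝ := n + 1 / 2 with ha
  have ha0 : 0 < a := by positivity
  set v : ℝ := m ^ 2 / n with hv
  set v' : ℝ := m ^ 2 / a with hv'
  have hv0 : 0 < v := by positivity
  have hv'0 : 0 < v' := by positivity
  obtain ⟨hρ0, hρ1, hρ2⟩ := choose_central_ratio_bounds n m hn
  obtain ⟨hβ0, hβ1, hβ2⟩ := central_choose_bounds n hn
  set ρ := ((2 * n).choose (n + m) : ℝ) / (2 * n).choose n * Real.exp (m ^ 2 / (n + 1 / 2)) with hρ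
  set β := ((2 * n).choose n : ℝ) / 4 ^ n * Real.sqrt (Real.pi * n) with hβ
  have hmain : ((2 * n).choose (n + m) : ℝ) / 4 ^ n * Real.sqrt (Real.pi * n)
      = β * ρ * Real.exp (-v') := by
    have : Real.exp (m ^ 2 / ((n : ℝ) + 1 / 2)) * Real.exp (-v') = 1 := by
      rw [← Real.exp_add, hv', ha]; simp
    rw [hβ, hρ]
    calc _ = ((2 * n).choose n : ℝ) / 4 ^ n * Real.sqrt (Real.pi * n) *
          (((2 * n).choose (n + m) : ℝ) / (2 * n).choose n) * 1 := by field_simp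
      _ = ((2 * n).choose n : ℝ) / 4 ^ n * Real.sqrt (Real.pi * n) *
          (((2 * n).choose (n + m) : ℝ) / (2 * n).choose n) *
          (Real.exp (m ^ 2 / ((n : ℝ) + 1 / 2)) * Real.exp (-v')) := by rw [this]
      _ = _ := by ring
  have hE := Real.exp_pos (-v')
  have hvv : v - v' = v' / (2 * n) := by
    rw [hv, hv', ha]; field_simp; ring
  have hρ3 : 1 - 2 * v' ^ 2 / n ≤ ρ := by
    refine le_trans ?_ hρ2
    have : 2 * (m : ℝ) ^ 4 / (n + 1 / 2) ^ 3 = 2 * v' ^ 2 / a := by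
      rw [hv', ← ha]; field_simp
    rw [this]
    gcongr
    rw [ha]; linarith
  have hexp1 : Real.exp (-v) ≤ Real.exp (-v') := Real.exp_le_exp.2 (by
    have : 0 ≤ v' / (2 * n) := by positivity
    linarith)
  have hexp2 : Real.exp (-v') - Real.exp (-v) ≤ v' / (2 * n) * Real.exp (-v') := by
    have h1 := Real.one_sub_le_exp_neg (v - v')
    have h2 : Real.exp (-v) = Real.exp (-(v - v')) * Real.exp (-v') := by
      rw [← Real.exp_add]; congr 1; ring
    rw [h2, ← hvv]
    nlinarith
  have hβρ : 1 - 1 / n - 2 * v' ^ 2 / n ≤ β * ρ := by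
    have h1 : 0 ≤ (1 - β) * (1 - ρ) := mul_nonneg (by linarith) (by linarith)
    nlinarith
  have hβρ1 : β * ρ ≤ 1 := mul_le_one₀ hβ1 hρ0 hρ1
  have hbound : |β * ρ * Real.exp (-v') - Real.exp (-v)|
      ≤ 1 / n * ((1 + v' / 2 + 2 * v' ^ 2) * Real.exp (-v')) := by
    have e1 : v' / (2 * n) * Real.exp (-v') = 1 / n * (v' / 2 * Real.exp (-v')) := by
      field_simp
    have h1 : (1 - 1 / n - 2 * v' ^ 2 / n) * Real.exp (-v') ≤ β * ρ * Real.exp (-v') := by gcongr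
    have h2 : β * ρ * Real.exp (-v') ≤ 1 * Real.exp (-v') := by gcongr
    have e2 : (1 - 1 / n - 2 * v' ^ 2 / n) * Real.exp (-v')
        = Real.exp (-v') - 1 / n * ((1 + 2 * v' ^ 2) * Real.exp (-v')) := by ring
    have p1 : 0 ≤ 1 / (n : ℝ) * (v' / 2 * Real.exp (-v')) := by positivity
    have p2 : 0 ≤ 1 / (n : ℝ) * ((1 + 2 * v' ^ 2) * Real.exp (-v')) := by positivity
    have e3 : 1 / (n : ℝ) * ((1 + v' / 2 + 2 * v' ^ 2) * Real.exp (-v')) =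
        1 / (n : ℝ) * (v' / 2 * Real.exp (-v'))
          + 1 / (n : ℝ) * ((1 + 2 * v' ^ 2) * Real.exp (-v')) := by ring
    rw [e3, abs_le]
    rw [e2] at h1
    rw [e1] at hexp2
    constructor <;> linarith
  rw [hmain]
  refine hbound.trans ?_
  have hpoly := exp_neg_mul_poly_le_cube hv'0
  have hvv2 : 2 / 3 * v ≤ v' := by
    rw [hv, hv', ← mul_div_assoc, div_le_div_iff₀ (by positivity) ha0, ha]
    nlinarith [sq_nonneg (m : ℝ)]
  have hv3 : (2 / 3 * v) ^ 3 ≤ v' ^ 3 := by gcongr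
  calc 1 / (n : ℝ) * ((1 + v' / 2 + 2 * v' ^ 2) * Real.exp (-v'))
      ≤ 1 / n * (258 / v' ^ 3) := by gcongr
    _ ≤ 1 / n * (258 / (2 / 3 * v) ^ 3) := by gcongr
    _ ≤ 1000 / (n * v ^ 3) := by
      rw [div_mul_div_comm, one_mul, div_le_div_iff₀ (by positivity) (by positivity)]
      have : 0 < n * v ^ 3 := by positivity
      nlinarith

/-- Counterpart of `abs_degreeTail_sub_limitTail_le_mul` for t ≥ 1. The prefactor of the l-th term
is at most 4 t · (l + 1)² t, so the cubic Gaussian error leaves 1/((n + 1) t) times a summable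
sequence. -/
theorem abs_degreeTail_sub_limitTail_le_inv (r n : ℕ) (hrn : (n : ℝ) + 1 ≤ 4 ^ r) :
    |degreeTail r (n + 1) - limitTail (4 ^ r / (n + 1))|
      ≤ 4000 * baselSum / (n + 1) * (4 ^ r / ((n : ℝ) + 1))⁻¹ := by
  have hpi := Real.pi_gt_three
  set t : ℝ := 4 ^ r / (n + 1) with ht
  have hν : (0 : ℝ) < n + 1 := by positivity
  have ht1 : 1 ≤ t := by rw [ht, le_div_iff₀ hν]; linarith
  have ht0 : 0 < t := by linarith
  set N : ℝ := 2 ^ r with hN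
  have hN0 : 0 < N := by positivity
  have hNt : N ^ 2 = t * (n + 1) := by
    rw [ht, hN, div_mul_cancel₀ _ hν.ne', ← pow_mul, mul_comm r 2, pow_mul]
    norm_num
  clear_value t
  have hsq : Real.sqrt (Real.pi * (n + 1)) = Real.sqrt Real.pi * Real.sqrt (n + 1) :=
    Real.sqrt_mul (by positivity) _
  have hsqpi : 1 ≤ Real.sqrt Real.pi := by
    rw [Real.one_le_sqrt]; linarith
  have hst : t ^ (3 / 2 : ℝ) = t * Real.sqrt t := by
    rw [Real.sqrt_eq_rpow, ← Real.rpow_one_add' ht0.le (by norm_num)]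
    norm_num
  have hNs : N = Real.sqrt t * Real.sqrt (n + 1) := by
    rw [← Real.sqrt_mul ht0.le, ← hNt, Real.sqrt_sq hN0.le]
  have hsn : 0 < Real.sqrt ((n : ℝ) + 1) := Real.sqrt_pos.2 hν
  have hsn2 : Real.sqrt ((n : ℝ) + 1) ^ 2 = n + 1 := Real.sq_sqrt hν.le
  set b : ℕ → ℝ := fun l => ((2 * (n + 1)).choose (n + 1 + (l + 1) * 2 ^ r) : ℝ) / 4 ^ (n + 1)
  have hsumK : HasSum (fun l : ℕ => 4 * N / (n + 1) * (((l : ℝ) + 1) * N) ^ 2 *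
      (Real.exp (-((l : ℝ) + 1) ^ 2 * t) / Real.sqrt (Real.pi * (n + 1)))) (limitTail t) := by
    have h := (summable_thetaSum 1 ht0).hasSum.mul_left (4 / Real.sqrt Real.pi * t ^ (3 / 2 : ℝ))
    convert! h using 1
    ext l
    have hc : N * N ^ 2 / ((n + 1) * (Real.sqrt Real.pi * Real.sqrt (n + 1)))
        = t * Real.sqrt t / Real.sqrt Real.pi := by
      rw [hNt]
      nth_rewrite 1 [hNs]
      field_simp
    rw [hst, hsq]
    calc _ = 4 * (N * N ^ 2 / ((n + 1) * (Real.sqrt Real.pi * Real.sqrt (n + 1))))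
          * (((l : ℝ) + 1) ^ 2 * Real.exp (-((l : ℝ) + 1) ^ 2 * t)) := by
          field_simp
      _ = _ := by rw [hc]; ring
  have hbound : ∀ l : ℕ, ‖4 * N / (n + 1) * (((l : ℝ) + 1) * N) ^ 2 * b l -
      4 * N / (n + 1) * (((l : ℝ) + 1) * N) ^ 2 *
      (Real.exp (-((l : ℝ) + 1) ^ 2 * t) / Real.sqrt (Real.pi * (n + 1)))‖
      ≤ 4000 / (n + 1) * t⁻¹ * (1 / ((l : ℝ) + 1) ^ 2) := by
    intro l
    have h := abs_choose_sub_gaussian_le (n + 1) ((l + 1) * 2 ^ r) (by omega)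
      (Nat.mul_pos (by omega) (by positivity))
    push_cast at h
    have hv : (((l : ℝ) + 1) * N) ^ 2 / (n + 1) = ((l : ℝ) + 1) ^ 2 * t := by
      rw [mul_pow, hNt]; field_simp
    rw [← hN, hv] at h
    have hS : 0 < Real.sqrt (Real.pi * (n + 1)) := Real.sqrt_pos.2 (by positivity)
    have hS1 : Real.sqrt (n + 1) ≤ Real.sqrt (Real.pi * (n + 1)) := by
      rw [hsq]
      nlinarith
    have heq : 4 * N / (n + 1) * (((l : ℝ) + 1) * N) ^ 2 * b l -
      4 * N / (n + 1) * (((l : ℝ) + 1) * N) ^ 2 *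
      (Real.exp (-((l : ℝ) + 1) ^ 2 * t) / Real.sqrt (Real.pi * (n + 1))) =
      4 * (N / Real.sqrt (Real.pi * (n + 1))) * ((((l : ℝ) + 1) * N) ^ 2 / (n + 1)) *
      (b l * Real.sqrt (Real.pi * (n + 1)) - Real.exp (-(((l : ℝ) + 1) ^ 2 * t))) := by
      rw [neg_mul]
      field_simp
    have hNS : N / Real.sqrt (Real.pi * (n + 1)) ≤ t := by
      rw [div_le_iff₀ hS]
      have h1 : Real.sqrt t ≤ t := Real.sqrt_le_iff.2 ⟨ht0.le, by nlinarith⟩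
      rw [hNs]
      gcongr
    rw [heq, hv, Real.norm_eq_abs, abs_mul, abs_of_nonneg (by positivity)]
    calc _ ≤ 4 * t * (((l : ℝ) + 1) ^ 2 * t) * (1000 / ((n + 1) * (((l : ℝ) + 1) ^ 2 * t) ^ 3)) := by
          gcongr
      _ = 4000 / (n + 1) * t⁻¹ * (1 / ((l : ℝ) + 1) ^ 2) * (1 / ((l : ℝ) + 1) ^ 2) := by
          field_simp
          ring
      _ ≤ _ := by
          refine mul_le_of_le_one_right (by positivity) ?_
          rw [div_le_one (by positivity)]
          have : (0 : ℝ) ≤ l := Nat.cast_nonneg l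
          nlinarith
  have h3 := summable_one_div_succ_sq.hasSum.mul_left (4000 / ((n : ℝ) + 1) * t⁻¹)
  have hsumb : Summable fun l : ℕ => 4 * N / (n + 1) * (((l : ℝ) + 1) * N) ^ 2 * b l := by
    have := (Summable.of_norm_bounded h3.summable hbound).add hsumK.summable
    simpa using this
  rw [degreeTail_eq_sum_choose, ← hN, ← hsumK.tsum_eq, ← hsumb.tsum_sub hsumK.summable,
    ← Real.norm_eq_abs]
  refine (tsum_of_norm_bounded h3 hbound).trans (le_of_eq ?_)
  rw [baselSum]
  ring

end LatticePath


/-! ### Regularised sums over integer translates and unfolding -/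

namespace LatticePath

open Filter Topology MeasureTheory

theorem summable_int_weight :
    Summable fun r : ℤ => (2 * |(r : ℝ)| + 1) * Real.exp (-|(r : ℝ)|) := by
  have h1 : Summable fun n : ℕ => (2 * (n : ℝ) + 1) * Real.exp (-(n : ℝ)) := by
    have h2 := (Real.summable_pow_mul_exp_neg_nat_mul 1 one_pos).mul_left 2
    have h3 := Real.summable_pow_mul_exp_neg_nat_mul 0 one_pos
    refine (h2.add h3).congr fun n => ?_
    simp
    ring
  refine Summable.of_nat_of_neg ?_ ?_
  · simpa using h1
  · simpa using h1

/-- A continuously differentiable function that tends to the unit step function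
exponentially fast at both ends. -/
structure SmoothStep (q q' : ℝ → ℝ) (C : ℝ) : Prop where
  hasDerivAt : ∀ u, HasDerivAt q (q' u) u
  continuous_deriv : Continuous q'
  bound : ∀ u, |q u - (if 0 < u then 1 else 0)| ≤ C * Real.exp (-|u|)
  bound_deriv : ∀ u, |q' u| ≤ C * Real.exp (-|u|)

/-- The regularised sum of the integer translates of `q` with weights `w`. -/
noncomputable def shiftSum (q : ℝ → ℝ) (w : ℤ → ℝ) (x : ℝ) : ℝ :=
  ∑' r : ℤ, w r * (q (x - r) - if r ≤ 0 then 1 else 0)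

theorem exp_neg_abs_sub_le {x M : ℝ} (r : ℤ) (hx : |x| ≤ M) :
    Real.exp (-|x - r|) ≤ Real.exp M * Real.exp (-|(r : ℝ)|) := by
  rw [← Real.exp_add]
  refine Real.exp_le_exp.2 ?_
  have := abs_sub_abs_le_abs_sub (r : ℝ) x
  rw [abs_sub_comm] at this
  linarith

/-- On the period (0, 1] the regulariser coincides with the translated unit step, so each summand
there is a translate of the single function q minus the step. -/
theorem step_sub_int {x : ℝ} (hx0 : 0 < x) (hx1 : x ≤ 1) (r : ℤ) :
    (if 0 < x - r then (1 : ℝ) else 0) = if r ≤ 0 then 1 else 0 := by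
  have : 0 < x - r ↔ r ≤ 0 := by
    constructor
    · intro hr
      by_contra hcon
      have : (1 : ℝ) ≤ r := by exact_mod_cast (by omega : 1 ≤ r)
      linarith
    · intro hr
      have : (r : ℝ) ≤ 0 := by exact_mod_cast hr
      linarith
  simp [this]

section ShiftSum

variable {q q' : ℝ → ℝ} {C : ℝ}

theorem SmoothStep.nonneg (h : SmoothStep q q' C) : 0 ≤ C := by
  have := (abs_nonneg _).trans (h.bound_deriv 0)
  simpa using this

theorem SmoothStep.norm_deriv_term_le (h : SmoothStep q q' C) {w : ℤ → ℝ}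
    (hw : ∀ r, |w r| ≤ 2 * |(r : ℝ)| + 1) {M y : ℝ} (hy : |y| ≤ M) (r : ℤ) :
    ‖w r * q' (y - r)‖
      ≤ C * Real.exp M * ((2 * |(r : ℝ)| + 1) * Real.exp (-|(r : ℝ)|)) := by
  have hC := h.nonneg
  rw [norm_mul, Real.norm_eq_abs, Real.norm_eq_abs]
  calc |w r| * |q' (y - r)| ≤ (2 * |(r : ℝ)| + 1) * (C * Real.exp (-|y - r|)) :=
        mul_le_mul (hw r) (h.bound_deriv _) (abs_nonneg _) (by positivity)
    _ ≤ (2 * |(r : ℝ)| + 1) * (C * (Real.exp M * Real.exp (-|(r : ℝ)|))) := by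
        gcongr
        exact exp_neg_abs_sub_le r hy
    _ = _ := by ring

theorem SmoothStep.summable_at_half (h : SmoothStep q q' C) {w : ℤ → ℝ}
    (hw : ∀ r, |w r| ≤ 2 * |(r : ℝ)| + 1) :
    Summable fun r : ℤ => w r * (q (1 / 2 - r) - if r ≤ 0 then 1 else 0) := by
  have hC := h.nonneg
  refine Summable.of_norm_bounded (summable_int_weight.mul_left (C * Real.exp 1)) fun r => ?_
  rw [← step_sub_int (x := 1 / 2) (by norm_num) (by norm_num) r, norm_mul, Real.norm_eq_abs,
    Real.norm_eq_abs]
  calc _ ≤ (2 * |(r : ℝ)| + 1) * (C * Real.exp (-|1 / 2 - (r : ℝ)|)) :=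
        mul_le_mul (hw r) (h.bound _) (abs_nonneg _) (by positivity)
    _ ≤ (2 * |(r : ℝ)| + 1) * (C * (Real.exp 1 * Real.exp (-|(r : ℝ)|))) := by
        gcongr
        exact exp_neg_abs_sub_le r (by rw [abs_of_pos] <;> norm_num)
    _ = _ := by ring

theorem SmoothStep.hasDerivAt_term (h : SmoothStep q q' C) (w : ℤ → ℝ) (r : ℤ) (y : ℝ) :
    HasDerivAt (fun y : ℝ => w r * (q (y - r) - if r ≤ 0 then 1 else 0)) (w r * q' (y - r)) y :=
  (((h.hasDerivAt (y - r)).comp_sub_const y (r : ℝ)).sub_const _).const_mul _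

/-- Summability is direct at 1/2, where the regulariser is the step itself. The locally uniform
bound on the derivatives carries it to every point. -/
theorem SmoothStep.summable (h : SmoothStep q q' C) {w : ℤ → ℝ}
    (hw : ∀ r, |w r| ≤ 2 * |(r : ℝ)| + 1) (x : ℝ) :
    Summable fun r : ℤ => w r * (q (x - r) - if r ≤ 0 then 1 else 0) := by
  refine summable_of_summable_hasDerivAt_of_isPreconnected
    (t := Metric.ball 0 (|x| + 1)) (y₀ := 1 / 2)
    (summable_int_weight.mul_left (C * Real.exp (|x| + 1))) Metric.isOpen_ball
    (convex_ball _ _).isPreconnected (fun r y _ => h.hasDerivAt_term w r y)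
    (fun r y hy => h.norm_deriv_term_le hw (mem_ball_zero_iff.1 hy).le r) ?_ (h.summable_at_half hw) ?_
  · simp only [Metric.mem_ball, dist_zero_right, Real.norm_eq_abs]
    rw [abs_of_pos] <;> [linarith [abs_nonneg x]; norm_num]
  · simp

theorem SmoothStep.hasDerivAt_shiftSum (h : SmoothStep q q' C) {w : ℤ → ℝ}
    (hw : ∀ r, |w r| ≤ 2 * |(r : ℝ)| + 1) (x : ℝ) :
    HasDerivAt (shiftSum q w) (∑' r : ℤ, w r * q' (x - r)) x := by
  refine hasDerivAt_tsum_of_isPreconnected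
    (t := Metric.ball 0 (|x| + 1)) (y₀ := 1 / 2)
    (summable_int_weight.mul_left (C * Real.exp (|x| + 1))) Metric.isOpen_ball
    (convex_ball _ _).isPreconnected (fun r y _ => h.hasDerivAt_term w r y)
    (fun r y hy => h.norm_deriv_term_le hw (mem_ball_zero_iff.1 hy).le r) ?_ (h.summable_at_half hw) ?_
  · simp only [Metric.mem_ball, dist_zero_right, Real.norm_eq_abs]
    rw [abs_of_pos] <;> [linarith [abs_nonneg x]; norm_num]
  · simp

theorem SmoothStep.continuous_tsum_deriv (h : SmoothStep q q' C) {w : ℤ → ℝ}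
    (hw : ∀ r, |w r| ≤ 2 * |(r : ℝ)| + 1) : Continuous fun x => ∑' r : ℤ, w r * q' (x - r) := by
  refine continuous_iff_continuousAt.2 fun x => ?_
  have hc : ContinuousOn (fun x => ∑' r : ℤ, w r * q' (x - r)) (Metric.ball 0 (|x| + 1)) :=
    continuousOn_tsum (fun r => (continuous_const.mul
      (h.continuous_deriv.comp (continuous_sub_right _))).continuousOn)
      (summable_int_weight.mul_left (C * Real.exp (|x| + 1)))
      (fun r y hy => h.norm_deriv_term_le hw (mem_ball_zero_iff.1 hy).le r)
  exact hc.continuousAt (Metric.isOpen_ball.mem_nhds (by simp))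

/-- After r is replaced by r + 1 the regulariser changes only at r = 0, and this produces the extra
term `w 1`. -/
theorem SmoothStep.shiftSum_add_one (h : SmoothStep q q' C) {w : ℤ → ℝ}
    (hw : ∀ r, |w (r + 1)| ≤ 2 * |(r : ℝ)| + 1) (x : ℝ) :
    shiftSum q w (x + 1) = shiftSum q (fun r => w (r + 1)) x + w 1 := by
  rw [shiftSum, ← (Equiv.addRight (1 : ℤ)).tsum_eq]
  have h1 : HasSum (fun r : ℤ => if r = 0 then w 1 else 0) (w 1) := by
    simpa using hasSum_ite_eq (0 : ℤ) (w 1)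
  have h2 := ((h.summable hw x).hasSum.add h1)
  rw [shiftSum, ← h2.tsum_eq]
  refine tsum_congr fun r => ?_
  change w (r + 1) * (q (x + 1 - ((r + 1 : ℤ) : ℝ)) - if r + 1 ≤ 0 then 1 else 0) = _
  have e : x + 1 - ((r + 1 : ℤ) : ℝ) = x - r := by push_cast; ring
  rw [e]
  rcases lt_trichotomy r 0 with hr | hr | hr
  · rw [if_pos (by omega), if_pos (by omega), if_neg (by omega)]
    ring
  · subst hr
    simp
    ring
  · rw [if_neg (by omega), if_neg (by omega), if_neg (by omega)]
    ring

theorem integrable_weight : Integrable fun t : ℝ => (2 * |t| + 1) * Real.exp (-|t|) := by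
  -- 17 = 2 · 3! + 2! + 2 · 1! + 1 bounds (2s + 1)(1 + s²) exp(-s) for s ≥ 0.
  refine (integrable_inv_one_add_sq.const_mul 17).mono' ?_ (Eventually.of_forall fun t => ?_)
  · exact Continuous.aestronglyMeasurable (by fun_prop)
  · have h0 : 0 ≤ |t| := abs_nonneg t
    have h1 := pow_mul_exp_neg_le 1 h0
    have h2 := pow_mul_exp_neg_le 2 h0
    have h3 := pow_mul_exp_neg_le 3 h0
    have h4 : Real.exp (-|t|) ≤ 1 := Real.exp_le_one_iff.2 (by linarith)
    norm_num [Nat.factorial] at h1 h2 h3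
    rw [Real.norm_of_nonneg (by positivity), ← div_eq_mul_inv, le_div_iff₀ (by positivity),
      ← sq_abs t]
    rw [← sq_abs] at h2
    nlinarith

theorem SmoothStep.continuous (h : SmoothStep q q' C) : Continuous q :=
  continuous_iff_continuousAt.2 fun u => (h.hasDerivAt u).continuousAt

theorem SmoothStep.norm_mul_le (h : SmoothStep q q' C) {a : ℝ → ℂ}
    (hb : ∀ t, ‖a t‖ ≤ 2 * |t| + 1) (t : ℝ) :
    ‖a t * ((q t - (if 0 < t then 1 else 0) : ℝ) : ℂ)‖
      ≤ C * ((2 * |t| + 1) * Real.exp (-|t|)) := by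
  rw [norm_mul, Complex.norm_real, Real.norm_eq_abs]
  calc _ ≤ (2 * |t| + 1) * (C * Real.exp (-|t|)) :=
        mul_le_mul (hb t) (h.bound t) (abs_nonneg _) (by positivity)
    _ = _ := by ring

theorem SmoothStep.measurable_sub_step (h : SmoothStep q q' C) {a : ℝ → ℂ} (ha : Continuous a) :
    Measurable fun t => a t * ((q t - (if 0 < t then 1 else 0) : ℝ) : ℂ) := by
  refine ha.measurable.mul (Complex.measurable_ofReal.comp (h.continuous.measurable.sub ?_))
  exact Measurable.ite measurableSet_Ioi measurable_const measurable_const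

theorem SmoothStep.integrable_mul (h : SmoothStep q q' C) {a : ℝ → ℂ} (ha : Continuous a)
    (hb : ∀ t, ‖a t‖ ≤ 2 * |t| + 1) :
    Integrable fun t => a t * ((q t - (if 0 < t then 1 else 0) : ℝ) : ℂ) :=
  (integrable_weight.const_mul C).mono' (h.measurable_sub_step ha).aestronglyMeasurable
    (Eventually.of_forall (h.norm_mul_le hb))

/-- On (0, 1] the series has the terms F(x - r) for one integrable F on the line, and integrating
over a period glues the translates together. Dominated convergence justifies the exchange. -/
theorem SmoothStep.integral_unfold (h : SmoothStep q q' C) {a : ℝ → ℂ} (ha : Continuous a)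
    (hb : ∀ t, ‖a t‖ ≤ 2 * |t| + 1) {G : ℝ → ℂ}
    (hG : ∀ x, HasSum (fun r : ℤ => a (x - r) * ((q (x - r) - (if r ≤ 0 then 1 else 0) : ℝ) : ℂ))
      (G x)) :
    ∫ x in (0 : ℝ)..1, G x = ∫ t, a t * ((q t - (if 0 < t then 1 else 0) : ℝ) : ℂ) := by
  have hC := h.nonneg
  set F : ℝ → ℂ := fun t => a t * ((q t - (if 0 < t then 1 else 0) : ℝ) : ℂ) with hF
  have h1 := (h.integrable_mul ha hb).hasSum_intervalIntegral_comp_add_int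
  have h2 : HasSum (fun r : ℤ => ∫ x in (0 : ℝ)..1, F (x + r)) (∫ x in (0 : ℝ)..1, G x) := by
    refine intervalIntegral.hasSum_integral_of_dominated_convergence
      (fun r _ => C * Real.exp 1 * 3 * ((2 * |(r : ℝ)| + 1) * Real.exp (-|(r : ℝ)|))) ?_ ?_ ?_ ?_ ?_
    · intro r
      exact ((h.measurable_sub_step ha).comp (measurable_add_const (r : ℝ))).aestronglyMeasurable
    · intro r
      refine Eventually.of_forall fun x hx => ?_
      rw [Set.uIoc_of_le zero_le_one] at hx
      refine (h.norm_mul_le hb (x + r)).trans ?_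
      have hx' : |x| ≤ 1 := by rw [abs_of_pos hx.1]; exact hx.2
      have e1 := exp_neg_abs_sub_le (-r) hx'
      rw [Int.cast_neg, sub_neg_eq_add, abs_neg] at e1
      have e2 : 2 * |x + r| + 1 ≤ 3 * (2 * |(r : ℝ)| + 1) := by
        have := abs_add_le x r
        have := abs_nonneg (r : ℝ)
        linarith
      calc C * ((2 * |x + r| + 1) * Real.exp (-|x + r|))
          ≤ C * ((3 * (2 * |(r : ℝ)| + 1)) * (Real.exp 1 * Real.exp (-|(r : ℝ)|))) := by
            gcongr
        _ = _ := by ring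
    · exact Eventually.of_forall fun x _ => summable_int_weight.mul_left _
    · exact intervalIntegrable_const
    · refine Eventually.of_forall fun x hx => ?_
      rw [Set.uIoc_of_le zero_le_one] at hx
      rw [← (Equiv.neg ℤ).hasSum_iff]
      convert! hG x using 1
      ext r
      have e : x + ((Equiv.neg ℤ r : ℤ) : ℝ) = x - r := by simp [sub_eq_add_neg]
      simp only [Function.comp, hF]
      rw [e, step_sub_int hx.1 hx.2]
  exact h2.unique h1

end ShiftSum

end LatticePath


/-! ### Fourier series of the periodic parts -/

namespace LatticePath

open Filter Topology MeasureTheory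

/-- The character `e ^ (-2 π i k t)`. -/
noncomputable def fourierExp (k : ℤ) (t : ℝ) : ℂ :=
  Complex.exp (-(2 * k * Real.pi * Complex.I * t))

theorem continuous_fourierExp (k : ℤ) : Continuous (fourierExp k) := by
  unfold fourierExp
  fun_prop

theorem norm_fourierExp (k : ℤ) (t : ℝ) : ‖fourierExp k t‖ = 1 := by
  have : -(2 * (k : ℂ) * Real.pi * Complex.I * t) = ((-(2 * k * Real.pi * t) : ℝ) : ℂ) * Complex.I := by
    push_cast
    ring
  rw [fourierExp, this, Complex.norm_exp_ofReal_mul_I]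

theorem fourierExp_sub_int (k : ℤ) (t : ℝ) (r : ℤ) :
    fourierExp k (t - r) = fourierExp k t := by
  rw [fourierExp, fourierExp]
  refine Complex.exp_eq_exp_iff_exists_int.2 ⟨k * r, ?_⟩
  push_cast
  ring

theorem fourierExp_zero (t : ℝ) : fourierExp 0 t = 1 := by
  simp [fourierExp]

/-- Integration by parts gives |c_k(f)| ≤ |c_k(f')| / |k| for k ≠ 0. This is at most |c_k(f')|² +
1/k², summable by Parseval. -/
theorem summable_fourierCoeffOn_of_hasDerivAt {f f' : ℝ → ℂ}
    (hd : ∀ x, HasDerivAt f (f' x) x) (hc : Continuous f') (hp : f 1 = f 0) :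
    Summable (fourierCoeffOn zero_lt_one f) := by
  obtain ⟨M, hM⟩ := isCompact_Icc.exists_bound_of_continuousOn (s := Set.Icc (0 : ℝ) 1)
    hc.continuousOn
  have hmem : MemLp f' 2 (volume.restrict (Set.Ioc 0 1)) := by
    refine MemLp.of_bound hc.aestronglyMeasurable M ?_
    filter_upwards [ae_restrict_mem measurableSet_Ioc] with x hx
    exact hM x (Set.Ioc_subset_Icc_self hx)
  have h2 := (hasSum_sq_fourierCoeffOn zero_lt_one hmem).summable
  have h1 : Summable fun k : ℤ => 1 / (k : ℝ) ^ 2 := Real.summable_one_div_int_pow.2 one_lt_two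
  have h0 : Summable fun k : ℤ => if k = 0 then ‖fourierCoeffOn zero_lt_one f 0‖ else 0 :=
    (hasSum_ite_eq (0 : ℤ) _).summable
  refine Summable.of_norm_bounded ((h2.add h1).add h0) fun k => ?_
  by_cases hk : k = 0
  · subst hk
    simp
  · have hkR : (0 : ℝ) < |(k : ℝ)| := by positivity
    rw [fourierCoeffOn_of_hasDerivAt zero_lt_one hk (fun x _ => hd x) (hc.intervalIntegrable _ _),
      hp, if_neg hk, add_zero]
    simp only [sub_self, mul_zero, zero_sub, Complex.ofReal_one, Complex.ofReal_zero, sub_zero,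
      one_mul, mul_neg, norm_neg, norm_mul, norm_div, norm_one, Complex.norm_I, mul_one,
      Complex.norm_intCast, Complex.norm_real, Real.norm_eq_abs, abs_of_pos Real.pi_pos,
      RCLike.norm_ofNat]
    set c := ‖fourierCoeffOn zero_lt_one f' k‖
    have hle : 1 / (2 * Real.pi * |(k : ℝ)|) ≤ 1 / |(k : ℝ)| := by
      have := Real.pi_gt_three
      gcongr
      nlinarith
    have hsq : 1 / (k : ℝ) ^ 2 = (1 / |(k : ℝ)|) ^ 2 := by rw [div_pow, sq_abs, one_pow]
    have hc0 : 0 ≤ c := norm_nonneg _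
    rw [hsq]
    have := mul_le_mul_of_nonneg_right hle hc0
    nlinarith [sq_nonneg (1 / |(k : ℝ)| - c), sq_nonneg (1 / |(k : ℝ)|), sq_nonneg c]

theorem hasSum_fourier_of_hasDerivAt {f f' : ℝ → ℝ} (hp : Function.Periodic f 1)
    (hd : ∀ x, HasDerivAt f (f' x) x) (hc : Continuous f') (x : ℝ) :
    HasSum (fun k : ℤ => (∫ y in (0 : ℝ)..1, fourierExp k y * f y)
      * Complex.exp (2 * k * Real.pi * Complex.I * x)) (f x : ℂ) := by
  have hfc : Continuous f := continuous_iff_continuousAt.2 fun u => (hd u).continuousAt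
  have hp' : Function.Periodic (fun y => (f y : ℂ)) 1 := fun y => by simp [hp y]
  let F : C(AddCircle (1 : ℝ), ℂ) :=
    ⟨hp'.lift, continuous_coinduced_dom.mpr (Complex.continuous_ofReal.comp hfc)⟩
  have hcoef : ∀ k, fourierCoeff F k = ∫ y in (0 : ℝ)..1, fourierExp k y * f y := by
    intro k
    rw [fourierCoeff_eq_intervalIntegral F k 0, zero_add, one_div_one, one_smul]
    refine intervalIntegral.integral_congr fun y _ => ?_
    simp only [smul_eq_mul]
    rw [fourier_coe_apply, fourierExp]
    congr 2
    push_cast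
    ring
  have hcoefOn : ∀ k, fourierCoeffOn zero_lt_one (fun y => (f y : ℂ)) k
      = ∫ y in (0 : ℝ)..1, fourierExp k y * f y := by
    intro k
    rw [fourierCoeffOn_eq_integral, sub_zero, one_div_one, one_smul]
    refine intervalIntegral.integral_congr fun y _ => ?_
    simp only [smul_eq_mul]
    rw [fourier_coe_apply, fourierExp]
    congr 2
    push_cast
    ring
  have hsum : Summable (fourierCoeff F) := by
    have := summable_fourierCoeffOn_of_hasDerivAt (f := fun y => (f y : ℂ))
      (f' := fun y => (f' y : ℂ)) (fun y => (hd y).ofReal_comp)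
      (Complex.continuous_ofReal.comp hc) (by simpa using hp' 0)
    refine this.congr fun k => ?_
    rw [hcoef, hcoefOn]
  have h := has_pointwise_sum_fourier_series_of_summable hsum (x : AddCircle (1 : ℝ))
  convert! h using 1
  ext k
  rw [smul_eq_mul, hcoef, fourier_coe_apply]
  congr 2
  push_cast
  ring

theorem integral_fourierExp_mul_id (k : ℤ) (hk : k ≠ 0) :
    ∫ x in (0 : ℝ)..1, fourierExp k x * x = -(1 / (2 * k * Real.pi * Complex.I)) := by
  set a : ℂ := 2 * k * Real.pi * Complex.I with ha
  have ha0 : a ≠ 0 := by simp [ha, hk, Real.pi_ne_zero]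
  have hder : ∀ x : ℝ, HasDerivAt (fun x : ℝ => Complex.exp (-(a * x)) * (-x / a - 1 / a ^ 2))
      (fourierExp k x * x) x := by
    intro x
    have h1 : HasDerivAt (fun z : ℂ => Complex.exp (-(a * z)) * (-z / a - 1 / a ^ 2))
        (Complex.exp (-(a * x)) * x) (x : ℂ) := by
      have e1 : HasDerivAt (fun z : ℂ => -(a * z)) (-a) (x : ℂ) := by
        exact (((hasDerivAt_id (x : ℂ)).const_mul a).neg).congr_deriv (by simp)
      have e2 : HasDerivAt (fun z : ℂ => -z / a - 1 / a ^ 2) (-1 / a) (x : ℂ) :=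
        (((hasDerivAt_id (x : ℂ)).neg).div_const a).sub_const _
      refine (e1.cexp.mul e2).congr_deriv ?_
      field_simp
      ring
    exact h1.comp_ofReal
  have hE : Complex.exp (-a) = 1 := by
    have := fourierExp_sub_int k 1 1
    simpa [fourierExp, ha] using this.symm
  rw [intervalIntegral.integral_eq_sub_of_hasDerivAt (fun x _ => hder x)]
  · simp [hE, neg_div]
  · exact ((continuous_fourierExp k).mul Complex.continuous_ofReal).intervalIntegrable _ _

theorem integral_fourierExp_mul_sq (k : ℤ) (hk : k ≠ 0) :
    ∫ x in (0 : ℝ)..1, fourierExp k x * (x : ℂ) ^ 2 = -(1 / (2 * k * Real.pi * Complex.I))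
      - 2 / (2 * k * Real.pi * Complex.I) ^ 2 := by
  set a : ℂ := 2 * k * Real.pi * Complex.I with ha
  have ha0 : a ≠ 0 := by simp [ha, hk, Real.pi_ne_zero]
  have hder : ∀ x : ℝ, HasDerivAt
      (fun x : ℝ => Complex.exp (-(a * x)) * (-(x : ℂ) ^ 2 / a - 2 * x / a ^ 2 - 2 / a ^ 3))
      (fourierExp k x * (x : ℂ) ^ 2) x := by
    intro x
    have h1 : HasDerivAt
        (fun z : ℂ => Complex.exp (-(a * z)) * (-z ^ 2 / a - 2 * z / a ^ 2 - 2 / a ^ 3))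
        (Complex.exp (-(a * x)) * (x : ℂ) ^ 2) (x : ℂ) := by
      have e1 : HasDerivAt (fun z : ℂ => -(a * z)) (-a) (x : ℂ) := by
        exact (((hasDerivAt_id (x : ℂ)).const_mul a).neg).congr_deriv (by simp)
      have e2 : HasDerivAt (fun z : ℂ => -z ^ 2 / a - 2 * z / a ^ 2 - 2 / a ^ 3)
          (-(2 * x) / a - 2 / a ^ 2) (x : ℂ) := by
        refine ((((hasDerivAt_pow 2 (x : ℂ)).neg).div_const a).sub
          (((hasDerivAt_id (x : ℂ)).const_mul 2).div_const (a ^ 2))).sub_const _ |>.congr_deriv ?_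
        simp
      refine (e1.cexp.mul e2).congr_deriv ?_
      field_simp
      ring
    exact h1.comp_ofReal
  have hE : Complex.exp (-a) = 1 := by
    have := fourierExp_sub_int k 1 1
    simpa [fourierExp, ha] using this.symm
  rw [intervalIntegral.integral_eq_sub_of_hasDerivAt (fun x _ => hder x)]
  · simp [hE]
    ring
  · exact ((continuous_fourierExp k).mul
      (Complex.continuous_ofReal.pow 2)).intervalIntegrable _ _

/-- The regularised sum of all integer translates of `q`. -/
noncomputable def firstSum (q : ℝ → ℝ) : ℝ → ℝ := shiftSum q fun _ => 1

/-- The regularised sum of all integer translates of `q` with weights `2 r - 1`. -/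
noncomputable def secondSum (q : ℝ → ℝ) : ℝ → ℝ := shiftSum q fun r => 2 * r - 1

/-- The periodic part of `secondSum`. -/
noncomputable def secondPeriodic (q : ℝ → ℝ) (x : ℝ) : ℝ :=
  secondSum q x - 2 * x * firstSum q x + x ^ 2

section Periodic

variable {q q' : ℝ → ℝ} {C : ℝ}

theorem abs_one_le_weight (r : ℤ) : |(1 : ℝ)| ≤ 2 * |(r : ℝ)| + 1 := by
  have := abs_nonneg (r : ℝ)
  rw [abs_one]
  linarith

theorem abs_two_mul_sub_one_le_weight (r : ℤ) : |2 * (r : ℝ) - 1| ≤ 2 * |(r : ℝ)| + 1 := by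
  have := abs_sub (2 * (r : ℝ)) 1
  rwa [abs_mul, abs_two, abs_one] at this

theorem SmoothStep.firstSum_add_one (h : SmoothStep q q' C) (x : ℝ) :
    firstSum q (x + 1) = firstSum q x + 1 :=
  h.shiftSum_add_one (w := fun _ => 1) abs_one_le_weight x

/-- The shifted weight is 2(r + 1) - 1 = (2r - 1) + 2, whence the additional copies of the first
sum. -/
theorem SmoothStep.secondSum_add_one (h : SmoothStep q q' C) (x : ℝ) :
    secondSum q (x + 1) = secondSum q x + 2 * firstSum q x + 1 := by
  rw [secondSum, h.shiftSum_add_one (w := fun r => 2 * (r : ℝ) - 1)]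
  · have h1 := (h.summable abs_two_mul_sub_one_le_weight x).hasSum.add
      ((h.summable abs_one_le_weight x).hasSum.mul_left 2)
    rw [firstSum, shiftSum, shiftSum, shiftSum, ← h1.tsum_eq]
    congr 1
    · refine tsum_congr fun r => ?_
      push_cast
      ring
    · norm_num
  · intro r
    have := abs_add_le (2 * (r : ℝ)) 1
    rw [abs_mul, abs_two, abs_one] at this
    refine le_trans (le_of_eq ?_) this
    congr 1
    push_cast
    ring

theorem SmoothStep.periodic_firstSum_sub (h : SmoothStep q q' C) :
    Function.Periodic (fun x => firstSum q x - x) 1 := fun x => by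
  simp only [h.firstSum_add_one]
  ring

theorem SmoothStep.periodic_secondPeriodic (h : SmoothStep q q' C) :
    Function.Periodic (secondPeriodic q) 1 := fun x => by
  simp only [secondPeriodic, h.firstSum_add_one, h.secondSum_add_one]
  ring

theorem SmoothStep.exists_deriv_firstSum_sub (h : SmoothStep q q' C) :
    ∃ f' : ℝ → ℝ, (∀ x, HasDerivAt (fun x => firstSum q x - x) (f' x) x) ∧ Continuous f' :=
  ⟨_, fun x => (h.hasDerivAt_shiftSum abs_one_le_weight x).sub (hasDerivAt_id x),
    (h.continuous_tsum_deriv abs_one_le_weight).sub continuous_const⟩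

theorem SmoothStep.continuous_firstSum (h : SmoothStep q q' C) : Continuous (firstSum q) :=
  continuous_iff_continuousAt.2 fun x =>
    (h.hasDerivAt_shiftSum abs_one_le_weight x).continuousAt

theorem SmoothStep.continuous_secondSum (h : SmoothStep q q' C) : Continuous (secondSum q) :=
  continuous_iff_continuousAt.2 fun x =>
    (h.hasDerivAt_shiftSum abs_two_mul_sub_one_le_weight x).continuousAt

theorem SmoothStep.exists_deriv_secondPeriodic (h : SmoothStep q q' C) :
    ∃ f' : ℝ → ℝ, (∀ x, HasDerivAt (secondPeriodic q) (f' x) x) ∧ Continuous f' := by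
  refine ⟨fun x => (∑' r : ℤ, (2 * (r : ℝ) - 1) * q' (x - r))
    - (2 * firstSum q x + 2 * x * ∑' r : ℤ, 1 * q' (x - r)) + 2 * x, fun x => ?_, ?_⟩
  · have h1 := h.hasDerivAt_shiftSum abs_two_mul_sub_one_le_weight x
    have h2 := h.hasDerivAt_shiftSum abs_one_le_weight x
    have h3 : HasDerivAt (fun x : ℝ => 2 * x) 2 x := by
      simpa using (hasDerivAt_id x).const_mul 2
    refine ((h1.sub (h3.mul h2)).add (hasDerivAt_pow 2 x)).congr_deriv ?_
    rw [firstSum]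
    simp
  · have c1 := h.continuous_tsum_deriv abs_two_mul_sub_one_le_weight
    have c2 := h.continuous_tsum_deriv abs_one_le_weight
    have c3 := h.continuous_firstSum
    exact (c1.sub ((continuous_const.mul c3).add ((continuous_const.mul continuous_id).mul c2))).add
      (continuous_const.mul continuous_id)

theorem SmoothStep.integral_fourierExp_mul_firstSum (h : SmoothStep q q' C) (k : ℤ) :
    ∫ y in (0 : ℝ)..1, fourierExp k y * ((firstSum q y - y : ℝ) : ℂ) =
      (∫ t, fourierExp k t * ((q t - (if 0 < t then 1 else 0) : ℝ) : ℂ))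
        - ∫ y in (0 : ℝ)..1, fourierExp k y * y := by
  rw [← h.integral_unfold (a := fourierExp k) (continuous_fourierExp k) (fun t => ?_)
    (G := fun x => fourierExp k x * (firstSum q x : ℂ)) (fun x => ?_),
    ← intervalIntegral.integral_sub]
  · refine intervalIntegral.integral_congr fun y _ => ?_
    push_cast
    ring
  · exact ((continuous_fourierExp k).mul
      (Complex.continuous_ofReal.comp h.continuous_firstSum)).intervalIntegrable _ _
  · exact ((continuous_fourierExp k).mul Complex.continuous_ofReal).intervalIntegrable _ _
  · rw [norm_fourierExp]
    linarith [abs_nonneg t]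
  · have h1 := (Complex.hasSum_ofReal.2 (h.summable abs_one_le_weight x).hasSum).mul_left
      (fourierExp k x)
    convert! h1 using 1
    ext r
    rw [fourierExp_sub_int, one_mul]

/-- With t = x - r, the weight (2r - 1) - 2x equals -(2t + 1). Thus the combination of both sums is
again a sum of translates and unfolds. -/
theorem SmoothStep.integral_fourierExp_mul_secondPeriodic (h : SmoothStep q q' C) (k : ℤ) :
    ∫ y in (0 : ℝ)..1, fourierExp k y * (secondPeriodic q y : ℂ) =
      (∫ t, fourierExp k t * (-(2 * t + 1)) * ((q t - (if 0 < t then 1 else 0) : ℝ) : ℂ))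
        + ∫ y in (0 : ℝ)..1, fourierExp k y * (y : ℂ) ^ 2 := by
  have c1 : Continuous fun x : ℝ =>
      fourierExp k x * ((secondSum q x - 2 * x * firstSum q x : ℝ) : ℂ) :=
    (continuous_fourierExp k).mul (Complex.continuous_ofReal.comp
      (h.continuous_secondSum.sub ((continuous_const.mul continuous_id).mul h.continuous_firstSum)))
  rw [← h.integral_unfold (a := fun t => fourierExp k t * (-(2 * t + 1)))
    ((continuous_fourierExp k).mul (by fun_prop)) (fun t => ?_)
    (G := fun x => fourierExp k x * ((secondSum q x - 2 * x * firstSum q x : ℝ) : ℂ))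
    (fun x => ?_),
    ← intervalIntegral.integral_add (c1.intervalIntegrable _ _)]
  · refine intervalIntegral.integral_congr fun y _ => ?_
    simp only [secondPeriodic]
    push_cast
    ring
  · exact ((continuous_fourierExp k).mul
      (Complex.continuous_ofReal.pow 2)).intervalIntegrable _ _
  · rw [norm_mul, norm_fourierExp, one_mul, norm_neg]
    refine (norm_add_le _ _).trans ?_
    simp
  · have h1 := (Complex.hasSum_ofReal.2 ((h.summable abs_two_mul_sub_one_le_weight x).hasSum.sub
      ((h.summable abs_one_le_weight x).hasSum.mul_left (2 * x)))).mul_left (fourierExp k x)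
    convert! h1 using 1
    ext r
    rw [fourierExp_sub_int]
    push_cast
    ring

end Periodic

end LatticePath


/-! ### The Mellin transform of the limiting tail -/

namespace LatticePath

open Filter Topology MeasureTheory

/-- The limiting tail function in logarithmic scale. -/
noncomputable def logTail (u : ℝ) : ℝ := limitTail (Real.exp (-(u * Real.log 4)))

theorem one_le_log_four : 1 ≤ Real.log 4 := by
  rw [Real.le_log_iff_exp_le (by norm_num)]
  linarith [Real.exp_one_lt_d9]

theorem log_four_le_two : Real.log 4 ≤ 2 := by
  rw [show (4 : ℝ) = 2 ^ 2 by norm_num, Real.log_pow]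
  push_cast
  linarith [Real.log_two_lt_d9]

/-- Substituting t = 4^(-u) turns the first-order bounds at 0 and ∞ into exp(-|u|), since log 4 ≥ 1.
The chain rule factor log 4 ≤ 2 accounts for the constant `2 * C`. -/
theorem exists_smoothStep_logTail : ∃ q' C, SmoothStep logTail q' C := by
  obtain ⟨C, hC, h1, h2⟩ := limitTail_bounds
  have hl1 := one_le_log_four
  have hl2 := log_four_le_two
  set τ : ℝ → ℝ := fun u => Real.exp (-(u * Real.log 4)) with hτ
  have hτ0 : ∀ u, 0 < τ u := fun u => Real.exp_pos _
  have hτd : ∀ u, HasDerivAt τ (τ u * -Real.log 4) u := fun u => by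
    have e1 : HasDerivAt (fun u : ℝ => -(u * Real.log 4)) (-Real.log 4) u :=
      (((hasDerivAt_id u).mul_const (Real.log 4)).neg).congr_deriv (by simp)
    exact e1.exp
  have hpos : ∀ u, 0 < u → τ u < 1 ∧ τ u ≤ Real.exp (-|u|) := fun u hu => by
    rw [abs_of_pos hu]
    exact ⟨Real.exp_lt_one_iff.2 (by nlinarith), Real.exp_le_exp.2 (by nlinarith)⟩
  have hneg : ∀ u, u ≤ 0 → 1 ≤ τ u ∧ (τ u)⁻¹ ≤ Real.exp (-|u|) := fun u hu => by
    rw [abs_of_nonpos hu]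
    refine ⟨Real.one_le_exp (by nlinarith), ?_⟩
    rw [hτ, ← Real.exp_neg]
    exact Real.exp_le_exp.2 (by nlinarith)
  refine ⟨fun u => -Real.log 4 * (τ u * limitTailDeriv (τ u)), 2 * C, ?_, ?_, ?_, ?_⟩
  · intro u
    refine ((hasDerivAt_limitTail (hτ0 u)).comp u (hτd u)).congr_deriv ?_
    ring
  · have hτc : Continuous τ := continuous_iff_continuousAt.2 fun u => (hτd u).continuousAt
    exact continuous_const.mul (hτc.mul
      (continuousOn_limitTailDeriv.comp_continuous hτc fun u => hτ0 u))
  · intro u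
    rcases lt_or_ge 0 u with hu | hu
    · obtain ⟨e1, e2⟩ := hpos u hu
      rw [if_pos hu]
      refine ((h2 (τ u) (hτ0 u) e1.le).1).trans ?_
      nlinarith [hτ0 u]
    · obtain ⟨e1, e2⟩ := hneg u hu
      rw [if_neg hu.not_gt, sub_zero]
      refine ((h1 (τ u) e1).1).trans ?_
      have := inv_pos.2 (hτ0 u)
      nlinarith
  · intro u
    rw [abs_mul, abs_neg, abs_of_nonneg (by linarith)]
    rcases lt_or_ge 0 u with hu | hu
    · obtain ⟨e1, e2⟩ := hpos u hu
      have e3 := (h2 (τ u) (hτ0 u) e1.le).2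
      calc _ ≤ 2 * (C * Real.exp (-|u|)) :=
            mul_le_mul hl2 (e3.trans (by gcongr)) (abs_nonneg _) (by norm_num)
        _ = _ := by ring
    · obtain ⟨e1, e2⟩ := hneg u hu
      have e3 := (h1 (τ u) e1).2
      calc _ ≤ 2 * (C * Real.exp (-|u|)) :=
            mul_le_mul hl2 (e3.trans (by gcongr)) (abs_nonneg _) (by norm_num)
        _ = _ := by ring

/-- The limiting tail function with its limit at the origin removed. -/
noncomputable def reducedTail (t : ℝ) : ℂ := ((limitTail t - (if t < 1 then 1 else 0) : ℝ) : ℂ)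

theorem continuousOn_limitTail : ContinuousOn limitTail (Set.Ioi 0) := fun _ ht =>
  (hasDerivAt_limitTail ht).continuousAt.continuousWithinAt

theorem locallyIntegrableOn_reducedTail : LocallyIntegrableOn reducedTail (Set.Ioi 0) := by
  have h1 : LocallyIntegrableOn (fun t => (limitTail t : ℂ)) (Set.Ioi 0) :=
    (Complex.continuous_ofReal.comp_continuousOn continuousOn_limitTail).locallyIntegrableOn
      measurableSet_Ioi
  have h2 : LocallyIntegrableOn (fun t : ℝ => (if t < 1 then (1 : ℂ) else 0)) (Set.Ioi 0) := by
    have : (fun t : ℝ => (if t < 1 then (1 : ℂ) else 0))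
        = (Set.Iio 1).indicator (fun _ => (1 : ℂ)) := by
      ext t
      simp [Set.indicator]
    rw [this]
    exact (locallyIntegrable_const (1 : ℂ)).indicator measurableSet_Iio |>.locallyIntegrableOn _
  have h3 : reducedTail = (fun t => (limitTail t : ℂ))
      - fun t : ℝ => (if t < 1 then (1 : ℂ) else 0) := by
    ext t
    simp only [reducedTail, Pi.sub_apply]
    split_ifs <;> simp
  rw [h3]
  exact h1.sub h2

theorem isBigO_reducedTail_top : reducedTail =O[atTop] (fun t : ℝ => t ^ (-(1 : ℝ))) := by
  obtain ⟨C, hC, h1, h2⟩ := limitTail_bounds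
  refine Asymptotics.IsBigO.of_bound C ?_
  filter_upwards [eventually_ge_atTop 1] with t ht
  rw [reducedTail, if_neg (by linarith), Complex.norm_real, sub_zero, Real.rpow_neg_one,
    Real.norm_eq_abs, Real.norm_of_nonneg (by positivity)]
  exact (h1 t ht).1

theorem isBigO_reducedTail_zero : reducedTail =O[𝓝[>] 0] (fun t : ℝ => t ^ (-(-1 : ℝ))) := by
  obtain ⟨C, hC, h1, h2⟩ := limitTail_bounds
  refine Asymptotics.IsBigO.of_bound C ?_
  filter_upwards [Ioo_mem_nhdsGT (zero_lt_one' ℝ)] with t ht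
  rw [reducedTail, if_pos ht.2, Complex.norm_real, neg_neg, Real.rpow_one,
    Real.norm_eq_abs, Real.norm_of_nonneg ht.1.le]
  exact (h2 t ht.1 ht.2.le).1

theorem hasDerivAt_mellin_reducedTail {s : ℂ} (h1 : s.re < 1) (h2 : -1 < s.re) :
    HasDerivAt (mellin reducedTail) (mellin (fun t => Real.log t • reducedTail t) s) s :=
  (mellin_hasDerivAt_of_isBigO_rpow locallyIntegrableOn_reducedTail isBigO_reducedTail_top h1
    isBigO_reducedTail_zero h2).2

theorem chi_div_two (k : ℤ) : chi k / 2 = ((2 * Real.pi * k / Real.log 4 : ℝ) : ℂ) * Complex.I := by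
  have : Real.log 4 = 2 * Real.log 2 := by
    rw [show (4 : ℝ) = 2 ^ 2 by norm_num, Real.log_pow]; norm_num
  rw [chi, this]
  have h2 : (Real.log 2 : ℂ) ≠ 0 := by
    exact_mod_cast (Real.log_pos one_lt_two).ne'
  push_cast
  field_simp

/-- As χ_k / 2 = 2πik / log 4, the substitution t = exp(-u log 4) turns the power t^(χ_k/2) into a
character of period 1. -/
theorem mellin_chi_div_two (f : ℝ → ℂ) (k : ℤ) :
    mellin f (chi k / 2) = Real.log 4 *
      ∫ t : ℝ, fourierExp k t * f (Real.exp (-(t * Real.log 4))) := by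
  have hl : 0 < Real.log 4 := by linarith [one_le_log_four]
  rw [mellin_eq_fourier, chi_div_two, Real.fourier_real_eq_integral_exp_smul]
  have h := Measure.integral_comp_mul_right
    (fun v : ℝ => Complex.exp (-(2 * Real.pi * k / Real.log 4 * v * Complex.I))
      * f (Real.exp (-v))) (Real.log 4)
  rw [abs_inv, abs_of_pos hl] at h
  have h2 : ∫ t : ℝ, fourierExp k t * f (Real.exp (-(t * Real.log 4))) =
      ∫ t : ℝ, Complex.exp (-(2 * Real.pi * k / Real.log 4 * ((t * Real.log 4 : ℝ) : ℂ) * Complex.I))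
      * f (Real.exp (-(t * Real.log 4))) := by
    congr 1
    ext t
    rw [fourierExp]
    congr 2
    have : (Real.log 4 : ℂ) ≠ 0 := by exact_mod_cast hl.ne'
    push_cast
    field_simp
  rw [h2, h, Complex.real_smul, ← mul_assoc, ← Complex.ofReal_mul, mul_inv_cancel₀ hl.ne',
    Complex.ofReal_one, one_mul]
  congr 1
  ext v
  simp only [Complex.re_ofReal_mul, Complex.I_re, Complex.im_ofReal_mul, Complex.I_im, mul_zero,
    neg_zero, zero_mul, Real.exp_zero, one_smul, smul_eq_mul, mul_one]
  congr 2
  have : (Real.log 4 : ℂ) ≠ 0 := by exact_mod_cast hl.ne'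
  have hpi : (Real.pi : ℂ) ≠ 0 := by exact_mod_cast Real.pi_ne_zero
  push_cast
  field_simp

theorem reducedTail_exp (t : ℝ) : reducedTail (Real.exp (-(t * Real.log 4))) =
    ((logTail t - (if 0 < t then 1 else 0) : ℝ) : ℂ) := by
  have hl : 0 < Real.log 4 := by linarith [one_le_log_four]
  have : Real.exp (-(t * Real.log 4)) < 1 ↔ 0 < t := by
    rw [Real.exp_lt_one_iff, neg_lt_zero, mul_pos_iff_of_pos_right hl]
  rw [reducedTail, logTail]
  simp only [this]

theorem integral_fourierExp_mul_logTail (k : ℤ) :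
    ∫ t, fourierExp k t * ((logTail t - (if 0 < t then 1 else 0) : ℝ) : ℂ)
      = mellin reducedTail (chi k / 2) / Real.log 4 := by
  have hl : (Real.log 4 : ℂ) ≠ 0 := by
    exact_mod_cast (by linarith [one_le_log_four] : Real.log 4 ≠ 0)
  rw [mellin_chi_div_two, mul_div_cancel_left₀ _ hl]
  simp_rw [reducedTail_exp]

/-- Here -(2t + 1) = (2 / log 4)(-t log 4) - 1, and -t log 4 is the logarithm of the Mellin
variable; a logarithmic factor differentiates the transform. -/
theorem integral_fourierExp_mul_linear_mul_logTail (k : ℤ) :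
    ∫ t, fourierExp k t * (-(2 * t + 1)) * ((logTail t - (if 0 < t then 1 else 0) : ℝ) : ℂ)
      = (2 / Real.log 4 * deriv (mellin reducedTail) (chi k / 2)
          - mellin reducedTail (chi k / 2)) / Real.log 4 := by
  have hl0 : Real.log 4 ≠ 0 := by linarith [one_le_log_four]
  have hl : (Real.log 4 : ℂ) ≠ 0 := by exact_mod_cast hl0
  obtain ⟨q', C, h⟩ := exists_smoothStep_logTail
  have hre : (chi k / 2).re = 0 := by
    rw [chi_div_two, Complex.re_ofReal_mul, Complex.I_re, mul_zero]
  rw [(hasDerivAt_mellin_reducedTail (s := chi k / 2) (by rw [hre]; norm_num)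
    (by rw [hre]; norm_num)).deriv, mellin_chi_div_two, mellin_chi_div_two]
  simp_rw [reducedTail_exp, Real.log_exp, Complex.real_smul]
  have e : ∀ t : ℝ, fourierExp k t * (-(2 * t + 1))
      * ((logTail t - (if 0 < t then 1 else 0) : ℝ) : ℂ) =
      2 / Real.log 4 * (fourierExp k t * (((-(t * Real.log 4) : ℝ) : ℂ)
        * ((logTail t - (if 0 < t then 1 else 0) : ℝ) : ℂ)))
      - fourierExp k t * ((logTail t - (if 0 < t then 1 else 0) : ℝ) : ℂ) := by
    intro t
    push_cast
    field_simp
    ring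
  rw [integral_congr_ae (Eventually.of_forall e), integral_sub, integral_const_mul]
  · have hfield : ∀ x y : ℂ, 2 / (Real.log 4 : ℂ) * x - y
        = (2 / (Real.log 4 : ℂ) * (Real.log 4 * x) - Real.log 4 * y) / Real.log 4 := by
      intro x y
      field_simp
    exact hfield _ _
  · have h1 := (h.integrable_mul (a := fun t => fourierExp k t * t)
      ((continuous_fourierExp k).mul Complex.continuous_ofReal) (fun t => by
        rw [norm_mul, norm_fourierExp, one_mul, Complex.norm_real, Real.norm_eq_abs]
        linarith [abs_nonneg t])).const_mul (-2)
    refine h1.congr (Eventually.of_forall fun t => ?_)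
    simp only
    push_cast
    field_simp
  · exact h.integrable_mul (continuous_fourierExp k) (fun t => by
      rw [norm_fourierExp]
      linarith [abs_nonneg t])

theorem hasMellin_step {s : ℂ} (hs : 0 < s.re) :
    HasMellin (fun t : ℝ => (if t < 1 then (1 : ℂ) else 0)) s (1 / s) := by
  have h := hasMellin_one_Ioc hs
  have hae : (fun t : ℝ => (t : ℂ) ^ (s - 1) • (Set.Ioc 0 1).indicator (fun _ => (1 : ℂ)) t)
      =ᵐ[volume.restrict (Set.Ioi 0)]
      fun t : ℝ => (t : ℂ) ^ (s - 1) • (if t < 1 then (1 : ℂ) else 0) := by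
    filter_upwards [ae_restrict_mem measurableSet_Ioi,
      ae_restrict_of_ae (Measure.ae_ne volume (1 : ℝ))] with t ht h1
    congr 1
    simp only [Set.indicator, Set.mem_Ioc]
    have : (0 < t ∧ t ≤ 1) ↔ t < 1 := ⟨fun hh => lt_of_le_of_ne hh.2 h1, fun hh => ⟨ht, hh.le⟩⟩
    simp only [this]
  refine ⟨h.1.congr hae, ?_⟩
  rw [mellin, ← integral_congr_ae hae]
  exact h.2

theorem mellinConvergent_limitTail {s : ℂ} (h0 : 0 < s.re) (h1 : s.re < 1) :
    MellinConvergent (fun t => (limitTail t : ℂ)) s := by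
  have hr : MellinConvergent reducedTail s :=
    mellinConvergent_of_isBigO_rpow locallyIntegrableOn_reducedTail isBigO_reducedTail_top h1
      isBigO_reducedTail_zero (by linarith)
  have := (hasMellin_add hr (hasMellin_step h0).1).1
  convert! this using 2
  rename_i t
  rw [reducedTail]
  split_ifs <;> simp

theorem mellin_reducedTail_eq_sub {s : ℂ} (h0 : 0 < s.re) (h1 : s.re < 1) :
    mellin reducedTail s = mellin (fun t => (limitTail t : ℂ)) s - 1 / s := by
  have := hasMellin_sub (mellinConvergent_limitTail h0 h1) (hasMellin_step h0).1
  rw [(hasMellin_step h0).2] at this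
  rw [← this.2]
  congr 1
  ext t
  rw [reducedTail]
  split_ifs <;> simp

/-- Termwise, the factor t^(3/2) shifts s and each λ contributes Γ(s + 3/2) λ² λ^(-2s-3). -/
theorem mellin_limitTail {s : ℂ} (h0 : 0 < s.re) :
    mellin (fun t => (limitTail t : ℂ)) s
      = 4 / Real.sqrt Real.pi * (Complex.Gamma (s + 3 / 2) * riemannZeta (2 * s + 1)) := by
  have hre : (s + 3 / 2).re = s.re + 3 / 2 := by simp
  have hterm : ∀ i : ℕ, Complex.Gamma (s + 3 / 2) * (((i : ℂ) + 1) ^ 2)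
      / ((((i : ℝ) + 1) ^ 2 : ℝ) : ℂ) ^ (s + 3 / 2)
      = Complex.Gamma (s + 3 / 2) * (1 / ((i : ℂ) + 1) ^ (2 * s + 1)) := by
    intro i
    have hi : ((i : ℂ) + 1) ≠ 0 := by exact_mod_cast (Nat.succ_ne_zero i)
    have e1 : ((((i : ℝ) + 1) ^ 2 : ℝ) : ℂ) ^ (s + 3 / 2)
        = ((i : ℂ) + 1) ^ (2 * (s + 3 / 2)) := by
      have hp : (0 : ℝ) < (i : ℝ) + 1 := by positivity
      rw [sq, Complex.ofReal_mul, Complex.mul_cpow_ofReal_nonneg hp.le hp.le, two_mul,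
        Complex.cpow_add (s + 3 / 2) (s + 3 / 2) hi]
      push_cast
      rfl
    have e2 : ((i : ℂ) + 1) ^ (2 * (s + 3 / 2)) = ((i : ℂ) + 1) ^ (2 * s + 1) * ((i : ℂ) + 1) ^ 2 := by
      rw [← Complex.cpow_natCast, ← Complex.cpow_add _ _ hi]
      congr 1
      push_cast
      ring
    rw [e1, e2]
    have h3 : ((i : ℂ) + 1) ^ (2 * s + 1) ≠ 0 := by
      rw [Ne, Complex.cpow_eq_zero_iff]; tauto
    field_simp
  have hsum := hasSum_mellin (a := fun i : ℕ => ((i : ℂ) + 1) ^ 2)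
    (p := fun i : ℕ => ((i : ℝ) + 1) ^ 2) (F := fun t => (thetaSum 1 t : ℂ)) (s := s + 3 / 2)
    (fun i => Or.inr (by positivity)) (by rw [hre]; linarith) (fun t ht => ?_) ?_
  · have hz := zeta_eq_tsum_one_div_nat_add_one_cpow (s := 2 * s + 1) (by simp; linarith)
    have h2 : mellin (fun t => (thetaSum 1 t : ℂ)) (s + 3 / 2)
        = Complex.Gamma (s + 3 / 2) * riemannZeta (2 * s + 1) := by
      rw [← hsum.tsum_eq, hz, ← tsum_mul_left]
      exact tsum_congr hterm
    rw [← h2, ← mellin_cpow_smul, ← smul_eq_mul, ← mellin_const_smul]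
    refine setIntegral_congr_fun measurableSet_Ioi fun t ht => ?_
    have ht' : (0 : ℝ) < t := ht
    simp only [limitTail, smul_eq_mul]
    push_cast
    rw [Complex.ofReal_cpow ht'.le]
    push_cast
    ring
  · have := Complex.hasSum_ofReal.2 (summable_thetaSum 1 ht).hasSum
    convert! this using 1
    ext i
    push_cast
    ring
  · have hsq : Summable fun i : ℕ => 1 / (((i : ℝ) + 1)) ^ (2 * s.re + 1) := by
      have := (summable_nat_add_iff 1).2
        (Real.summable_one_div_nat_rpow (p := 2 * s.re + 1) |>.2 (by linarith))
      simpa using this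
    refine hsq.congr fun i => ?_
    have hp : (0 : ℝ) < (i : ℝ) + 1 := by positivity
    rw [hre, norm_pow, ← Real.rpow_natCast_mul hp.le]
    have : ‖(i : ℂ) + 1‖ = (i : ℝ) + 1 := by
      rw [show (i : ℂ) + 1 = (((i : ℝ) + 1 : ℝ) : ℂ) by push_cast; rfl, Complex.norm_real,
        Real.norm_of_nonneg hp.le]
    rw [this, ← Real.rpow_natCast, ← Real.rpow_sub hp, one_div, ← Real.rpow_neg hp.le]
    congr 1
    push_cast
    ring

end LatticePath


/-! ### Analytic continuation and the Fourier coefficients for k ≠ 0 -/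

namespace LatticePath

open Filter Topology MeasureTheory

/-- The function `s ↦ 1 + s * N s`, where `N` is the Mellin transform of `reducedTail`, in a form
that is analytic on the strip `|Re s| < 1 / 2`. -/
noncomputable def mellinFactor (s : ℂ) : ℂ :=
  -2 * riemannZeta (-2 * s) * (Real.pi : ℂ) ^ (2 * s) * Complex.Gamma (1 + -1 * s) * (1 + 2 * s)

theorem differentiableAt_Gamma_of_re_pos {s : ℂ} (hs : 0 < s.re) :
    DifferentiableAt ℂ Complex.Gamma s :=
  Complex.differentiableAt_Gamma s fun m h => by
    have := congrArg Complex.re h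
    simp at this
    linarith [(Nat.cast_nonneg m : (0 : ℝ) ≤ m)]

theorem hasDerivAt_Gamma_digamma {s : ℂ} (hs : 0 < s.re) :
    HasDerivAt Complex.Gamma (Complex.Gamma s * Complex.digamma s) s := by
  refine (differentiableAt_Gamma_of_re_pos hs).hasDerivAt.congr_deriv ?_
  have := Complex.Gamma_ne_zero_of_re_pos hs
  rw [Complex.digamma_def, logDeriv_apply]
  field_simp

/-- The zeta functional equation at -2s, together with s Γ(-s) = -Γ(1 - s). It trades the pole of
ζ(2s + 1) at 0 for the regular value of ζ(-2s), so Taylor data at 0 become accessible. -/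
theorem gamma_mul_zeta_functional {s : ℂ} (h0 : s ≠ 0) (h1 : -(1 / 2) < s.re)
    (h2 : s.re < 1 / 2) :
    s * (4 / (√Real.pi : ℂ) * (Complex.Gamma (s + 3 / 2) * riemannZeta (2 * s + 1)))
      = mellinFactor s := by
  have hπ : (Real.pi : ℂ) ≠ 0 := by exact_mod_cast Real.pi_ne_zero
  have hne : ∀ m : ℕ, -s ≠ -m := by
    intro m hm
    rcases m with _ | m
    · simp at hm
      exact h0 hm
    · have := congrArg Complex.re hm
      simp at this
      have hm : (0 : ℝ) ≤ m := m.cast_nonneg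
      linarith
  have hG1 : Complex.Gamma (s + 1 / 2) ≠ 0 := Complex.Gamma_ne_zero_of_re_pos (by
    simp; linarith)
  have hG2 : Complex.Gamma (-s) ≠ 0 := Complex.Gamma_ne_zero hne
  have e1 : riemannZeta (2 * s + 1)
      = completedRiemannZeta (-2 * s) / Complex.Gammaℝ (2 * s + 1) := by
    rw [riemannZeta_def_of_ne_zero, ← completedRiemannZeta_one_sub]
    · congr 2
      ring
    · intro h
      have := congrArg Complex.re h
      simp at this
      linarith
  have e2 : riemannZeta (-2 * s) = completedRiemannZeta (-2 * s) / Complex.Gammaℝ (-2 * s) :=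
    riemannZeta_def_of_ne_zero (by simpa using h0)
  have e3 : Complex.Gamma (s + 3 / 2) = (s + 1 / 2) * Complex.Gamma (s + 1 / 2) := by
    rw [← Complex.Gamma_add_one]
    · congr 1
      ring
    · intro h
      have := congrArg Complex.re h
      simp at this
      linarith
  have e4 : Complex.Gamma (1 + -1 * s) = -s * Complex.Gamma (-s) := by
    rw [← Complex.Gamma_add_one _ (neg_ne_zero.2 h0)]
    congr 1
    ring
  have e5 : ((√Real.pi : ℝ) : ℂ) = (Real.pi : ℂ) ^ (1 / 2 : ℂ) := by
    rw [Real.sqrt_eq_rpow, Complex.ofReal_cpow Real.pi_pos.le]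
    norm_num
  have e6 : (Real.pi : ℂ) ^ (-(2 * s + 1) / 2) = ((Real.pi : ℂ) ^ s)⁻¹ * ((Real.pi : ℂ) ^ (1 / 2 : ℂ))⁻¹ := by
    rw [← Complex.cpow_neg, ← Complex.cpow_neg, ← Complex.cpow_add _ _ hπ]
    congr 1
    ring
  have e7 : (Real.pi : ℂ) ^ (2 * s) = (Real.pi : ℂ) ^ s * (Real.pi : ℂ) ^ s := by
    rw [← Complex.cpow_add _ _ hπ]
    congr 1
    ring
  have e8 : -(-2 * s) / 2 = s := by ring
  have e9 : (-2 * s) / 2 = -s := by ring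
  have e10 : (2 * s + 1) / 2 = s + 1 / 2 := by ring
  have hp1 : (Real.pi : ℂ) ^ s ≠ 0 := by simp [Complex.cpow_eq_zero_iff, hπ]
  have hp2 : (Real.pi : ℂ) ^ (1 / 2 : ℂ) ≠ 0 := by simp [Complex.cpow_eq_zero_iff, hπ]
  rw [mellinFactor, e1, e2, e3, e4, e5, e7, Complex.Gammaℝ_def, Complex.Gammaℝ_def, e6, e8, e9, e10]
  generalize (Real.pi : ℂ) ^ s = p at *
  generalize (Real.pi : ℂ) ^ (1 / 2 : ℂ) = q at *
  generalize completedRiemannZeta (-2 * s) = Z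
  generalize Complex.Gamma (s + 1 / 2) = G1 at *
  generalize Complex.Gamma (-s) = G2 at *
  field_simp
  ring

theorem differentiableAt_mellinFactor {s : ℂ} (h1 : -(1 / 2) < s.re) (h2 : s.re < 1 / 2) :
    DifferentiableAt ℂ mellinFactor s := by
  have hπ : (Real.pi : ℂ) ≠ 0 := by exact_mod_cast Real.pi_ne_zero
  have d1 : DifferentiableAt ℂ (fun s : ℂ => riemannZeta (-2 * s)) s := by
    have : DifferentiableAt ℂ riemannZeta (-2 * s) := differentiableAt_riemannZeta (by
      intro h
      have := congrArg Complex.re h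
      simp at this
      linarith)
    exact this.comp s (by fun_prop)
  have d2 : DifferentiableAt ℂ (fun s : ℂ => Complex.Gamma (1 + -1 * s)) s := by
    have : DifferentiableAt ℂ Complex.Gamma (1 + -1 * s) :=
      differentiableAt_Gamma_of_re_pos (by simp; linarith)
    exact this.comp s (by fun_prop)
  have d3 : DifferentiableAt ℂ (fun s : ℂ => (Real.pi : ℂ) ^ (2 * s)) s :=
    DifferentiableAt.const_cpow (by fun_prop) (Or.inl hπ)
  unfold mellinFactor
  fun_prop

/-- Both sides are analytic on |Re s| < 1/2 and agree for 0 < Re s < 1/2, where the Mellin integral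
of F itself converges. The identity theorem extends this to the imaginary axis. -/
theorem id_mul_mellin_reducedTail {s : ℂ} (h1 : -(1 / 2) < s.re) (h2 : s.re < 1 / 2) :
    s * mellin reducedTail s + 1 = mellinFactor s := by
  set U : Set ℂ := {s | -(1 / 2) < s.re} ∩ {s | s.re < 1 / 2} with hU
  have hUo : IsOpen U := (isOpen_lt continuous_const Complex.continuous_re).inter
    (isOpen_lt Complex.continuous_re continuous_const)
  have hUc : IsPreconnected U :=
    ((convex_halfSpace_re_gt _).inter (convex_halfSpace_re_lt _)).isPreconnected
  have hf : AnalyticOnNhd ℂ (fun s => s * mellin reducedTail s + 1) U := by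
    refine DifferentiableOn.analyticOnNhd (fun z hz => ?_) hUo
    have hz1 : -(1 / 2) < z.re := hz.1
    have hz2 : z.re < 1 / 2 := hz.2
    have := (hasDerivAt_mellin_reducedTail (s := z) (by linarith) (by linarith)).differentiableAt
    exact ((differentiableAt_id.mul this).add_const _).differentiableWithinAt
  have hg : AnalyticOnNhd ℂ mellinFactor U := DifferentiableOn.analyticOnNhd
    (fun z hz => (differentiableAt_mellinFactor hz.1 hz.2).differentiableWithinAt) hUo
  refine hf.eqOn_of_preconnected_of_eventuallyEq hg hUc (z₀ := 1 / 4) ?_ ?_ ⟨h1, h2⟩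
  · constructor <;> norm_num
  · have hV : IsOpen ({s : ℂ | 0 < s.re} ∩ {s | s.re < 1 / 2}) :=
      (isOpen_lt continuous_const Complex.continuous_re).inter
        (isOpen_lt Complex.continuous_re continuous_const)
    filter_upwards [hV.mem_nhds (show (1 / 4 : ℂ) ∈ _ by constructor <;> norm_num)] with z hz
    have hz1 : 0 < z.re := hz.1
    have hz2 : z.re < 1 / 2 := hz.2
    have hz0 : z ≠ 0 := by
      rintro rfl
      simp at hz1
    rw [mellin_reducedTail_eq_sub hz1 (by linarith), mellin_limitTail hz1,
      ← gamma_mul_zeta_functional hz0 (by linarith) hz2]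
    field_simp
    ring

theorem mellin_reducedTail_eq {s : ℂ} (h0 : s ≠ 0) (h1 : -(1 / 2) < s.re) (h2 : s.re < 1 / 2) :
    mellin reducedTail s
      = 4 / (√Real.pi : ℂ) * (Complex.Gamma (s + 3 / 2) * riemannZeta (2 * s + 1)) - 1 / s := by
  have h := id_mul_mellin_reducedTail h1 h2
  rw [← gamma_mul_zeta_functional h0 h1 h2] at h
  apply mul_left_cancel₀ h0
  rw [mul_sub, ← h]
  field_simp
  ring

theorem deriv_mellin_reducedTail {s : ℂ} (h0 : s ≠ 0) (h1 : -(1 / 2) < s.re)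
    (h2 : s.re < 1 / 2) :
    deriv (mellin reducedTail) s
      = 4 / (√Real.pi : ℂ) * (Complex.Gamma (s + 3 / 2)
        * (Complex.digamma (s + 3 / 2) * riemannZeta (2 * s + 1)
          + 2 * deriv riemannZeta (2 * s + 1))) + 1 / s ^ 2 := by
  have hev : mellin reducedTail =ᶠ[𝓝 s] fun s =>
      4 / (√Real.pi : ℂ) * (Complex.Gamma (s + 3 / 2) * riemannZeta (2 * s + 1)) - 1 / s := by
    have hV : IsOpen (({s : ℂ | -(1 / 2) < s.re} ∩ {s | s.re < 1 / 2}) ∩ {0}ᶜ) :=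
      ((isOpen_lt continuous_const Complex.continuous_re).inter
        (isOpen_lt Complex.continuous_re continuous_const)).inter isOpen_compl_singleton
    filter_upwards [hV.mem_nhds ⟨⟨h1, h2⟩, h0⟩] with z hz
    exact mellin_reducedTail_eq hz.2 hz.1.1 hz.1.2
  rw [hev.deriv_eq]
  have hre : 0 < (s + 3 / 2).re := by simp; linarith
  have dG : HasDerivAt (fun s : ℂ => Complex.Gamma (s + 3 / 2))
      (Complex.Gamma (s + 3 / 2) * Complex.digamma (s + 3 / 2)) s :=
    (hasDerivAt_Gamma_digamma hre).comp_add_const s (3 / 2)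
  have dZ : HasDerivAt (fun s : ℂ => riemannZeta (2 * s + 1))
      (deriv riemannZeta (2 * s + 1) * 2) s := by
    have e : HasDerivAt (fun s : ℂ => 2 * s + 1) 2 s :=
      (((hasDerivAt_id s).const_mul 2).add_const 1).congr_deriv (by simp)
    exact (differentiableAt_riemannZeta (by simpa using h0)).hasDerivAt.comp s e
  have dI : HasDerivAt (fun s : ℂ => 1 / s) (-(s ^ 2)⁻¹) s := by
    simpa using hasDerivAt_inv h0
  refine (((dG.mul dZ).const_mul (4 / (√Real.pi : ℂ))).sub dI).deriv.trans ?_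
  ring

/-- Logarithmic derivative of Legendre's duplication formula. -/
theorem two_mul_digamma_two_mul {z : ℂ} (hz : 0 < z.re) :
    2 * Complex.digamma (2 * z)
      = Complex.digamma z + Complex.digamma (z + 1 / 2) + 2 * Complex.log 2 := by
  have h2 : 0 < (2 * z).re := by simpa using hz
  have h3 : 0 < (z + 1 / 2).re := by simp; linarith
  have dl : HasDerivAt (fun s => Complex.Gamma s * Complex.Gamma (s + 1 / 2)) _ z :=
    (hasDerivAt_Gamma_digamma hz).mul ((hasDerivAt_Gamma_digamma h3).comp_add_const z (1 / 2))
  have e : HasDerivAt (fun s : ℂ => 2 * s) 2 z :=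
    ((hasDerivAt_id z).const_mul 2).congr_deriv (by simp)
  have e' : HasDerivAt (fun s : ℂ => 1 - 2 * s) (-2) z := e.const_sub 1
  have d2 : HasDerivAt (fun s : ℂ => Complex.Gamma (2 * s)) _ z :=
    (hasDerivAt_Gamma_digamma h2).comp z e
  have dr : HasDerivAt (fun s => Complex.Gamma (2 * s) * (2 : ℂ) ^ (1 - 2 * s)
      * ((√Real.pi : ℝ) : ℂ)) _ z :=
    (d2.mul (e'.const_cpow (c := 2) (Or.inl two_ne_zero))).mul_const _
  have hu := (dl.congr_of_eventuallyEq (Eventually.of_forall fun s =>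
    (Complex.Gamma_mul_Gamma_add_half s).symm)).unique dr
  have hd := Complex.Gamma_mul_Gamma_add_half z
  have n1 := Complex.Gamma_ne_zero_of_re_pos hz
  have n2 := Complex.Gamma_ne_zero_of_re_pos h3
  apply mul_left_cancel₀ (mul_ne_zero n1 n2)
  linear_combination -hu + (2 * Complex.digamma (2 * z) - 2 * Complex.log 2) * hd

theorem chi_ne_zero {k : ℤ} (hk : k ≠ 0) : chi k / 2 ≠ 0 := by
  rw [chi_div_two]
  have h1 : (k : ℝ) ≠ 0 := by exact_mod_cast hk
  have h2 : Real.log 4 ≠ 0 := by linarith [one_le_log_four]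
  have h3 := Real.pi_ne_zero
  refine mul_ne_zero ?_ Complex.I_ne_zero
  exact_mod_cast (by positivity : 2 * Real.pi * k / Real.log 4 ≠ 0)

theorem log_four : Real.log 4 = 2 * Real.log 2 := by
  rw [show (4 : ℝ) = 2 ^ 2 by norm_num, Real.log_pow]
  norm_num

theorem chi_div_two_re (k : ℤ) : (chi k / 2).re = 0 := by
  rw [chi_div_two, Complex.re_ofReal_mul]
  simp

theorem chi_div_two_mul (k : ℤ) :
    2 * k * Real.pi * Complex.I = chi k / 2 * (2 * (Real.log 2 : ℂ)) := by
  have h2 : (Real.log 2 : ℂ) ≠ 0 := by exact_mod_cast (Real.log_pos one_lt_two).ne'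
  rw [chi]
  field_simp

/-- The term -1/s of the Mellin transform cancels against the Fourier coefficient of x. -/
theorem integral_fourierExp_mul_firstSum_logTail {k : ℤ} (hk : k ≠ 0) :
    ∫ y in (0 : ℝ)..1, fourierExp k y * ((firstSum logTail y - y : ℝ) : ℂ)
      = Real.log 2 * coeffC k := by
  obtain ⟨q', C, hq⟩ := exists_smoothStep_logTail
  have hs := chi_ne_zero hk
  have hre := chi_div_two_re k
  have h2 : (Real.log 2 : ℂ) ≠ 0 := by exact_mod_cast (Real.log_pos one_lt_two).ne'
  have hp : ((√Real.pi : ℝ) : ℂ) ≠ 0 := by exact_mod_cast (Real.sqrt_pos.2 Real.pi_pos).ne'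
  rw [hq.integral_fourierExp_mul_firstSum, integral_fourierExp_mul_logTail,
    integral_fourierExp_mul_id k hk, log_four, chi_div_two_mul,
    mellin_reducedTail_eq hs (by rw [hre]; norm_num) (by rw [hre]; norm_num), coeffC,
    show (3 + chi k) / 2 = chi k / 2 + 3 / 2 by ring, show 1 + chi k = 2 * (chi k / 2) + 1 by ring]
  generalize chi k / 2 = s at *
  push_cast
  field_simp
  ring

/-- The poles 1/s and 1/s² cancel against the Fourier coefficient of x². Duplication rewrites ψ(s +
3/2) through ψ(2 + χ_k) and ψ(1 + χ_k/2), producing the stated form of the coefficients. -/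
theorem integral_fourierExp_mul_secondPeriodic_logTail {k : ℤ} (hk : k ≠ 0) :
    ∫ y in (0 : ℝ)..1, fourierExp k y * ((secondPeriodic logTail y : ℝ) : ℂ)
      = coeffD k - coeffC k * Complex.digamma (1 + chi k / 2) := by
  obtain ⟨q', C, hq⟩ := exists_smoothStep_logTail
  have hs := chi_ne_zero hk
  have hre := chi_div_two_re k
  have h2 : (Real.log 2 : ℂ) ≠ 0 := by exact_mod_cast (Real.log_pos one_lt_two).ne'
  have hp : ((√Real.pi : ℝ) : ℂ) ≠ 0 := by exact_mod_cast (Real.sqrt_pos.2 Real.pi_pos).ne'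
  have hdup := two_mul_digamma_two_mul (z := 1 + chi k / 2)
    (by rw [Complex.add_re, hre]; norm_num)
  have hlog : Complex.log 2 = (Real.log 2 : ℂ) := by
    rw [Complex.ofReal_log (by norm_num)]
    norm_num
  rw [hq.integral_fourierExp_mul_secondPeriodic, integral_fourierExp_mul_linear_mul_logTail,
    integral_fourierExp_mul_sq k hk, log_four, chi_div_two_mul,
    mellin_reducedTail_eq hs (by rw [hre]; norm_num) (by rw [hre]; norm_num),
    deriv_mellin_reducedTail hs (by rw [hre]; norm_num) (by rw [hre]; norm_num), coeffD, coeffC,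
    show (3 + chi k) / 2 = chi k / 2 + 3 / 2 by ring, show 1 + chi k = 2 * (chi k / 2) + 1 by ring,
    show 2 + chi k = 2 * (1 + chi k / 2) by ring]
  rw [show 1 + chi k / 2 + 1 / 2 = chi k / 2 + 3 / 2 by ring, hlog] at hdup
  rw [show Complex.digamma (2 * (1 + chi k / 2)) = (Complex.digamma (1 + chi k / 2)
    + Complex.digamma (chi k / 2 + 3 / 2) + 2 * (Real.log 2 : ℂ)) / 2 by rw [← hdup]; ring]
  generalize chi k / 2 = s at *
  push_cast
  field_simp
  ring

/-! ### Second-order Taylor data at the origin -/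

/-- The function `f` is analytic at `0` with value `a`, derivative `b` and second derivative `c`
there. -/
structure HasTaylorTwo (f : ℂ → ℂ) (a b c : ℂ) : Prop where
  analyticAt : AnalyticAt ℂ f 0
  value : f 0 = a
  deriv_eq : deriv f 0 = b
  deriv_deriv_eq : deriv (deriv f) 0 = c

namespace HasTaylorTwo

variable {f g : ℂ → ℂ} {a b c a' b' c' : ℂ}

theorem of_eventuallyEq (hf : HasTaylorTwo f a b c) (h : g =ᶠ[𝓝 0] f) :
    HasTaylorTwo g a b c :=
  ⟨hf.analyticAt.congr h.symm, h.eq_of_nhds.trans hf.value, h.deriv_eq.trans hf.deriv_eq,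
    h.deriv.deriv_eq.trans hf.deriv_deriv_eq⟩

theorem const (a : ℂ) : HasTaylorTwo (fun _ => a) a 0 0 :=
  ⟨analyticAt_const, rfl, by simp, by simp⟩

theorem add (hf : HasTaylorTwo f a b c) (hg : HasTaylorTwo g a' b' c') :
    HasTaylorTwo (fun z => f z + g z) (a + a') (b + b') (c + c') := by
  have h : deriv (fun z => f z + g z) =ᶠ[𝓝 0] fun z => deriv f z + deriv g z := by
    filter_upwards [hf.analyticAt.eventually_analyticAt, hg.analyticAt.eventually_analyticAt]
      with z h1 h2
    exact (h1.differentiableAt.hasDerivAt.add h2.differentiableAt.hasDerivAt).deriv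
  refine ⟨hf.analyticAt.add hg.analyticAt, by rw [hf.value, hg.value], ?_, ?_⟩
  · rw [h.eq_of_nhds, hf.deriv_eq, hg.deriv_eq]
  · rw [h.deriv_eq, ← hf.deriv_deriv_eq, ← hg.deriv_deriv_eq]
    exact (hf.analyticAt.deriv.differentiableAt.hasDerivAt.add
      hg.analyticAt.deriv.differentiableAt.hasDerivAt).deriv

theorem mul (hf : HasTaylorTwo f a b c) (hg : HasTaylorTwo g a' b' c') :
    HasTaylorTwo (fun z => f z * g z) (a * a') (b * a' + a * b')
      (c * a' + 2 * (b * b') + a * c') := by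
  have h : deriv (fun z => f z * g z) =ᶠ[𝓝 0] fun z => deriv f z * g z + f z * deriv g z := by
    filter_upwards [hf.analyticAt.eventually_analyticAt, hg.analyticAt.eventually_analyticAt]
      with z h1 h2
    exact (h1.differentiableAt.hasDerivAt.mul h2.differentiableAt.hasDerivAt).deriv
  refine ⟨hf.analyticAt.mul hg.analyticAt, by rw [hf.value, hg.value], ?_, ?_⟩
  · rw [h.eq_of_nhds, hf.deriv_eq, hg.deriv_eq, hf.value, hg.value]
  · have df := hf.analyticAt.differentiableAt.hasDerivAt
    have dg := hg.analyticAt.differentiableAt.hasDerivAt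
    have ddf := hf.analyticAt.deriv.differentiableAt.hasDerivAt
    have ddg := hg.analyticAt.deriv.differentiableAt.hasDerivAt
    rw [h.deriv_eq]
    refine ((ddf.mul dg).add (df.mul ddg)).deriv.trans ?_
    rw [hf.value, hg.value, hf.deriv_eq, hg.deriv_eq, hf.deriv_deriv_eq, hg.deriv_deriv_eq]
    ring

theorem comp_affine (z₀ m : ℂ) (hf : AnalyticAt ℂ f z₀) :
    HasTaylorTwo (fun z => f (z₀ + m * z)) (f z₀) (m * deriv f z₀)
      (m ^ 2 * deriv (deriv f) z₀) := by
  have h : ∀ F : ℂ → ℂ, deriv (fun z => F (z₀ + m * z)) = fun z => m * deriv F (z₀ + m * z) := by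
    intro F
    ext z
    rw [deriv_comp_mul_left m (fun z => F (z₀ + z)), deriv_comp_const_add, smul_eq_mul]
  refine ⟨?_, by simp, by rw [h]; simp, ?_⟩
  · have hf' : AnalyticAt ℂ f (z₀ + m * 0) := by simpa using hf
    exact hf'.fun_comp (f := fun z => z₀ + m * z) (by fun_prop)
  · rw [h, deriv_const_mul_field, h]
    simp
    ring

theorem exp_mul (m : ℂ) : HasTaylorTwo (fun z => Complex.exp (m * z)) 1 m (m ^ 2) := by
  have := comp_affine (f := Complex.exp) 0 m (by fun_prop)
  simpa using this

end HasTaylorTwo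

end LatticePath


/-! ### Values at 0: second derivatives of Gamma, and zeta''(0) -/

namespace LatticePath

open Filter Topology MeasureTheory

theorem analyticAt_Gamma_of_re_pos {s : ℂ} (hs : 0 < s.re) : AnalyticAt ℂ Complex.Gamma s := by
  have ho : IsOpen {s : ℂ | 0 < s.re} := isOpen_lt continuous_const Complex.continuous_re
  exact DifferentiableOn.analyticAt (s := {s : ℂ | 0 < s.re})
    (fun z hz => (differentiableAt_Gamma_of_re_pos hz).differentiableWithinAt) (ho.mem_nhds hs)

/-- Compare second-order coefficients in the reflection formula Γ(1/2 + z) Γ(1/2 - z) sin(π(1/2 +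
z)) = π near z = 0; Γ'(1/2) is known. -/
theorem deriv_deriv_Gamma_one_half : deriv (deriv Complex.Gamma) (1 / 2)
    = (√Real.pi : ℂ) * ((Real.eulerMascheroniConstant + 2 * Complex.log 2) ^ 2
      + (Real.pi : ℂ) ^ 2 / 2) := by
  have hp : ((√Real.pi : ℝ) : ℂ) ≠ 0 := by exact_mod_cast (Real.sqrt_pos.2 Real.pi_pos).ne'
  have hG : AnalyticAt ℂ Complex.Gamma (1 / 2) := analyticAt_Gamma_of_re_pos (by norm_num)
  have t1 := HasTaylorTwo.comp_affine (1 / 2) 1 hG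
  have t2 := HasTaylorTwo.comp_affine (1 / 2) (-1) hG
  have t3 : HasTaylorTwo (fun z => Complex.sin (Real.pi * (1 / 2 + 1 * z))) 1 0
      (-(Real.pi : ℂ) ^ 2) := by
    have := HasTaylorTwo.comp_affine (f := fun z => Complex.sin (Real.pi * z)) (1 / 2) 1
      (by fun_prop)
    have d1 : deriv (fun z : ℂ => Complex.sin (Real.pi * z))
        = fun z => Real.pi * Complex.cos (Real.pi * z) := by
      ext z
      rw [deriv_comp_mul_left (Real.pi : ℂ) Complex.sin, Complex.deriv_sin, smul_eq_mul]
    have d2 : deriv (fun z : ℂ => Real.pi * Complex.cos (Real.pi * z))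
        = fun z => -((Real.pi : ℂ) ^ 2 * Complex.sin (Real.pi * z)) := by
      ext z
      rw [deriv_const_mul_field, deriv_comp_mul_left (Real.pi : ℂ) Complex.cos, Complex.deriv_cos,
        smul_eq_mul]
      ring
    rw [d1, d2] at this
    have e : (Real.pi : ℂ) * (1 / 2) = Real.pi / 2 := by ring
    simpa [e, ← div_eq_mul_inv] using this
  have t := (t1.mul t2).mul t3
  have hc : (fun z => Complex.Gamma (1 / 2 + 1 * z) * Complex.Gamma (1 / 2 + -1 * z)
      * Complex.sin (Real.pi * (1 / 2 + 1 * z))) =ᶠ[𝓝 0] fun _ => (Real.pi : ℂ) := by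
    have hs : ∀ᶠ z in 𝓝 (0 : ℂ), Complex.sin (Real.pi * (1 / 2 + 1 * z)) ≠ 0 := by
      refine t3.analyticAt.continuousAt.eventually_ne ?_
      rw [t3.value]
      exact one_ne_zero
    filter_upwards [hs] with z hz
    have := Complex.Gamma_mul_Gamma_one_sub (1 / 2 + 1 * z)
    rw [show 1 / 2 + -1 * z = 1 - (1 / 2 + 1 * z) by ring, this, div_mul_cancel₀ _ hz]
  have h := t.deriv_deriv_eq.symm.trans
    ((HasTaylorTwo.const (Real.pi : ℂ)).of_eventuallyEq hc).deriv_deriv_eq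
  rw [Complex.hasDerivAt_Gamma_one_half.deriv, Complex.Gamma_one_half_eq] at h
  have e5 : (Real.pi : ℂ) ^ (1 / 2 : ℂ) = ((√Real.pi : ℝ) : ℂ) := by
    rw [Real.sqrt_eq_rpow, Complex.ofReal_cpow Real.pi_pos.le]
    norm_num
  rw [e5] at h
  apply mul_left_cancel₀ hp
  generalize deriv (deriv Complex.Gamma) (1 / 2) = H at *
  linear_combination h / 2

/-- In the second-order coefficient of the duplication formula at 1/2, Γ''(1) occurs once on the
left and four times on the right, so it can be solved for in terms of Γ''(1/2). -/
theorem deriv_deriv_Gamma_one : deriv (deriv Complex.Gamma) 1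
    = (Real.eulerMascheroniConstant : ℂ) ^ 2 + (Real.pi : ℂ) ^ 2 / 6 := by
  have hp : ((√Real.pi : ℝ) : ℂ) ≠ 0 := by exact_mod_cast (Real.sqrt_pos.2 Real.pi_pos).ne'
  have t1 := HasTaylorTwo.comp_affine (1 / 2) 1
    (analyticAt_Gamma_of_re_pos (s := 1 / 2) (by norm_num))
  have t2 := HasTaylorTwo.comp_affine 1 1 (analyticAt_Gamma_of_re_pos (s := 1) (by norm_num))
  have t3 := HasTaylorTwo.comp_affine 1 2 (analyticAt_Gamma_of_re_pos (s := 1) (by norm_num))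
  have t4 := HasTaylorTwo.exp_mul (-(2 * Complex.log 2))
  have hc : (fun z => Complex.Gamma (1 / 2 + 1 * z) * Complex.Gamma (1 + 1 * z)) =ᶠ[𝓝 0]
      fun z => Complex.Gamma (1 + 2 * z) * Complex.exp (-(2 * Complex.log 2) * z)
        * (√Real.pi : ℂ) := by
    refine Eventually.of_forall fun z => ?_
    have h := Complex.Gamma_mul_Gamma_add_half (1 / 2 + 1 * z)
    rw [show 1 / 2 + 1 * z + 1 / 2 = 1 + 1 * z by ring,
      show 2 * (1 / 2 + 1 * z) = 1 + 2 * z by ring,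
      Complex.cpow_def_of_ne_zero two_ne_zero] at h
    refine h.trans ?_
    ring_nf
  have h := (t1.mul t2).deriv_deriv_eq.symm.trans
    (((t3.mul t4).mul (HasTaylorTwo.const (√Real.pi : ℂ))).of_eventuallyEq hc).deriv_deriv_eq
  have e5 : (Real.pi : ℂ) ^ (1 / 2 : ℂ) = ((√Real.pi : ℝ) : ℂ) := by
    rw [Real.sqrt_eq_rpow, Complex.ofReal_cpow Real.pi_pos.le]
    norm_num
  rw [deriv_deriv_Gamma_one_half, Complex.hasDerivAt_Gamma_one_half.deriv,
    Complex.Gamma_one_half_eq, Complex.hasDerivAt_Gamma_one.deriv, Complex.Gamma_one, e5] at h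
  generalize deriv (deriv Complex.Gamma) 1 = H at *
  apply mul_left_cancel₀ hp
  linear_combination -h / 3

theorem hasTaylorTwo_mellinFactor : HasTaylorTwo mellinFactor 1
    (2 + Real.eulerMascheroniConstant - 2 * Real.log 2)
    ((2 + Real.eulerMascheroniConstant - 2 * Real.log 2) ^ 2 - 4 + (Real.pi : ℂ) ^ 2 / 6
      - 8 * iteratedDeriv 2 riemannZeta 0
      - 4 * (Real.log 2 + Real.log Real.pi : ℂ) ^ 2) := by
  have hπ : (Real.pi : ℂ) ≠ 0 := by exact_mod_cast Real.pi_ne_zero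
  have t1 := HasTaylorTwo.comp_affine 0 (-2) (analyticOn_riemannZeta 0 (by simp))
  simp only [zero_add] at t1
  have t2 : HasTaylorTwo (fun s => (Real.pi : ℂ) ^ (2 * s)) 1 (2 * Real.log Real.pi)
      ((2 * Real.log Real.pi) ^ 2) := by
    refine (HasTaylorTwo.exp_mul (2 * Real.log Real.pi)).of_eventuallyEq
      (Eventually.of_forall fun z => ?_)
    simp only []
    rw [Complex.cpow_def_of_ne_zero hπ, Complex.ofReal_log Real.pi_pos.le]
    ring_nf
  have t3 := HasTaylorTwo.comp_affine 1 (-1) (analyticAt_Gamma_of_re_pos (s := 1) (by norm_num))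
  have t4 : HasTaylorTwo (fun s => 1 + 2 * s) 1 2 0 := by
    simpa using HasTaylorTwo.comp_affine (f := id) 1 2 (by fun_prop)
  have t := ((((HasTaylorTwo.const (-2)).mul t1).mul t2).mul t3).mul t4
  rw [deriv_deriv_Gamma_one, Complex.hasDerivAt_Gamma_one.deriv, Complex.Gamma_one,
    riemannZeta_zero, deriv_riemannZeta_zero] at t
  have hlog : Complex.log (2 * Real.pi) = Real.log 2 + Real.log Real.pi := by
    rw [← Complex.ofReal_add, ← Real.log_mul two_ne_zero Real.pi_ne_zero,
      Complex.ofReal_log (by positivity)]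
    push_cast
    rfl
  have hi : iteratedDeriv 2 riemannZeta 0 = deriv (deriv riemannZeta) 0 := by
    rw [iteratedDeriv_succ, iteratedDeriv_one]
  rw [hlog] at t
  rw [hi]
  refine ⟨t.analyticAt, t.value.trans ?_, t.deriv_eq.trans ?_, t.deriv_deriv_eq.trans ?_⟩
  · ring
  · ring
  · ring

/-- The first and second derivatives at 0 of s N(s) + 1 are N(0) and 2 N'(0). -/
theorem mellin_reducedTail_zero : mellin reducedTail 0 =
      2 + Real.eulerMascheroniConstant - 2 * Real.log 2 ∧
    2 * deriv (mellin reducedTail) 0 =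
      (2 + Real.eulerMascheroniConstant - 2 * Real.log 2) ^ 2 - 4 + (Real.pi : ℂ) ^ 2 / 6
      - 8 * iteratedDeriv 2 riemannZeta 0 - 4 * (Real.log 2 + Real.log Real.pi : ℂ) ^ 2 := by
  have ho : IsOpen ({s : ℂ | -(1 / 2) < s.re} ∩ {s | s.re < 1 / 2}) :=
    (isOpen_lt continuous_const Complex.continuous_re).inter
      (isOpen_lt Complex.continuous_re continuous_const)
  have h0 : (0 : ℂ) ∈ {s : ℂ | -(1 / 2) < s.re} ∩ {s | s.re < 1 / 2} := by
    constructor <;> norm_num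
  have hN : AnalyticAt ℂ (mellin reducedTail) 0 := by
    refine DifferentiableOn.analyticAt (fun z hz => ?_) (ho.mem_nhds h0)
    have hz1 : -(1 / 2) < z.re := hz.1
    have hz2 : z.re < 1 / 2 := hz.2
    exact (hasDerivAt_mellin_reducedTail (s := z) (by linarith)
      (by linarith)).differentiableAt.differentiableWithinAt
  have t1 : HasTaylorTwo (mellin reducedTail) _ _ _ := ⟨hN, rfl, rfl, rfl⟩
  have t2 : HasTaylorTwo (fun s => s) 0 1 0 := by
    simpa using HasTaylorTwo.comp_affine (f := id) 0 1 (by fun_prop)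
  have t := ((t2.mul t1).add (HasTaylorTwo.const 1)).of_eventuallyEq (g := mellinFactor) (by
    filter_upwards [ho.mem_nhds h0] with z hz
    exact (id_mul_mellin_reducedTail hz.1 hz.2).symm)
  have u := hasTaylorTwo_mellinFactor
  have e1 := t.deriv_eq.symm.trans u.deriv_eq
  have e2 := t.deriv_deriv_eq.symm.trans u.deriv_deriv_eq
  constructor
  · rw [← e1]
    ring
  · rw [← e2]
    ring

/-- Zeta commutes with complex conjugation, and differentiation preserves this symmetry. -/
theorem iteratedDeriv_two_riemannZeta_zero_im : (iteratedDeriv 2 riemannZeta 0).im = 0 := by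
  have h0 : (starRingEnd ℂ) ∘ riemannZeta ∘ (starRingEnd ℂ) = riemannZeta := by
    ext s
    simp [riemannZeta_conj]
  have h1 : (starRingEnd ℂ) ∘ deriv riemannZeta ∘ (starRingEnd ℂ) = deriv riemannZeta := by
    rw [← deriv_conj_conj, h0]
  have h2 : (starRingEnd ℂ) ∘ deriv (deriv riemannZeta) ∘ (starRingEnd ℂ)
      = deriv (deriv riemannZeta) := by
    rw [← deriv_conj_conj, h1]
  rw [iteratedDeriv_succ, iteratedDeriv_one]
  have := congrFun h2 0
  simp only [Function.comp_apply, map_zero] at this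
  exact Complex.conj_eq_iff_im.1 this

end LatticePath


/-! ### The fluctuations and their means -/

namespace LatticePath

open Filter Topology MeasureTheory

theorem hasSum_fourier_ne_zero {f f' : ℝ → ℝ} (hp : Function.Periodic f 1)
    (hd : ∀ x, HasDerivAt f (f' x) x) (hc : Continuous f') {m : ℝ}
    (hm : ∫ y in (0 : ℝ)..1, f y = m) {a : ℤ → ℂ}
    (ha : ∀ k : ℤ, k ≠ 0 → ∫ y in (0 : ℝ)..1, fourierExp k y * f y = a k) :
    HasFourierSeries a (fun x => f x - m) := by
  intro x
  -- Setting the coefficient at k = 0 to zero subtracts the mean from the sum.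
  have h := (hasSum_fourier_of_hasDerivAt hp hd hc x).update 0 0
  have h0 : ∫ y in (0 : ℝ)..1, fourierExp 0 y * f y = (m : ℂ) := by
    simp only [fourierExp_zero, one_mul]
    rw [intervalIntegral.integral_ofReal, hm]
  rw [h0, ← hasSum_subtype_iff_of_support_subset (s := {k : ℤ | k ≠ 0})] at h
  · convert! h using 1
    · ext k
      have hk : (k : ℤ) ≠ 0 := k.2
      simp only [Function.comp_apply, Function.update_of_ne hk]
      rw [ha _ hk]
    · simp
      ring
  · intro k hk h0
    subst h0
    simp at hk

theorem isPeriodicMeanZero_sub {f : ℝ → ℝ} (hp : Function.Periodic f 1) (hc : Continuous f)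
    {m : ℝ} (hm : ∫ y in (0 : ℝ)..1, f y = m) : IsPeriodicMeanZero (fun x => f x - m) := by
  refine ⟨fun x => by simp only [hp x], (hc.sub continuous_const).intervalIntegrable _ _, ?_⟩
  rw [intervalIntegral.integral_sub (hc.intervalIntegrable _ _) (by simp), hm]
  simp

/-- The mean of `firstSum logTail x - x`. -/
noncomputable def firstMean : ℝ :=
  (Real.eulerMascheroniConstant + 2 - 3 * Real.log 2) / (2 * Real.log 2)

/-- The constant term in the asymptotic expansion of the variance. -/
noncomputable def varianceConst : ℝ :=
  (Real.pi ^ 2 - 24 * Real.log Real.pi ^ 2 - 48 * (iteratedDeriv 2 riemannZeta 0).re - 24)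
    / (24 * Real.log 2 ^ 2) - 2 * Real.log Real.pi / Real.log 2 - 11 / 12

theorem chi_zero : chi 0 / 2 = 0 := by
  simp [chi]

theorem integral_firstSum_logTail :
    ∫ y in (0 : ℝ)..1, (firstSum logTail y - y) = firstMean := by
  obtain ⟨q', C, hq⟩ := exists_smoothStep_logTail
  have h := hq.integral_fourierExp_mul_firstSum 0
  rw [integral_fourierExp_mul_logTail, chi_zero, mellin_reducedTail_zero.1, log_four] at h
  simp only [fourierExp_zero, one_mul] at h
  rw [intervalIntegral.integral_ofReal, intervalIntegral.integral_ofReal, integral_id] at h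
  have h2 : Real.log 2 ≠ 0 := (Real.log_pos one_lt_two).ne'
  have h' : ∫ y in (0 : ℝ)..1, (firstSum logTail y - y)
      = (2 + Real.eulerMascheroniConstant - 2 * Real.log 2) / (2 * Real.log 2)
        - (1 ^ 2 - 0 ^ 2) / 2 := by
    exact_mod_cast h
  rw [h', firstMean]
  field_simp
  ring

/-- The square of the first mean is split off because it cancels against the square of the
expectation, leaving `varianceConst`. -/
theorem integral_secondPeriodic_logTail :
    ∫ y in (0 : ℝ)..1, secondPeriodic logTail y = firstMean ^ 2 + varianceConst := by
  obtain ⟨q', C, hq⟩ := exists_smoothStep_logTail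
  have h := hq.integral_fourierExp_mul_secondPeriodic 0
  have hz : iteratedDeriv 2 riemannZeta 0 = ((iteratedDeriv 2 riemannZeta 0).re : ℂ) :=
    Complex.ext rfl (by simpa using iteratedDeriv_two_riemannZeta_zero_im)
  have hD := mellin_reducedTail_zero.2
  rw [hz] at hD
  have hD' := eq_div_of_mul_eq two_ne_zero ((mul_comm _ _).trans hD)
  rw [integral_fourierExp_mul_linear_mul_logTail, chi_zero, mellin_reducedTail_zero.1, hD',
    log_four] at h
  simp only [fourierExp_zero, one_mul] at h
  have e : ∫ y in (0 : ℝ)..1, (y : ℂ) ^ 2 = ((∫ y in (0 : ℝ)..1, y ^ 2 : ℝ) : ℂ) := by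
    rw [← intervalIntegral.integral_ofReal]
    push_cast
    rfl
  rw [intervalIntegral.integral_ofReal, e, integral_pow] at h
  have h2 : Real.log 2 ≠ 0 := (Real.log_pos one_lt_two).ne'
  rw [firstMean, varianceConst]
  generalize (iteratedDeriv 2 riemannZeta 0).re = z at *
  have h' : ∫ y in (0 : ℝ)..1, secondPeriodic logTail y
      = (2 / (2 * Real.log 2) *
        (((2 + Real.eulerMascheroniConstant - 2 * Real.log 2) ^ 2 - 4 + Real.pi ^ 2 / 6
          - 8 * z - 4 * (Real.log 2 + Real.log Real.pi) ^ 2) / 2)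
        - (2 + Real.eulerMascheroniConstant - 2 * Real.log 2)) / (2 * Real.log 2)
        + (1 ^ (2 + 1) - 0 ^ (2 + 1)) / ((2 : ℕ) + 1) := by
    exact_mod_cast h
  rw [h']
  push_cast
  field_simp
  ring

/-- The fluctuation in the expected reduction degree. -/
noncomputable def deltaOne (x : ℝ) : ℝ := firstSum logTail x - x - firstMean

/-- The linear fluctuation in the variance of the reduction degree. -/
noncomputable def deltaTwo (x : ℝ) : ℝ :=
  secondPeriodic logTail x - (firstMean ^ 2 + varianceConst)

theorem hasFourierSeries_deltaOne :
    HasFourierSeries (fun k => Real.log 2 * coeffC k) deltaOne := by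
  obtain ⟨q', C, hq⟩ := exists_smoothStep_logTail
  obtain ⟨f', hd, hc⟩ := hq.exists_deriv_firstSum_sub
  exact hasSum_fourier_ne_zero hq.periodic_firstSum_sub hd hc integral_firstSum_logTail
    fun k hk => integral_fourierExp_mul_firstSum_logTail hk

theorem hasFourierSeries_deltaTwo :
    HasFourierSeries (fun k => coeffD k - coeffC k * Complex.digamma (1 + chi k / 2))
      deltaTwo := by
  obtain ⟨q', C, hq⟩ := exists_smoothStep_logTail
  obtain ⟨f', hd, hc⟩ := hq.exists_deriv_secondPeriodic
  exact hasSum_fourier_ne_zero hq.periodic_secondPeriodic hd hc integral_secondPeriodic_logTail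
    fun k hk => integral_fourierExp_mul_secondPeriodic_logTail hk

theorem isPeriodicMeanZero_deltaOne : IsPeriodicMeanZero deltaOne := by
  obtain ⟨q', C, hq⟩ := exists_smoothStep_logTail
  exact isPeriodicMeanZero_sub hq.periodic_firstSum_sub
    (hq.continuous_firstSum.sub continuous_id) integral_firstSum_logTail

theorem isPeriodicMeanZero_deltaTwo : IsPeriodicMeanZero deltaTwo := by
  obtain ⟨q', C, hq⟩ := exists_smoothStep_logTail
  refine isPeriodicMeanZero_sub hq.periodic_secondPeriodic ?_ integral_secondPeriodic_logTail
  exact (hq.continuous_secondSum.sub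
    ((continuous_const.mul continuous_id).mul hq.continuous_firstSum)).add (continuous_pow 2)

theorem exists_abs_deltaOne_le : ∃ M, ∀ x, |deltaOne x| ≤ M := by
  obtain ⟨q', C, hq⟩ := exists_smoothStep_logTail
  have hc : Continuous deltaOne := (hq.continuous_firstSum.sub continuous_id).sub continuous_const
  obtain ⟨M, hM⟩ := isCompact_Icc.exists_bound_of_continuousOn (s := Set.Icc (0 : ℝ) 1)
    hc.continuousOn
  refine ⟨M, fun x => ?_⟩
  obtain ⟨y, hy, hxy⟩ := isPeriodicMeanZero_deltaOne.1.exists_mem_Ico₀ one_pos x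
  rw [hxy]
  exact hM y ⟨hy.1, hy.2.le⟩

end LatticePath


/-! ### Moments as tail sums and passage to the limiting tail -/

namespace LatticePath

open Filter Topology MeasureTheory

theorem card_paths (n : ℕ) : Fintype.card (Fin n → Step) = 4 ^ n := by
  have : Fintype.card Step = 4 := rfl
  simp [this]

instance (n : ℕ) : IsProbabilityMeasure (uniformPath n) :=
  have : Nonempty (Fin n → Step) := ⟨fun _ => .up⟩
  ProbabilityTheory.isProbabilityMeasure_uniformOn Set.finite_univ Set.univ_nonempty

theorem integral_uniformPath (n : ℕ) (F : (Fin n → Step) → ℝ) :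
    ∫ p, F p ∂(uniformPath n) = (∑ p, F p) / 4 ^ n := by
  rw [integral_fintype Integrable.of_finite, Finset.sum_div]
  refine Finset.sum_congr rfl fun p _ => ?_
  have : (uniformPath n).real {p} = 1 / 4 ^ n := by
    rw [uniformPath, ProbabilityTheory.uniformOn, Measure.real,
      ProbabilityTheory.cond_apply MeasurableSet.univ]
    simp [Measure.count_univ, show Fintype.card Step = 4 from rfl]
  rw [this, smul_eq_mul]
  ring

/-- For r ≤ 0 the truncation `r.toNat` is 0 and the two indicators cancel, so only 1 ≤ r ≤ d
contribute. Indexing by all integers matches the shape of `shiftSum`. -/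
theorem hasSum_weight_tail (w : ℤ → ℝ) (d : ℕ) :
    HasSum (fun r : ℤ => w r * ((if r.toNat ≤ d then 1 else 0) - if r ≤ 0 then 1 else 0))
      (∑ i ∈ Finset.range d, w (i + 1)) := by
  have h := hasSum_sum_of_ne_finset_zero (L := SummationFilter.unconditional ℤ)
    (f := fun r : ℤ => w r * ((if r.toNat ≤ d then 1 else 0) - if r ≤ 0 then 1 else 0))
    (s := (Finset.range d).image fun i : ℕ => (i : ℤ) + 1) (fun r hr => ?_)
  · rw [Finset.sum_image (fun a _ b _ h => by simpa using h)] at h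
    convert! h using 1
    refine Finset.sum_congr rfl fun i hi => ?_
    have h1 : ((i : ℤ) + 1).toNat ≤ d := by
      have := Finset.mem_range.1 hi
      omega
    have h2 : ¬ ((i : ℤ) + 1 ≤ 0) := by omega
    rw [if_pos h1, if_neg h2, sub_zero, mul_one]
  · by_cases h0 : r ≤ 0
    · simp [h0, Int.toNat_of_nonpos h0]
    · have : ¬ r.toNat ≤ d := by
        intro hd
        refine hr (Finset.mem_image.2 ⟨r.toNat - 1, Finset.mem_range.2 (by omega), by omega⟩)
      simp [h0, this]

theorem hasSum_weight_degreeTail (w : ℤ → ℝ) (n : ℕ) :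
    HasSum (fun r : ℤ => w r * (degreeTail r.toNat n - if r ≤ 0 then 1 else 0))
      (∫ p, ∑ i ∈ Finset.range (rdeg (List.ofFn p)), w (i + 1) ∂(uniformPath n)) := by
  rw [integral_uniformPath]
  have h := (hasSum_sum (s := Finset.univ) fun (p : Fin n → Step) _ =>
    hasSum_weight_tail w (rdeg (List.ofFn p))).div_const (4 ^ n)
  convert! h using 1
  ext r
  rw [← Finset.mul_sum, Finset.sum_sub_distrib, Finset.sum_const, Finset.card_univ, card_paths,
    sum_ofFn n (fun l => if r.toNat ≤ rdeg l then 1 else 0), degreeTail]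
  simp only [nsmul_eq_mul]
  push_cast
  field_simp

theorem expectedD_eq_tsum (n : ℕ) : expectedD n =
    ∑' r : ℤ, (1 : ℝ) * (degreeTail r.toNat n - if r ≤ 0 then 1 else 0) := by
  rw [(hasSum_weight_degreeTail (fun _ => 1) n).tsum_eq]
  simp [expectedD, D]

theorem varianceD_eq_tsum (n : ℕ) : varianceD n =
    (∑' r : ℤ, (2 * (r : ℝ) - 1) * (degreeTail r.toNat n - if r ≤ 0 then 1 else 0))
      - expectedD n ^ 2 := by
  rw [varianceD, ProbabilityTheory.variance_eq_sub MemLp.of_discrete,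
    (hasSum_weight_degreeTail (fun r => 2 * r - 1) n).tsum_eq, expectedD]
  congr 1
  refine integral_congr_ae (Eventually.of_forall fun p => ?_)
  simp only [Pi.pow_apply, D]
  generalize rdeg (List.ofFn p) = d
  induction d with
  | zero => simp
  | succ d ih =>
    rw [Finset.sum_range_succ, ← ih]
    push_cast
    ring

theorem four_zpow_eq_exp (r : ℤ) : (4 : ℝ) ^ r = Real.exp (r * Real.log 4) := by
  rw [← Real.rpow_intCast, Real.rpow_def_of_pos (by norm_num), mul_comm]

theorem logTail_logb_sub (n : ℕ) (r : ℤ) :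
    logTail (Real.logb 4 ((n + 1 : ℕ) : ℝ) - r) = limitTail (4 ^ r / (n + 1)) := by
  have h4 : Real.log 4 ≠ 0 := by linarith [one_le_log_four]
  have hn : (0 : ℝ) < n + 1 := by positivity
  rw [logTail, four_zpow_eq_exp, Real.logb]
  congr 1
  push_cast
  rw [sub_mul, div_mul_cancel₀ _ h4, neg_sub, Real.exp_sub, Real.exp_log hn]

theorem abs_degreeTail_sub_logTail_le : ∃ C : ℝ, 0 < C ∧ ∀ (n : ℕ) (r : ℤ),
    |degreeTail r.toNat (n + 1) - logTail (Real.logb 4 ((n + 1 : ℕ) : ℝ) - r)|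
      ≤ C / (n + 1) * (Real.exp (-|Real.logb 4 ((n + 1 : ℕ) : ℝ) - r|)
        + Real.exp (-|(r : ℝ)|)) := by
  obtain ⟨C, hC, -, h2⟩ := limitTail_bounds
  have hL := one_le_log_four
  have hB : 0 ≤ baselSum := by
    have := (abs_nonneg _).trans (abs_degreeTail_sub_limitTail_le_mul 0 0)
    norm_num at this
    linarith
  refine ⟨C + 8000 * baselSum, by positivity, fun n r => ?_⟩
  have hn : (0 : ℝ) < n + 1 := by positivity
  set x := Real.logb 4 ((n + 1 : ℕ) : ℝ) with hx
  rw [hx, logTail_logb_sub, ← hx]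
  by_cases hr : r ≤ 0
  · have hr' : (r : ℝ) ≤ 0 := by exact_mod_cast hr
    have h4 : (4 : ℝ) ^ r ≤ Real.exp (-|(r : ℝ)|) := by
      rw [four_zpow_eq_exp, abs_of_nonpos hr']
      exact Real.exp_le_exp.2 (by nlinarith)
    have h41 : (4 : ℝ) ^ r ≤ 1 := h4.trans (Real.exp_le_one_iff.2 (by simp))
    rw [Int.toNat_of_nonpos hr, degreeTail_zero, abs_sub_comm]
    refine (h2 _ (by positivity) ?_).1.trans ?_
    · rw [div_le_one hn]
      linarith [(Nat.cast_nonneg n : (0 : ℝ) ≤ n)]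
    · calc C * (4 ^ r / (n + 1)) = C / (n + 1) * 4 ^ r := by ring
        _ ≤ (C + 8000 * baselSum) / (n + 1) * (Real.exp (-|x - r|) + Real.exp (-|(r : ℝ)|)) := by
          gcongr
          · linarith
          · linarith [Real.exp_pos (-|x - r|)]
  · obtain ⟨m, rfl⟩ : ∃ m : ℕ, r = (m + 1 : ℕ) := ⟨r.toNat - 1, by omega⟩
    have hexp : (4 : ℝ) ^ (m + 1) / (n + 1) = Real.exp (-((x - (m + 1 : ℕ)) * Real.log 4)) := by
      have h4 : Real.log 4 ≠ 0 := by linarith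
      have := four_zpow_eq_exp (m + 1 : ℕ)
      rw [zpow_natCast] at this
      rw [this, hx, Real.logb]
      push_cast
      rw [sub_mul, div_mul_cancel₀ _ h4, neg_sub, Real.exp_sub, Real.exp_log hn]
    rw [Int.toNat_natCast, zpow_natCast]
    have hle : |degreeTail (m + 1) (n + 1) - limitTail (4 ^ (m + 1) / (n + 1))|
        ≤ 8000 * baselSum / (n + 1) * Real.exp (-|x - (m + 1 : ℕ)|) := by
      rcases le_total 0 (x - (m + 1 : ℕ)) with h | h
      · refine (abs_degreeTail_sub_limitTail_le_mul m n).trans ?_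
        gcongr
        rw [hexp, abs_of_nonneg h]
        exact Real.exp_le_exp.2 (by nlinarith)
      · refine (abs_degreeTail_sub_limitTail_le_inv (m + 1) n ?_).trans ?_
        · have : (1 : ℝ) ≤ 4 ^ (m + 1) / (n + 1) := by
            rw [hexp]
            exact Real.one_le_exp (by nlinarith)
          rwa [le_div_iff₀ hn, one_mul] at this
        · gcongr
          · norm_num
          · rw [hexp, ← Real.exp_neg, abs_of_nonpos h]
            exact Real.exp_le_exp.2 (by nlinarith)
    refine hle.trans ?_
    push_cast
    gcongr
    · linarith
    · linarith [Real.exp_pos (-|((m : ℝ) + 1)|)]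

theorem tsum_weight_exp_le {w : ℤ → ℝ} {B x : ℝ}
    (hw : ∀ j : ℤ, |w (⌊x⌋ + j)| ≤ B * (2 * |(j : ℝ)| + 1)) :
    Summable (fun r : ℤ => |w r| * Real.exp (-|x - r|)) ∧
    ∑' r : ℤ, |w r| * Real.exp (-|x - r|)
      ≤ B * Real.exp 1 * ∑' r : ℤ, (2 * |(r : ℝ)| + 1) * Real.exp (-|(r : ℝ)|) := by
  have hB : 0 ≤ B := by
    have := (abs_nonneg _).trans (hw 0)
    simpa using this
  have hle : ∀ j : ℤ, |w (Equiv.addLeft ⌊x⌋ j)| * Real.exp (-|x - (Equiv.addLeft ⌊x⌋ j : ℤ)|)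
      ≤ B * Real.exp 1 * ((2 * |(j : ℝ)| + 1) * Real.exp (-|(j : ℝ)|)) := fun j => by
    have hf : |Int.fract x| ≤ 1 := by
      rw [abs_of_nonneg (Int.fract_nonneg x)]
      exact (Int.fract_lt_one x).le
    have h1 := exp_neg_abs_sub_le j hf
    rw [Int.fract, sub_sub] at h1
    simp only [Equiv.coe_addLeft, Int.cast_add]
    calc _ ≤ B * (2 * |(j : ℝ)| + 1) * (Real.exp 1 * Real.exp (-|(j : ℝ)|)) := by
          gcongr
          exact hw j
      _ = _ := by ring
  have hs := summable_int_weight.mul_left (B * Real.exp 1)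
  have hs' : Summable fun j : ℤ =>
      |w (Equiv.addLeft ⌊x⌋ j)| * Real.exp (-|x - (Equiv.addLeft ⌊x⌋ j : ℤ)|) :=
    hs.of_nonneg_of_le (fun j => by positivity) hle
  refine ⟨(Equiv.addLeft ⌊x⌋).summable_iff.1 hs', ?_⟩
  rw [← tsum_mul_left, ← (Equiv.addLeft ⌊x⌋).tsum_eq]
  exact hs'.tsum_le_tsum hle hs

/-- The error is concentrated near r = 0 and r = x. The number `B` measures the weight near ⌊x⌋ and
is the only source of growth beyond 1/(n + 1). -/
theorem exists_tsum_degreeTail_sub_shiftSum_le : ∃ C : ℝ, 0 < C ∧ ∀ (n : ℕ) (w : ℤ → ℝ) (B : ℝ),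
    1 ≤ B → (∀ r : ℤ, |w r| ≤ 2 * |(r : ℝ)| + 1) →
    (∀ j : ℤ, |w (⌊Real.logb 4 ((n + 1 : ℕ) : ℝ)⌋ + j)| ≤ B * (2 * |(j : ℝ)| + 1)) →
    |(∑' r : ℤ, w r * (degreeTail r.toNat (n + 1) - if r ≤ 0 then 1 else 0))
      - shiftSum logTail w (Real.logb 4 ((n + 1 : ℕ) : ℝ))| ≤ C * B / (n + 1) := by
  obtain ⟨C, hC, hle⟩ := abs_degreeTail_sub_logTail_le
  obtain ⟨q', K, hq⟩ := exists_smoothStep_logTail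
  set S := ∑' r : ℤ, (2 * |(r : ℝ)| + 1) * Real.exp (-|(r : ℝ)|) with hS
  have hS0 : 0 ≤ S := tsum_nonneg fun r => by positivity
  refine ⟨C * (Real.exp 1 + 1) * (S + 1), by positivity, fun n w B hB hw hwB => ?_⟩
  set x := Real.logb 4 ((n + 1 : ℕ) : ℝ) with hx
  obtain ⟨s1, b1⟩ := tsum_weight_exp_le hwB
  have s2 : Summable fun r : ℤ => |w r| * Real.exp (-|(r : ℝ)|) :=
    summable_int_weight.of_nonneg_of_le (fun r => by positivity) fun r => by
      gcongr
      exact hw r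
  have b2 : ∑' r : ℤ, |w r| * Real.exp (-|(r : ℝ)|) ≤ S :=
    s2.tsum_le_tsum (fun r => by gcongr; exact hw r) summable_int_weight
  have hs := (s1.add s2).mul_left (C / (n + 1))
  have hb : ∀ r : ℤ, ‖w r * (degreeTail r.toNat (n + 1) - if r ≤ 0 then 1 else 0)
      - w r * (logTail (x - r) - if r ≤ 0 then 1 else 0)‖
      ≤ C / (n + 1) * (|w r| * Real.exp (-|x - r|) + |w r| * Real.exp (-|(r : ℝ)|)) := fun r => by
    rw [← mul_sub, sub_sub_sub_cancel_right, norm_mul, Real.norm_eq_abs, Real.norm_eq_abs]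
    calc _ ≤ |w r| * (C / (n + 1) * (Real.exp (-|x - r|) + Real.exp (-|(r : ℝ)|))) := by
          gcongr
          exact hle n r
      _ = _ := by ring
  rw [shiftSum, ← (hasSum_weight_degreeTail w (n + 1)).summable.tsum_sub (hq.summable hw x)]
  refine (tsum_of_norm_bounded hs.hasSum hb).trans ?_
  rw [tsum_mul_left, s1.tsum_add s2]
  have : (0 : ℝ) < n + 1 := by positivity
  calc _ ≤ C / (n + 1) * (B * Real.exp 1 * S + B * S) := by
        gcongr
        nlinarith
    _ = C * (Real.exp 1 + 1) * S * B / (n + 1) := by ring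
    _ ≤ _ := by
      gcongr
      linarith

end LatticePath


/-! ### Asymptotics of expectation and variance -/

namespace LatticePath

open Filter Topology MeasureTheory

theorem exists_expectedD_sub_le : ∃ C : ℝ, 0 < C ∧ ∀ n : ℕ,
    |expectedD (n + 1) - firstSum logTail (Real.logb 4 ((n + 1 : ℕ) : ℝ))| ≤ C / (n + 1) := by
  obtain ⟨C, hC, h⟩ := exists_tsum_degreeTail_sub_shiftSum_le
  refine ⟨C, hC, fun n => ?_⟩
  have := h n (fun _ => 1) 1 le_rfl abs_one_le_weight fun j => by
    rw [one_mul]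
    exact abs_one_le_weight j
  rwa [mul_one, ← expectedD_eq_tsum] at this

theorem exists_varianceD_add_sub_le : ∃ C : ℝ, 0 < C ∧ ∀ n : ℕ,
    |varianceD (n + 1) + expectedD (n + 1) ^ 2
      - secondSum logTail (Real.logb 4 ((n + 1 : ℕ) : ℝ))|
      ≤ C * (2 * Real.logb 4 ((n + 1 : ℕ) : ℝ) + 1) / (n + 1) := by
  obtain ⟨C, hC, h⟩ := exists_tsum_degreeTail_sub_shiftSum_le
  refine ⟨C, hC, fun n => ?_⟩
  rw [varianceD_eq_tsum, sub_add_cancel]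
  have hx : 0 ≤ Real.logb 4 ((n + 1 : ℕ) : ℝ) :=
    Real.logb_nonneg (by norm_num) (by push_cast; linarith [(Nat.cast_nonneg n : (0 : ℝ) ≤ n)])
  refine h n (fun r => 2 * r - 1) _ (by linarith) abs_two_mul_sub_one_le_weight fun j => ?_
  generalize Real.logb 4 ((n + 1 : ℕ) : ℝ) = x at *
  -- Recentred at ⌊x⌋, the weight 2r - 1 is at most (2x + 1)(2|j| + 1); this is the origin of the
  -- factor log n in the variance error.
  have h1 : (⌊x⌋ : ℝ) ≤ x := Int.floor_le x
  have h2 : (0 : ℝ) ≤ ⌊x⌋ := by exact_mod_cast Int.floor_nonneg.2 hx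
  have h3 := abs_nonneg (j : ℝ)
  have h4 := mul_nonneg hx h3
  push_cast
  rw [abs_le]
  constructor <;> nlinarith [neg_abs_le (j : ℝ), le_abs_self (j : ℝ)]

theorem expectedD_isBigO :
    (fun n : ℕ => expectedD n - (Real.logb 4 n
        + (Real.eulerMascheroniConstant + 2 - 3 * Real.log 2) / (2 * Real.log 2)
        + deltaOne (Real.logb 4 n))) =O[atTop] (fun n : ℕ => (n : ℝ)⁻¹) := by
  obtain ⟨C, hC, h⟩ := exists_expectedD_sub_le
  refine Asymptotics.IsBigO.of_bound C ?_
  filter_upwards [eventually_ge_atTop 1] with n hn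
  obtain ⟨m, rfl⟩ : ∃ m, n = m + 1 := ⟨n - 1, by omega⟩
  have := h m
  rw [norm_inv, Real.norm_natCast, Real.norm_eq_abs, ← div_eq_mul_inv, deltaOne, firstMean]
  rw [Nat.cast_succ] at this ⊢
  refine le_of_eq_of_le ?_ this
  congr 1
  ring

theorem varianceD_isBigO :
    (fun n : ℕ => varianceD n - (varianceConst + deltaTwo (Real.logb 4 n)
        - 2 * firstMean * deltaOne (Real.logb 4 n) - deltaOne (Real.logb 4 n) ^ 2))
      =O[atTop] (fun n : ℕ => Real.log n / n) := by
  obtain ⟨C₁, hC₁, h₁⟩ := exists_expectedD_sub_le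
  obtain ⟨C₂, hC₂, h₂⟩ := exists_varianceD_add_sub_le
  obtain ⟨M, hM⟩ := exists_abs_deltaOne_le
  have hM0 : 0 ≤ M := (abs_nonneg _).trans (hM 0)
  refine Asymptotics.IsBigO.of_bound (3 * C₂ + 2 * C₁ * (M + 1 + |firstMean|) + C₁ ^ 2) ?_
  -- For n ≥ 4 one has log n ≥ 1, so constants are absorbed into log n.
  filter_upwards [eventually_ge_atTop 4] with n hn
  obtain ⟨m, rfl⟩ : ∃ m, n = m + 1 := ⟨n - 1, by omega⟩
  have e₁ := h₁ m
  have e₂ := h₂ m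
  set x := Real.logb 4 ((m + 1 : ℕ) : ℝ) with hx
  have hn4 : (4 : ℝ) ≤ ((m + 1 : ℕ) : ℝ) := by exact_mod_cast hn
  have hl : 1 ≤ Real.log ((m + 1 : ℕ) : ℝ) :=
    one_le_log_four.trans (Real.log_le_log (by norm_num) hn4)
  have hxl : x ≤ Real.log ((m + 1 : ℕ) : ℝ) :=
    div_le_self (by linarith) one_le_log_four
  have hx0 : 0 ≤ x := Real.logb_nonneg (by norm_num) (by linarith)
  rw [← Nat.cast_succ, Nat.succ_eq_add_one] at e₁ e₂
  generalize ((m + 1 : ℕ) : ℝ) = ν at *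
  have hν : 0 < ν := by linarith
  have hδ := hM x
  have hA : firstSum logTail x = x + firstMean + deltaOne x := by
    rw [deltaOne]
    ring
  have hAb : |firstSum logTail x| ≤ (M + 1 + |firstMean|) * Real.log ν := by
    rw [hA]
    calc |x + firstMean + deltaOne x| ≤ |x| + |firstMean| + |deltaOne x| := abs_add_three _ _ _
      _ ≤ Real.log ν + |firstMean| * Real.log ν + M * Real.log ν := by
        rw [abs_of_nonneg hx0]
        gcongr
        · exact le_mul_of_one_le_right (abs_nonneg _) hl
        · exact hδ.trans (le_mul_of_one_le_right hM0 hl)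
      _ = _ := by ring
  -- The main term is exactly S₂ - S₁², because S₁ - x is `firstMean` plus the first fluctuation.
  -- What remains are the errors of the two moments, with the expectation squared.
  have hkey : varianceD (m + 1) - (varianceConst + deltaTwo x - 2 * firstMean * deltaOne x
      - deltaOne x ^ 2) = (varianceD (m + 1) + expectedD (m + 1) ^ 2 - secondSum logTail x)
      - 2 * firstSum logTail x * (expectedD (m + 1) - firstSum logTail x)
      - (expectedD (m + 1) - firstSum logTail x) ^ 2 := by
    rw [deltaTwo, secondPeriodic, deltaOne]
    ring
  rw [hkey, Real.norm_eq_abs, Real.norm_eq_abs, abs_of_nonneg (a := Real.log ν / ν) (by positivity)]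
  generalize expectedD (m + 1) - firstSum logTail x = a at *
  generalize varianceD (m + 1) + expectedD (m + 1) ^ 2 - secondSum logTail x = b at *
  have hb : |b| ≤ 3 * C₂ * (Real.log ν / ν) := e₂.trans (by
    rw [mul_div_assoc', div_le_div_iff_of_pos_right hν]
    nlinarith)
  have ha : |2 * firstSum logTail x * a|
      ≤ 2 * C₁ * (M + 1 + |firstMean|) * (Real.log ν / ν) := by
    rw [abs_mul, abs_mul, abs_two]
    calc 2 * |firstSum logTail x| * |a|
        ≤ 2 * ((M + 1 + |firstMean|) * Real.log ν) * (C₁ / ν) := by gcongr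
      _ = _ := by ring
  have ha2 : |a ^ 2| ≤ C₁ ^ 2 * (Real.log ν / ν) := by
    rw [abs_pow]
    calc |a| ^ 2 ≤ (C₁ / ν) ^ 2 := by gcongr
      _ = C₁ ^ 2 * (1 / ν / ν) := by ring
      _ ≤ _ := by
        gcongr
        refine le_trans ?_ hl
        rw [div_le_one hν]
        linarith
  calc |b - 2 * firstSum logTail x * a - a ^ 2|
      ≤ |b| + |2 * firstSum logTail x * a| + |a ^ 2| :=
        (abs_sub _ _).trans (by gcongr; exact abs_sub _ _)
    _ ≤ _ := by linarith

end LatticePath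

theorem mainTheorem4 :
    ∃ δ₁ δ₂ : ℝ → ℝ,
      LatticePath.HasFourierSeries (fun k => Real.log 2 * LatticePath.coeffC k) δ₁ ∧
      LatticePath.HasFourierSeries
        (fun k => LatticePath.coeffD k
          - LatticePath.coeffC k * Complex.digamma (1 + LatticePath.chi k / 2)) δ₂ ∧
      LatticePath.IsPeriodicMeanZero δ₁ ∧
      LatticePath.IsPeriodicMeanZero δ₂ ∧
      (fun n : ℕ => LatticePath.expectedD n -
          (Real.logb 4 n
            + (Real.eulerMascheroniConstant + 2 - 3 * Real.log 2) / (2 * Real.log 2)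
            + δ₁ (Real.logb 4 n)))
        =O[Filter.atTop] (fun n : ℕ => (n : ℝ)⁻¹) ∧
      (iteratedDeriv 2 riemannZeta 0).im = 0 ∧
      (fun n : ℕ => LatticePath.varianceD n -
          ((Real.pi ^ 2 - 24 * Real.log Real.pi ^ 2 - 48 * (iteratedDeriv 2 riemannZeta 0).re - 24)
              / (24 * Real.log 2 ^ 2)
            - 2 * Real.log Real.pi / Real.log 2 - 11 / 12
            + δ₂ (Real.logb 4 n)
            - (Real.eulerMascheroniConstant + 2 - 3 * Real.log 2) / Real.log 2
              * δ₁ (Real.logb 4 n)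
            - δ₁ (Real.logb 4 n) ^ 2))
        =O[Filter.atTop] (fun n : ℕ => Real.log n / n) := by
  refine ⟨LatticePath.deltaOne, LatticePath.deltaTwo, LatticePath.hasFourierSeries_deltaOne,
    LatticePath.hasFourierSeries_deltaTwo, LatticePath.isPeriodicMeanZero_deltaOne,
    LatticePath.isPeriodicMeanZero_deltaTwo, LatticePath.expectedD_isBigO,
    LatticePath.iteratedDeriv_two_riemannZeta_zero_im, ?_⟩
  have h : (Real.eulerMascheroniConstant + 2 - 3 * Real.log 2) / Real.log 2
      = 2 * LatticePath.firstMean := by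
    rw [LatticePath.firstMean]
    have : Real.log 2 ≠ 0 := (Real.log_pos one_lt_two).ne'
    field_simp
  rw [h]
  exact LatticePath.varianceD_isBigO
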